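/- Consider, for $k=1,2,\dots$, multivariate linear regression models $Y=XB+V$ with sample size $n=n_k$, a deterministic design matrix $X\in\mathbb{R}^{n\times p}$ of full column rank, $p<n$, coefficient matrix $B\in\mathbb{R}^{p\times d}$, and innovation matrix $V=(V_1,\dots,V_n)^\top$ whose rows $V_i\in\mathbb{R}^d$ are i.i.d. with $\mathbb{E}V_1=0$ and covariance matrix $\Sigma\neq 0$ (finite second moments). Let $\mathcal{C}\in\mathbb{R}^{m\times p}$ have rank $m$, $1\le m\le p$. All of $n,p,d,m,X,\mathcal{C},B$ and the law of $V_1$ may vary with $k$, and limits are taken along the sequence of models. Put $$P=X(X^\top X)^{-1}\mathcal{C}^\top\{\mathcal{C}(X^\top X)^{-1}\mathcal{C}^\top\}^{-1}\mathcal{C}(X^\top X)^{-1}X^\top=(P_{ij}),\qquad Q_n=|PY|_{\mathbb F}^2,\qquad \varsigma=|\Sigma|_{\mathbb F},$$ where $|\cdot|_{\mathbb F}$ is the Frobenius norm. Let $G_n=|PZ|_{\mathbb F}^2$, where the rows of $Z\in\mathbb{R}^{n\times d}$ are i.i.d. $N(0,\Sigma)$, and let $\rho(S,T)=\sup_{z\in\mathbb{R}}|\mathbb{P}(S\le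 z)-\mathbb{P}(T\le z)|$. For $q=2+\delta$ with $0<\delta\le 1$ define $$M_q=\mathbb{E}\Big|\frac{V_1^\top V_2}{\varsigma}\Big|^q,\quad L_q=\mathbb{E}\Big|\frac{V_1^\top\Sigma V_1}{\varsigma^2}\Big|^{q/2},\quad \Delta_q=\frac{\sum_{i}\sum_{j\ne i}|P_{ij}|^q}{m^{q/2}}M_q+\frac{\sum_i P_{ii}^{q/2}}{m^{q/2}}L_q,$$ $$\Lambda^2=\frac{\sum_i P_{ii}^2\,\mathrm{Var}(V_1^\top V_1)}{m\varsigma^2},\quad \Lambda\ge 0,$$ all with values in $[0,\infty]$. There are constants $C_1,C_2\in(0,\infty)$ and, for every $q\in(2,3]$, a constant $C_q\in(0,\infty)$ depending only on $q$, such that the following holds for every sequence of models for which $m^{-1}\sum_i P_{ii}^2\to 0$, $\Delta_q\to 0$, and the null hypothesis $\mathcal{C}B=0$ holds. (i) If $\Lambda\to 0$, then for every model of the sequence $$\rho(Q_n,G_n)\le C_1\Lambda^{2/5}+C_q\Delta_q^{1/(2q+1)}+C_2\Big(\frac1m\sum_{i=1}^nP_{ii}^2\Big)^{1/5},$$ and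 the right-hand side tends to $0$. (ii) If $\Lambda$ is eventually finite, $\Lambda\to\infty$, and the Lindeberg condition holds for $W_i=\{P_{ii}V_i^\top V_i-\mathbb{E}(P_{ii}V_i^\top V_i)\}/(\Lambda\varsigma\sqrt m)$, that is, $\sum_{i=1}^n\mathbb{E}(W_i^2\,\mathbb{I}\{|W_i|>\epsilon\})\to 0$ for every $\epsilon>0$, then $(Q_n-m\,\mathrm{tr}\,\Sigma)/(\Lambda\varsigma\sqrt m)$ converges in distribution to $N(0,1)$. -/

import Mathlib

open MeasureTheory ProbabilityTheory Filter Topology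
open scoped ENNReal NNReal Matrix

noncomputable section

open scoped Matrix.Norms.Frobenius in
/-- The Frobenius norm of a real matrix. -/
def frobNorm {a b : ℕ} (A : Matrix (Fin a) (Fin b) ℝ) : ℝ := ‖A‖

/-- The Kolmogorov distance between (the laws of) two real random variables, which may live on
different probability spaces. -/
def kolmogorovDist {Ω Ω' : Type*} [MeasurableSpace Ω] [MeasurableSpace Ω']
    (S : Ω → ℝ) (μ : Measure Ω) (T : Ω' → ℝ) (μ' : Measure Ω') : ℝ :=
  ⨆ z : ℝ, |μ.real {ω | S ω ≤ z} - μ'.real {ω | T ω ≤ z}|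

/-- The matrix whose rows are the given vectors. -/
def rowMatrix {n d : ℕ} (v : Fin n → EuclideanSpace ℝ (Fin d)) : Matrix (Fin n) (Fin d) ℝ :=
  Matrix.of fun i j => v i j

/-- The multivariate linear regression model `Y = X B + V` with `n` observations, `p` predictors,
`d`-dimensional responses and `m` linear constraints given by the matrix `C`. The design is
deterministic of full column rank with `p < n`, `C` has rank `m`, and the rows `V 1, …, V n` of the
innovation matrix are independent with the common law `ν`, which is centred, has finite second
moments and is not degenerate at zero (its covariance matrix is nonzero). -/
structure ManovaModel where
  /-- sample size -/
  n : ℕ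
  /-- number of predictors -/
  p : ℕ
  /-- dimension of the responses -/
  d : ℕ
  /-- number of linear constraints -/
  m : ℕ
  one_le_m : 1 ≤ m
  m_le_p : m ≤ p
  p_lt_n : p < n
  /-- design matrix -/
  X : Matrix (Fin n) (Fin p) ℝ
  rank_X : X.rank = p
  /-- constraint matrix -/
  C : Matrix (Fin m) (Fin p) ℝ
  rank_C : C.rank = m
  /-- coefficient matrix -/
  B : Matrix (Fin p) (Fin d) ℝ
  /-- probability space carrying the innovations -/
  Ω : Type*
  [mΩ : MeasurableSpace Ω]
  μ : Measure Ω
  [prob_μ : IsProbabilityMeasure μ]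
  /-- common law of the innovation vectors -/
  ν : Measure (EuclideanSpace ℝ (Fin d))
  [prob_ν : IsProbabilityMeasure ν]
  /-- innovation vectors -/
  V : Fin n → Ω → EuclideanSpace ℝ (Fin d)
  hasLaw_V : ∀ i, HasLaw (V i) ν μ
  indep_V : iIndepFun V μ
  memLp_two : MemLp id 2 ν
  mean_zero : ∫ x, x ∂ν = 0
  nondegenerate : ∃ j k, cov[fun x => x j, fun x => x k; ν] ≠ 0

namespace ManovaModel

attribute [instance] ManovaModel.mΩ ManovaModel.prob_μ ManovaModel.prob_ν

variable (M : ManovaModel)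

/-- The null hypothesis `C B = 0`. -/
def NullHypothesis : Prop := M.C * M.B = 0

/-- The response matrix `Y = X B + V`. -/
def Y (ω : M.Ω) : Matrix (Fin M.n) (Fin M.d) ℝ :=
  M.X * M.B + rowMatrix fun i => M.V i ω

/-- The projection matrix
`P = X (XᵀX)⁻¹ Cᵀ {C (XᵀX)⁻¹ Cᵀ}⁻¹ C (XᵀX)⁻¹ Xᵀ`. -/
def P : Matrix (Fin M.n) (Fin M.n) ℝ :=
  M.X * (M.Xᵀ * M.X)⁻¹ * M.Cᵀ * (M.C * (M.Xᵀ * M.X)⁻¹ * M.Cᵀ)⁻¹ * M.C * (M.Xᵀ * M.X)⁻¹ * M.Xᵀ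

/-- The MANOVA statistic `Q_n = |P Y|_F ^ 2`. -/
def Q (ω : M.Ω) : ℝ := frobNorm (M.P * M.Y ω) ^ 2

/-- The covariance matrix `Σ` of the innovation vectors. -/
def Sigma : Matrix (Fin M.d) (Fin M.d) ℝ :=
  Matrix.of fun j k => cov[fun x => x j, fun x => x k; M.ν]

/-- `ς = |Σ|_F`. -/
def vsig : ℝ := frobNorm M.Sigma

/-- The joint law of the rows `Z 1, …, Z n`, i.i.d. `N(0, Σ)`. -/
def gaussLaw : Measure (Fin M.n → EuclideanSpace ℝ (Fin M.d)) :=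
  Measure.pi fun _ => multivariateGaussian 0 M.Sigma

/-- The Gaussian analogue `G_n = |P Z|_F ^ 2`, as a random variable on the space carrying `Z`. -/
def G (z : Fin M.n → EuclideanSpace ℝ (Fin M.d)) : ℝ := frobNorm (M.P * rowMatrix z) ^ 2

/-- `M_q = E |V₁ᵀ V₂ / ς| ^ q`, with values in `[0, ∞]`. -/
def Mq (q : ℝ) : ℝ≥0∞ :=
  ∫⁻ z, ENNReal.ofReal (|inner ℝ z.1 z.2 / M.vsig| ^ q) ∂(M.ν.prod M.ν)

/-- `L_q = E |V₁ᵀ Σ V₁ / ς ^ 2| ^ (q / 2)`, with values in `[0, ∞]`. -/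
def Lq (q : ℝ) : ℝ≥0∞ :=
  ∫⁻ x, ENNReal.ofReal (|(x.ofLp ⬝ᵥ (M.Sigma *ᵥ x.ofLp)) / M.vsig ^ 2| ^ (q / 2)) ∂M.ν

/-- `Δ_q`, with values in `[0, ∞]`. -/
def Delta (q : ℝ) : ℝ≥0∞ :=
  ENNReal.ofReal ((∑ i, ∑ j ∈ Finset.univ.erase i, |M.P i j| ^ q) / (M.m : ℝ) ^ (q / 2)) * M.Mq q
    + ENNReal.ofReal ((∑ i, M.P i i ^ (q / 2)) / (M.m : ℝ) ^ (q / 2)) * M.Lq q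

/-- `m⁻¹ ∑ P_ii ^ 2`. -/
def leverage : ℝ := (∑ i, M.P i i ^ 2) / M.m

/-- `Λ`, the nonnegative root of `∑ P_ii ^ 2 ‖E₀(V₁ᵀ V₁)‖₂ ^ 2 / (m ς ^ 2)`, with values in
`[0, ∞]`; it is finite iff `V₁ᵀ V₁` has finite variance. -/
def Lam : ℝ≥0∞ :=
  (ENNReal.ofReal ((∑ i, M.P i i ^ 2) / (M.m * M.vsig ^ 2)) *
    evariance (fun x => inner ℝ x x) M.ν) ^ (1 / 2 : ℝ)

/-- The normalization `Λ ς √m` (meaningful when `Λ` is finite). -/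
def scale : ℝ := M.Lam.toReal * M.vsig * √M.m

/-- `W_i = E₀(P_ii V_iᵀ V_i) / (Λ ς √m)`. -/
def W (i : Fin M.n) (ω : M.Ω) : ℝ :=
  (M.P i i * inner ℝ (M.V i ω) (M.V i ω)
    - ∫ ω', M.P i i * inner ℝ (M.V i ω') (M.V i ω') ∂M.μ) / M.scale

/-- The Gaussian approximation bound
`C₁ Λ ^ (2/5) + C_q Δ_q ^ (1/(2q+1)) + C₂ (m⁻¹ ∑ P_ii ^ 2) ^ (1/5)`, with values in `[0, ∞]`. -/
def approxBound (C₁ Cq C₂ : ℝ≥0) (q : ℝ) : ℝ≥0∞ :=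
  C₁ * M.Lam ^ (2 / 5 : ℝ) + Cq * M.Delta q ^ (1 / (2 * q + 1))
    + C₂ * ENNReal.ofReal M.leverage ^ (1 / 5 : ℝ)

end ManovaModel

end

/-! Since `P` is symmetric and idempotent and annihilates `X B` under the null hypothesis, the
statistic is the quadratic form ∑ P_ij ⟨V_i, V_j⟩, and its Gaussian analogue is the same form in
Gaussian rows. As tr P = m, `quadForm_P` splits the form into T + D + m tr Σ, with T the
off-diagonal part and D the centred diagonal part. The natural unit is s = ς√m: E T² ≤ 4 s², while D
has variance Λ² s² when Λ is finite. So Λ decides which of the two parts matters.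

Small Λ. Chebyshev's inequality discards D, at cost Λ²/h² for the innovations and leverage/h² up to
a constant for Gaussian rows. T is affine in each row, so Lindeberg's swapping argument
(`ofReal_abs_integral_quadForm_sub_le`) replaces the rows one by one by Gaussian ones. The first two
moments match, and the remainder of order q, for a smooth step of width h s, costs Δ_q/h^q once
Rosenthal's inequality has controlled the slopes ∑ P_ij x_j. Returning from smooth steps to
distribution functions requires that G does not charge short intervals. Diagonalizing P ⊗ Σ turns G
into ∑ λ_k x_k² with standard Gaussian x and ∑ λ_k² = s²; its characteristic function decays like |t
s|^(-1/2), whence an interval of half-length h s has probability O(h^(1/2)). Balancing each error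
against h^(1/2) produces the exponents 2/5, 1/(2q+1) and 1/5.

Large Λ. After division by Λ s the part T is at most 2/Λ in L¹, and D is the sum of the independent
W_i, whose variances add up to one. Lindeberg's central limit theorem, proved with explicit bounds
on characteristic functions, and Lévy's continuity theorem conclude. -/

/-! ### Smooth test functions and their Taylor estimates -/

/-- A function with bounded second and third derivatives satisfies a second order Taylor estimate
with remainder of any order `q ∈ [2, 3]`. -/
theorem abs_taylor_two_le {g g₁ g₂ g₃ : ℝ → ℝ} (h₁ : ∀ x, HasDerivAt g (g₁ x) x)
    (h₂ : ∀ x, HasDerivAt g₁ (g₂ x) x) (h₃ : ∀ x, HasDerivAt g₂ (g₃ x) x) {K₂ K₃ : ℝ}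
    (hK₂ : ∀ x, |g₂ x| ≤ K₂) (hK₃ : ∀ x, |g₃ x| ≤ K₃) {q : ℝ} (hq : 2 ≤ q) (hq' : q ≤ 3)
    (a y : ℝ) :
    |g (a + y) - g a - g₁ a * y - g₂ a * y ^ 2 / 2| ≤ (2 * K₂ + K₃) * |y| ^ q := by
  have hK₂0 : 0 ≤ K₂ := (abs_nonneg _).trans (hK₂ 0)
  have hK₃0 : 0 ≤ K₃ := (abs_nonneg _).trans (hK₃ 0)
  -- The mean value inequality, used twice, bounds the remainder by |y|² times the oscillation of
  -- the second derivative on the ball of radius |y|.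
  have key : ∀ c : ℝ, (∀ u ∈ Metric.closedBall (0 : ℝ) |y|, |g₂ (a + u) - g₂ a| ≤ c) →
      |g (a + y) - g a - g₁ a * y - g₂ a * y ^ 2 / 2| ≤ c * |y| ^ 2 := by
    intro c hc
    have hconv : Convex ℝ (Metric.closedBall (0 : ℝ) |y|) := convex_closedBall _ _
    have h0 : (0 : ℝ) ∈ Metric.closedBall (0 : ℝ) |y| := by simp
    have hy : y ∈ Metric.closedBall (0 : ℝ) |y| := by simp
    have hc0 : 0 ≤ c := (abs_nonneg _).trans (hc 0 h0)
    have d1 : ∀ u ∈ Metric.closedBall (0 : ℝ) |y|,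
        |g₁ (a + u) - g₁ a - g₂ a * u| ≤ c * |y| := by
      intro u hu
      have := hconv.norm_image_sub_le_of_norm_hasDerivWithin_le
        (f := fun u => g₁ (a + u) - g₂ a * u) (f' := fun u => g₂ (a + u) - g₂ a) (C := c)
        (fun v _ => (((h₂ (a + v)).comp_const_add a v).sub
          (by simpa using (hasDerivAt_id v).const_mul (g₂ a))).hasDerivWithinAt)
        (fun v hv => hc v hv) h0 hu
      simp only [add_zero, mul_zero, sub_zero, Real.norm_eq_abs] at this
      have hu' : |u| ≤ |y| := by simpa using hu
      calc _ = |g₁ (a + u) - g₂ a * u - g₁ a| := by congr 1; ring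
        _ ≤ c * |u| := this
        _ ≤ c * |y| := by gcongr
    have := hconv.norm_image_sub_le_of_norm_hasDerivWithin_le
        (f := fun u => g (a + u) - g₁ a * u - g₂ a * u ^ 2 / 2)
        (f' := fun u => g₁ (a + u) - g₁ a - g₂ a * u) (C := c * |y|)
        (fun v _ => by
          have e1 := (h₁ (a + v)).comp_const_add a v
          have e2 := (hasDerivAt_id v).const_mul (g₁ a)
          have e3 := (((hasDerivAt_id v).pow 2).const_mul (g₂ a)).div_const 2
          have := (e1.sub e2).sub e3
          refine (this.congr_deriv ?_).hasDerivWithinAt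
          simp; ring)
        (fun v hv => d1 v hv) h0 hy
    simp only [add_zero, mul_zero, sub_zero, Real.norm_eq_abs] at this
    calc _ = |g (a + y) - g₁ a * y - g₂ a * y ^ 2 / 2 - g a| := by congr 1; ring
      _ ≤ c * |y| * |y| := by simpa using this
      _ = _ := by ring
  -- For |y| ≤ 1 the oscillation is at most K₃|y| and |y|³ ≤ |y|^q; for |y| ≥ 1 it is at most 2K₂
  -- and |y|² ≤ |y|^q.
  rcases le_total |y| 1 with hy1 | hy1
  · have := key (K₃ * |y|) (fun u hu => by
      have := (convex_univ (𝕜 := ℝ) (E := ℝ)).norm_image_sub_le_of_norm_hasDerivWithin_le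
        (f := g₂) (f' := g₃) (C := K₃) (fun v _ => (h₃ v).hasDerivWithinAt)
        (fun v _ => hK₃ v) (Set.mem_univ a) (Set.mem_univ (a + u))
      simp only [add_sub_cancel_left, Real.norm_eq_abs] at this
      exact this.trans (mul_le_mul_of_nonneg_left (by simpa using hu) hK₃0))
    refine this.trans ?_
    have h3 : |y| ^ (3 : ℝ) ≤ |y| ^ q := by
      rcases (abs_nonneg y).eq_or_lt with h | h
      · rw [← h, Real.zero_rpow (by norm_num), Real.zero_rpow (by linarith)]
      · exact Real.rpow_le_rpow_of_exponent_ge h hy1 hq'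
    have h3' : |y| ^ (3 : ℝ) = |y| ^ (3 : ℕ) := by rw [← Real.rpow_natCast]; norm_num
    rw [h3'] at h3
    calc K₃ * |y| * |y| ^ 2 = K₃ * |y| ^ 3 := by ring
      _ ≤ K₃ * |y| ^ q := by gcongr
      _ ≤ _ := by gcongr; linarith
  · have := key (2 * K₂) (fun u _ => by
      refine (abs_sub _ _).trans ?_
      linarith [hK₂ (a + u), hK₂ a])
    refine this.trans ?_
    have h2 : |y| ^ (2 : ℝ) ≤ |y| ^ q := Real.rpow_le_rpow_of_exponent_le hy1 hq
    rw [Real.rpow_two] at h2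
    calc 2 * K₂ * |y| ^ 2 ≤ 2 * K₂ * |y| ^ q := by gcongr
      _ ≤ _ := by gcongr; linarith

/-- A smooth approximation of the indicator function of `(-∞, 0]`, with its first two derivatives
and a Taylor estimate. -/
theorem exists_smooth_step : ∃ (g g₁ g₂ : ℝ → ℝ) (K : ℝ), 0 < K ∧ Continuous g ∧
    (∀ x, 0 ≤ g x) ∧ (∀ x, g x ≤ 1) ∧ (∀ x ≤ 0, g x = 1) ∧ (∀ x, 1 ≤ x → g x = 0) ∧
    ∀ q : ℝ, 2 ≤ q → q ≤ 3 → ∀ a y : ℝ,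
      |g (a + y) - g a - g₁ a * y - g₂ a * y ^ 2 / 2| ≤ K * |y| ^ q := by
  set g : ℝ → ℝ := fun x => Real.smoothTransition (1 - x) with hg
  have hsm : ContDiff ℝ 3 g := Real.smoothTransition.contDiff.comp (by fun_prop)
  have hsm1 : ContDiff ℝ 2 (deriv g) := (contDiff_succ_iff_deriv (n := 2).1 hsm).2.2
  have hsm2 : ContDiff ℝ 1 (deriv (deriv g)) := (contDiff_succ_iff_deriv (n := 1).1 hsm1).2.2
  have hsm3 : ContDiff ℝ 0 (deriv (deriv (deriv g))) :=
    (contDiff_succ_iff_deriv (n := 0).1 hsm2).2.2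
  have hone : ∀ x ≤ 0, g x = 1 := fun x hx => Real.smoothTransition.one_of_one_le (by linarith)
  have hzero : ∀ x, 1 ≤ x → g x = 0 :=
    fun x hx => Real.smoothTransition.zero_of_nonpos (by linarith)
  -- `g` is constant off [0, 1], so its derivatives have compact support there; continuity then
  -- bounds the second and third ones.
  have hc1 : HasCompactSupport (deriv g) := by
    refine HasCompactSupport.of_support_subset_isCompact (isCompact_Icc (a := (0 : ℝ)) (b := 1)) ?_
    intro x hx
    by_contra hx'
    apply hx
    rw [Set.mem_Icc, not_and_or, not_le, not_le] at hx'
    rcases hx' with h | h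
    · have : g =ᶠ[𝓝 x] fun _ => 1 := by
        filter_upwards [eventually_lt_nhds h] with z hz using hone z hz.le
      simp [this.deriv_eq]
    · have : g =ᶠ[𝓝 x] fun _ => 0 := by
        filter_upwards [eventually_gt_nhds h] with z hz using hzero z hz.le
      simp [this.deriv_eq]
  obtain ⟨K₂, hK₂⟩ := hc1.deriv.exists_bound_of_continuous hsm2.continuous
  obtain ⟨K₃, hK₃⟩ := hc1.deriv.deriv.exists_bound_of_continuous hsm3.continuous
  have hK₂0 : 0 ≤ K₂ := (norm_nonneg _).trans (hK₂ 0)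
  have hK₃0 : 0 ≤ K₃ := (norm_nonneg _).trans (hK₃ 0)
  refine ⟨g, deriv g, deriv (deriv g), 2 * K₂ + K₃ + 1, by positivity, hsm.continuous,
    fun x => Real.smoothTransition.nonneg _, fun x => Real.smoothTransition.le_one _, hone, hzero,
    fun q hq hq' a y => ?_⟩
  refine (abs_taylor_two_le (fun x => (hsm.differentiable (by norm_num) x).hasDerivAt)
    (fun x => (hsm1.differentiable (by norm_num) x).hasDerivAt)
    (fun x => (hsm2.differentiable (by norm_num) x).hasDerivAt) hK₂ hK₃ hq hq' a y).trans ?_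
  exact mul_le_mul_of_nonneg_right (by linarith) (by positivity)

/-! ### Rosenthal's inequality -/

/-- The linear term keeps its exact coefficient because it will integrate to zero. For |t| ≤ 1,
factor out (1 + t)² and apply Bernoulli's inequality to the power q − 2 ∈ [0, 1]. For |t| ≥ 1, 2^q ≤
8 and −qt ≤ 3|t|^q, whence 11 = 8 + 3. -/
theorem abs_one_add_rpow_le {q : ℝ} (hq : 2 ≤ q) (hq' : q ≤ 3) (t : ℝ) :
    |1 + t| ^ q ≤ 1 + q * t + 11 * (t ^ 2 + |t| ^ q) := by
  have hp : 0 ≤ |t| ^ q := by positivity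
  rcases le_total |t| 1 with h | h
  · have ht := abs_le.1 h
    have h0 : 0 ≤ 1 + t := by linarith
    rw [abs_of_nonneg h0]
    have e : (1 + t) ^ q = (1 + t) ^ 2 * (1 + t) ^ (q - 2) := by
      rcases h0.eq_or_lt with h | h
      · rw [← h, Real.zero_rpow (by linarith)]; simp
      · rw [← Real.rpow_two, ← Real.rpow_add h]; ring_nf
    have b := rpow_one_add_le_one_add_mul_self (s := t) ht.1 (p := q - 2) (by linarith)
      (by linarith)
    rw [e]
    have : (1 + t) ^ 2 * (1 + t) ^ (q - 2) ≤ (1 + t) ^ 2 * (1 + (q - 2) * t) := by gcongr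
    have h1 : (q - 2) * t ≤ 1 := by nlinarith
    nlinarith [sq_nonneg t, mul_nonneg (sq_nonneg t) (sub_nonneg.2 h1)]
  · have h1 : |1 + t| ≤ 2 * |t| := (abs_add_le _ _).trans (by simp; linarith)
    have h2 : |1 + t| ^ q ≤ (2 * |t|) ^ q := by gcongr
    rw [Real.mul_rpow (by norm_num) (abs_nonneg t)] at h2
    have h3 : (2 : ℝ) ^ q ≤ 8 := by
      calc (2 : ℝ) ^ q ≤ 2 ^ (3 : ℝ) := Real.rpow_le_rpow_of_exponent_le (by norm_num) hq'
        _ = 8 := by norm_num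
    have h4 : |t| ≤ |t| ^ q := by
      calc |t| = |t| ^ (1 : ℝ) := (Real.rpow_one _).symm
        _ ≤ _ := Real.rpow_le_rpow_of_exponent_le h (by linarith)
    have h5 : -(q * t) ≤ 3 * |t| := by
      have := neg_abs_le t
      nlinarith [abs_nonneg t]
    nlinarith [sq_nonneg t]

/-- The previous inequality at t = y/x, multiplied by |x|^q. In every mixed term x and y factor, so
that expectations factor under independence. -/
theorem abs_add_rpow_le {q : ℝ} (hq : 2 < q) (hq' : q ≤ 3) (x y : ℝ) :
    |x + y| ^ q ≤ |x| ^ q + q * (|x| ^ (q - 2) * x * y)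
      + 11 * (|x| ^ (q - 2) * y ^ 2 + |y| ^ q) := by
  rcases eq_or_ne x 0 with rfl | hx
  · have : 0 ≤ |y| ^ q := by positivity
    simp [Real.zero_rpow (show q ≠ 0 by linarith), Real.zero_rpow (show q - 2 ≠ 0 by linarith)]
    linarith
  have hx' : 0 < |x| := abs_pos.2 hx
  have e := abs_one_add_rpow_le hq.le hq' (y / x)
  have e2 := mul_le_mul_of_nonneg_left e (show 0 ≤ |x| ^ q by positivity)
  have a1 : |x| ^ q * |1 + y / x| ^ q = |x + y| ^ q := by
    rw [← Real.mul_rpow (abs_nonneg _) (abs_nonneg _), ← abs_mul]; congr 2; field_simp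
  have a2 : |x| ^ q * |y / x| ^ q = |y| ^ q := by
    rw [← Real.mul_rpow (abs_nonneg _) (abs_nonneg _), ← abs_mul]; congr 2; field_simp
  have a3 : |x| ^ q = |x| ^ (q - 2) * x ^ 2 := by
    rw [← sq_abs x, ← Real.rpow_two, ← Real.rpow_add hx']; ring_nf
  rw [a1] at e2
  refine e2.trans (le_of_eq ?_)
  have a4 : |x| ^ q * (q * (y / x)) = q * (|x| ^ (q - 2) * x * y) := by rw [a3]; field_simp
  have a5 : |x| ^ q * (y / x) ^ 2 = |x| ^ (q - 2) * y ^ 2 := by rw [a3]; field_simp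
  linear_combination a4 + 11 * a5 + 11 * a2

theorem MeasureTheory.MemLp.integrable_abs_rpow {Ω : Type*} {mΩ : MeasurableSpace Ω} {μ : Measure Ω}
    [IsFiniteMeasure μ] {X : Ω → ℝ} {q : ℝ} (hX : MemLp X (ENNReal.ofReal q) μ) {r : ℝ}
    (hr : 0 ≤ r) (hrq : r ≤ q) : Integrable (fun ω => |X ω| ^ r) μ := by
  rcases hr.eq_or_lt with rfl | hr0
  · simp
  have := (hX.mono_exponent (ENNReal.ofReal_le_ofReal hrq)).integrable_norm_rpow
    (by simpa using hr0) (by simp)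
  simpa [ENNReal.toReal_ofReal hr] using this

/-- Jensen's inequality for the concave power r/2 applied to X². -/
theorem integral_abs_rpow_le_of_le_two {Ω : Type*} {mΩ : MeasurableSpace Ω} {μ : Measure Ω}
    [IsProbabilityMeasure μ] {X : Ω → ℝ} (hX : MemLp X 2 μ) {r : ℝ} (hr : 0 ≤ r) (hr2 : r ≤ 2) :
    ∫ ω, |X ω| ^ r ∂μ ≤ (∫ ω, X ω ^ 2 ∂μ) ^ (r / 2) := by
  have e : ∀ ω, |X ω| ^ r = (X ω ^ 2) ^ (r / 2) := fun ω => by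
    rw [← sq_abs, ← Real.rpow_natCast, ← Real.rpow_mul (abs_nonneg _)]; congr 1; push_cast; ring
  have hX' : MemLp X (ENNReal.ofReal 2) μ := by simpa using hX
  have hi : Integrable (fun ω => |X ω| ^ r) μ := hX'.integrable_abs_rpow hr hr2
  simp_rw [e] at hi ⊢
  exact (Real.concaveOn_rpow (p := r / 2) (by linarith) (by linarith)).le_map_integral
    (Real.continuous_rpow_const (by linarith)).continuousOn isClosed_Ici
    (ae_of_all _ fun ω => Set.mem_Ici.2 (sq_nonneg _)) hX.integrable_sq hi

/-- **Rosenthal's inequality** for exponents `q ∈ (2, 3]`. -/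
theorem integral_abs_sum_rpow_le {Ω ι : Type*} {mΩ : MeasurableSpace Ω} {μ : Measure Ω}
    [IsProbabilityMeasure μ] {q : ℝ} (hq : 2 < q) (hq' : q ≤ 3) {X : ι → Ω → ℝ}
    (hm : ∀ i, Measurable (X i)) (hind : iIndepFun X μ)
    (hX : ∀ i, MemLp (X i) (ENNReal.ofReal q) μ) (h0 : ∀ i, ∫ ω, X i ω ∂μ = 0) (s : Finset ι) :
    ∫ ω, |∑ i ∈ s, X i ω| ^ q ∂μ ≤
      11 * (∑ i ∈ s, ∫ ω, |X i ω| ^ q ∂μ + (∑ i ∈ s, ∫ ω, X i ω ^ 2 ∂μ) ^ (q / 2)) := by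
  classical
  have h2q : (2 : ℝ≥0∞) ≤ ENNReal.ofReal q := by
    rw [← ENNReal.ofReal_ofNat]; exact ENNReal.ofReal_le_ofReal hq.le
  have h1q : (1 : ℝ≥0∞) ≤ ENNReal.ofReal q := le_trans (by norm_num) h2q
  have hX2 : ∀ i, MemLp (X i) 2 μ := fun i => (hX i).mono_exponent h2q
  set B : ℝ := ∑ i ∈ s, ∫ ω, X i ω ^ 2 ∂μ with hB
  have hv0 : ∀ i, 0 ≤ ∫ ω, X i ω ^ 2 ∂μ := fun i => integral_nonneg fun ω => sq_nonneg _
  have hB0 : 0 ≤ B := Finset.sum_nonneg fun i _ => hv0 i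
  -- Induction with `B` frozen at the variance of the full sum. The coefficient of E|S|^q is one at
  -- each stage, so the constant 11 does not accumulate; the cross term vanishes by independence and
  -- centring.
  have key : ∀ t ⊆ s, ∫ ω, (∑ i ∈ t, X i ω) ^ 2 ∂μ = ∑ i ∈ t, ∫ ω, X i ω ^ 2 ∂μ ∧
      ∫ ω, |∑ i ∈ t, X i ω| ^ q ∂μ ≤
        11 * ∑ i ∈ t, (∫ ω, |X i ω| ^ q ∂μ + (∫ ω, X i ω ^ 2 ∂μ) * B ^ ((q - 2) / 2)) := by
    intro t
    induction t using Finset.induction_on with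
    | empty => intro _; simp [Real.zero_rpow (show q ≠ 0 by linarith)]
    | insert a t ha ih =>
      intro hts
      obtain ⟨ih2, ihq⟩ := ih ((Finset.subset_insert _ _).trans hts)
      set S : Ω → ℝ := fun ω => ∑ i ∈ t, X i ω with hS
      have hSm : Measurable S := Finset.measurable_sum _ fun i _ => hm i
      have hSq : MemLp S (ENNReal.ofReal q) μ := memLp_finsetSum _ fun i _ => hX i
      have hS2 : MemLp S 2 μ := hSq.mono_exponent h2q
      have hSY : IndepFun S (X a) μ := by
        have := hind.indepFun_finsetSum_of_notMem hm ha
        rwa [show (∑ j ∈ t, X j) = S by ext ω; simp [hS]] at this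
      have hYi := (hX a).integrable h1q
      have hSi := hSq.integrable h1q
      have cross : ∫ ω, S ω * X a ω ∂μ = 0 := by
        have := hSY.integral_mul_eq_mul_integral hSm.aestronglyMeasurable
          (hm a).aestronglyMeasurable
        simpa [h0 a] using this
      have cross_i : Integrable (fun ω => S ω * X a ω) μ := hSY.integrable_mul hSi hYi
      have hiS2 := hS2.integrable_sq
      have hiY2 := (hX2 a).integrable_sq
      have hsum : ∀ ω, ∑ i ∈ insert a t, X i ω = S ω + X a ω := fun ω => by
        rw [Finset.sum_insert ha, add_comm]
      simp_rw [hsum]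
      refine ⟨?_, ?_⟩
      · have : ∀ ω, (S ω + X a ω) ^ 2 = S ω ^ 2 + 2 * (S ω * X a ω) + X a ω ^ 2 :=
          fun ω => by ring
        simp_rw [this]
        have i12 : Integrable (fun ω => S ω ^ 2 + 2 * (S ω * X a ω)) μ :=
          hiS2.add (cross_i.const_mul 2)
        rw [integral_add i12 hiY2,
          integral_add hiS2 (cross_i.const_mul 2), integral_const_mul, cross, ih2,
          Finset.sum_insert ha]
        ring
      have m1 : Measurable fun x : ℝ => |x| ^ (q - 2) := by fun_prop
      have m2 : Measurable fun x : ℝ => |x| ^ (q - 2) * x := by fun_prop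
      have ind1 : IndepFun (fun ω => |S ω| ^ (q - 2) * S ω) (X a) μ :=
        hSY.comp m2 measurable_id
      have ind2 : IndepFun (fun ω => |S ω| ^ (q - 2)) (fun ω => X a ω ^ 2) μ :=
        hSY.comp m1 (measurable_id.pow_const 2)
      have hi_qm1 : Integrable (fun ω => |S ω| ^ (q - 2) * S ω) μ := by
        refine (hSq.integrable_abs_rpow (r := q - 1) (by linarith) (by linarith)).mono'
          (m2.comp hSm).aestronglyMeasurable (ae_of_all _ fun ω => ?_)
        rw [Real.norm_eq_abs, abs_mul, abs_of_nonneg (Real.rpow_nonneg (abs_nonneg _) _)]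
        rcases eq_or_ne (S ω) 0 with h | h
        · simp [h]; positivity
        · conv_lhs => rw [← Real.rpow_one |S ω|]
          rw [Real.rpow_one, ← Real.rpow_add_one (abs_pos.2 h).ne']
          apply le_of_eq; ring_nf
      have hi_qm2 := hSq.integrable_abs_rpow (r := q - 2) (by linarith) (by linarith)
      have hiSq := hSq.integrable_abs_rpow (r := q) (by linarith) le_rfl
      have hiYq := (hX a).integrable_abs_rpow (r := q) (by linarith) le_rfl
      have i1 : Integrable (fun ω => |S ω| ^ (q - 2) * S ω * X a ω) μ :=
        ind1.integrable_mul hi_qm1 hYi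
      have i2 : Integrable (fun ω => |S ω| ^ (q - 2) * X a ω ^ 2) μ :=
        ind2.integrable_mul hi_qm2 hiY2
      have v1 : ∫ ω, |S ω| ^ (q - 2) * S ω * X a ω ∂μ = 0 := by
        have := ind1.integral_mul_eq_mul_integral (m2.comp hSm).aestronglyMeasurable
          (hm a).aestronglyMeasurable
        simpa [h0 a] using this
      have v2 : ∫ ω, |S ω| ^ (q - 2) * X a ω ^ 2 ∂μ =
          (∫ ω, |S ω| ^ (q - 2) ∂μ) * ∫ ω, X a ω ^ 2 ∂μ :=
        ind2.integral_mul_eq_mul_integral (m1.comp hSm).aestronglyMeasurable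
          ((hm a).pow_const 2).aestronglyMeasurable
      -- Here q − 2 ≤ 2 lets the second moment of the partial sum, at most `B`, control this moment.
      have j1 : ∫ ω, |S ω| ^ (q - 2) ∂μ ≤ B ^ ((q - 2) / 2) := by
        refine (integral_abs_rpow_le_of_le_two hS2 (by linarith) (by linarith)).trans ?_
        refine Real.rpow_le_rpow (integral_nonneg fun ω => sq_nonneg _) ?_ (by linarith)
        rw [ih2]
        exact Finset.sum_le_sum_of_subset_of_nonneg ((Finset.subset_insert _ _).trans hts)
          fun i _ _ => hv0 i
      have k1 : Integrable (fun ω => |S ω| ^ q + q * (|S ω| ^ (q - 2) * S ω * X a ω)) μ :=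
        hiSq.add (i1.const_mul q)
      have k2 : Integrable (fun ω => |S ω| ^ (q - 2) * X a ω ^ 2 + |X a ω| ^ q) μ := i2.add hiYq
      calc ∫ ω, |S ω + X a ω| ^ q ∂μ
          ≤ ∫ ω, (|S ω| ^ q + q * (|S ω| ^ (q - 2) * S ω * X a ω)
              + 11 * (|S ω| ^ (q - 2) * X a ω ^ 2 + |X a ω| ^ q)) ∂μ := by
            refine integral_mono_of_nonneg (ae_of_all _ fun ω => by positivity)
              (k1.add (k2.const_mul 11))
              (ae_of_all _ fun ω => abs_add_rpow_le hq hq' _ _)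
        _ = ∫ ω, |S ω| ^ q ∂μ + 11 * ((∫ ω, |S ω| ^ (q - 2) ∂μ) * (∫ ω, X a ω ^ 2 ∂μ)
              + ∫ ω, |X a ω| ^ q ∂μ) := by
            rw [integral_add k1 (k2.const_mul 11),
              integral_add hiSq (i1.const_mul q), integral_const_mul, integral_const_mul,
              integral_add i2 hiYq, v1, v2]
            ring
        _ ≤ _ := by
            rw [Finset.sum_insert ha]
            have := mul_le_mul_of_nonneg_right j1 (hv0 a)
            linarith
  refine (key s subset_rfl).2.trans (le_of_eq ?_)
  rw [Finset.sum_add_distrib, ← Finset.sum_mul, ← hB]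
  congr 2
  -- The identity B · B^((q-2)/2) = B^(q/2) is read off separately at B = 0, where the exponent rule
  -- for `rpow` is not available.
  rcases hB0.eq_or_lt with h | h
  · rw [← h, zero_mul, Real.zero_rpow (by linarith)]
  · conv_lhs => rw [← Real.rpow_one B]
    rw [Real.rpow_one, mul_comm, ← Real.rpow_add_one h.ne']; ring_nf

/-! ### Anti-concentration of weighted sums of Gaussian squares -/

/-- The characteristic function of a weighted sum of squares decays at worst like |t|^(-1/2). This
integrability makes the constant finite when that decay is averaged against a Gaussian kernel. -/
theorem integrable_abs_rpow_neg_half_gaussianReal :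
    Integrable (fun x : ℝ => |x| ^ (-(1 / 2) : ℝ)) (gaussianReal 0 1) := by
  rw [gaussianReal_of_var_ne_zero _ one_ne_zero,
    integrable_withDensity_iff (measurable_gaussianPDF _ _)
      (ae_of_all _ fun _ => gaussianPDF_lt_top)]
  simp_rw [toReal_gaussianPDF]
  have hpos : IntegrableOn (fun x : ℝ => |x| ^ (-(1 / 2) : ℝ) * gaussianPDFReal 0 1 x)
      (Set.Ioi 0) := by
    have := (integrableOn_rpow_mul_exp_neg_mul_sq (b := 1 / 2) (by norm_num)
      (s := -(1 / 2)) (by norm_num)).const_mul (√(2 * Real.pi))⁻¹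
    refine IntegrableOn.congr_fun this (fun x hx => ?_) measurableSet_Ioi
    rw [gaussianPDFReal, abs_of_pos (Set.mem_Ioi.1 hx)]
    simp only [NNReal.coe_one, mul_one, sub_zero]
    rw [show -(1 / 2) * x ^ 2 = -x ^ 2 / 2 by ring]
    ring
  rw [← integrableOn_univ, ← @Set.Iio_union_Ici _ _ (0 : ℝ), integrableOn_union,
    integrableOn_Ici_iff_integrableOn_Ioi]
  refine ⟨?_, hpos⟩
  rw [← (Measure.measurePreserving_neg (volume : Measure ℝ)).integrableOn_comp_preimage
      (Homeomorph.neg ℝ).measurableEmbedding]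
  simpa [Function.comp_def, gaussianPDFReal] using hpos

/-- The Gaussian integral with complex parameter b = 1/2 − it equals (π/b)^(1/2), and |b| = ½√(1 +
4t²). -/
theorem norm_integral_cexp_mul_sq_gaussianReal (t : ℝ) :
    ‖∫ x, Complex.exp (t * x ^ 2 * Complex.I) ∂(gaussianReal 0 1)‖
      = (1 + 4 * t ^ 2) ^ (-(1 / 4) : ℝ) := by
  rw [integral_gaussianReal_eq_integral_smul one_ne_zero]
  set b : ℂ := 1 / 2 - t * Complex.I with hb
  have hre : 0 < b.re := by simp [hb]
  have hnorm : ‖b‖ = (1 / 2) * √(1 + 4 * t ^ 2) := by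
    rw [Complex.norm_eq_sqrt_sq_add_sq, hb]
    have h4 : (1 / 2 : ℝ) = √(1 / 4) := by
      rw [show (1 / 4 : ℝ) = (1 / 2) ^ 2 by norm_num, Real.sqrt_sq (by norm_num)]
    rw [h4, ← Real.sqrt_mul (by norm_num)]
    congr 1
    simp
    ring
  have e : ∀ x : ℝ, gaussianPDFReal 0 1 x • Complex.exp (t * x ^ 2 * Complex.I)
      = ((√(2 * Real.pi))⁻¹ : ℂ) * Complex.exp (-b * (x : ℂ) ^ 2) := by
    intro x
    rw [gaussianPDFReal, Complex.real_smul]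
    push_cast
    rw [mul_assoc, ← Complex.exp_add, hb]
    simp only [mul_one]
    congr 2
    ring
  simp_rw [e]
  rw [integral_const_mul, integral_gaussian_complex hre, norm_mul,
    show (1 / 2 : ℂ) = ((1 / 2 : ℝ) : ℂ) by push_cast; ring,
    Complex.norm_cpow_real, norm_div, hnorm]
  have hpi : 0 < Real.pi := Real.pi_pos
  have hs : 0 < 1 + 4 * t ^ 2 := by positivity
  simp only [norm_inv, Complex.norm_real, Real.norm_eq_abs, abs_of_pos hpi,
    abs_of_nonneg (Real.sqrt_nonneg _)]
  rw [show Real.pi / (1 / 2 * √(1 + 4 * t ^ 2)) = (2 * Real.pi) * (√(1 + 4 * t ^ 2))⁻¹ by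
    field_simp, Real.mul_rpow (by positivity) (by positivity), ← Real.sqrt_eq_rpow, ← mul_assoc,
    inv_mul_cancel₀ (by positivity), one_mul, Real.sqrt_eq_rpow, ← Real.rpow_neg hs.le,
    ← Real.rpow_mul hs.le]
  norm_num

section SumSquares

variable {ι : Type*} [Fintype ι]

/-- The integral factors over coordinates, and ∏(1 + a_i) ≥ 1 + ∑ a_i for a_i ≥ 0. The resulting
bound sees only ∑ l_i², even if a single weight carries all of it. -/
theorem norm_integral_cexp_sum_mul_sq_le (l : ι → ℝ) (t : ℝ) :
    ‖∫ x : ι → ℝ, Complex.exp (((t * ∑ i, l i * x i ^ 2 : ℝ) : ℂ) * Complex.I)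
      ∂(Measure.pi fun _ => gaussianReal 0 1)‖
      ≤ (1 + 4 * t ^ 2 * ∑ i, l i ^ 2) ^ (-(1 / 4) : ℝ) := by
  have e : ∀ x : ι → ℝ, Complex.exp (((t * ∑ i, l i * x i ^ 2 : ℝ) : ℂ) * Complex.I)
      = ∏ i, Complex.exp (((t * l i : ℝ) : ℂ) * (x i : ℂ) ^ 2 * Complex.I) := by
    intro x
    rw [← Complex.exp_sum]
    congr 1
    push_cast
    rw [Finset.mul_sum, Finset.sum_mul]
    exact Finset.sum_congr rfl fun i _ => by ring
  simp_rw [e]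
  rw [integral_fintype_prod_eq_prod (𝕜 := ℂ)
    (f := fun i (y : ℝ) => Complex.exp (((t * l i : ℝ) : ℂ) * (y : ℂ) ^ 2 * Complex.I)), norm_prod]
  simp_rw [norm_integral_cexp_mul_sq_gaussianReal]
  rw [Real.finsetProd_rpow _ _ fun i _ => by positivity]
  refine Real.rpow_le_rpow_of_nonpos (by positivity) ?_ (by norm_num)
  have : ∀ s : Finset ι, 1 + 4 * t ^ 2 * ∑ i ∈ s, l i ^ 2 ≤ ∏ i ∈ s, (1 + 4 * (t * l i) ^ 2) := by
    classical
    intro s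
    induction s using Finset.induction_on with
    | empty => simp
    | insert a s ha ih =>
      rw [Finset.sum_insert ha, Finset.prod_insert ha]
      have h1 : 1 ≤ ∏ i ∈ s, (1 + 4 * (t * l i) ^ 2) := by
        refine le_trans ?_ ih
        have : 0 ≤ ∑ i ∈ s, l i ^ 2 := Finset.sum_nonneg fun i _ => sq_nonneg _
        nlinarith [mul_nonneg (sq_nonneg t) this]
      nlinarith [sq_nonneg (t * l a)]
  exact this Finset.univ

/-- **Anti-concentration** for weighted sums of squares of independent standard Gaussians. -/
theorem exists_gaussian_sq_anticoncentration : ∃ K : ℝ, 0 < K ∧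
    ∀ {ι : Type} [Fintype ι] (l : ι → ℝ) (τ : ℝ), 0 < τ → ∑ i, l i ^ 2 = τ ^ 2 →
    ∀ z h : ℝ, 0 < h →
      (Measure.pi fun _ : ι => gaussianReal 0 1).real {x | |∑ i, l i * x i ^ 2 - z| ≤ h}
        ≤ K * (h / τ) ^ (1 / 2 : ℝ) := by
  set J : ℝ := ∫ x, |x| ^ (-(1 / 2) : ℝ) ∂(gaussianReal 0 1) with hJ
  have hJ0 : 0 ≤ J := integral_nonneg fun x => by positivity
  refine ⟨Real.exp (1 / 2) * (J + 1), by positivity, fun {ι} _ l τ hτ hl z h hh => ?_⟩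
  set μ := Measure.pi fun _ : ι => gaussianReal 0 1
  set S : (ι → ℝ) → ℝ := fun x => ∑ i, l i * x i ^ 2 with hS
  have hSm : Measurable S := by fun_prop
  -- The kernel exp(−u²/2) dominates the indicator of |u| ≤ 1 up to the factor e^(1/2) and is itself
  -- the characteristic function of a standard Gaussian y. By Fubini, its mean at (S − z)/h becomes
  -- an average over y of the characteristic function of S at y/h.
  have kernel : ∀ u : ℝ, ((Real.exp (-u ^ 2 / 2) : ℝ) : ℂ)
      = ∫ y, Complex.exp (u * y * Complex.I) ∂(gaussianReal 0 1) := by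
    intro u
    rw [← charFun_apply_real, charFun_gaussianReal]
    push_cast; congr 1; simp; ring
  have hbd : ∀ u : ℝ, 0 ≤ Real.exp (-u ^ 2 / 2) ∧ Real.exp (-u ^ 2 / 2) ≤ 1 := fun u =>
    ⟨by positivity, Real.exp_le_one_iff.2 (by nlinarith [sq_nonneg u])⟩
  have step1 : μ.real {x | |S x - z| ≤ h}
      ≤ Real.exp (1 / 2) * ∫ x, Real.exp (-((S x - z) / h) ^ 2 / 2) ∂μ := by
    have hms : MeasurableSet {x | |S x - z| ≤ h} :=
      measurableSet_le (by fun_prop) measurable_const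
    rw [← integral_indicator_one hms, ← integral_const_mul]
    refine integral_mono_of_nonneg (ae_of_all _ fun x => Set.indicator_nonneg (by simp) _) ?_
      (ae_of_all _ fun x => ?_)
    · refine (Integrable.of_bound (by fun_prop) 1 (ae_of_all _ fun x => ?_)).const_mul _
      rw [Real.norm_eq_abs, abs_of_nonneg (hbd _).1]; exact (hbd _).2
    · by_cases hx : x ∈ {x | |S x - z| ≤ h}
      · simp only [Set.indicator_of_mem hx, Pi.one_apply]
        rw [← Real.exp_add, Real.one_le_exp_iff]
        have h1 : |(S x - z) / h| ≤ 1 := by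
          rw [abs_div, abs_of_pos hh]; exact (div_le_one hh).2 hx
        have := (sq_le_one_iff_abs_le_one _).2 h1
        linarith
      · simp only [Set.indicator_of_notMem hx]; positivity
  have step2 : ∫ x, Real.exp (-((S x - z) / h) ^ 2 / 2) ∂μ
      ≤ ∫ y, (h / τ) ^ (1 / 2 : ℝ) * |y| ^ (-(1 / 2) : ℝ) ∂(gaussianReal 0 1) := by
    have h0 : 0 ≤ ∫ x, Real.exp (-((S x - z) / h) ^ 2 / 2) ∂μ :=
      integral_nonneg fun x => (hbd _).1
    calc ∫ x, Real.exp (-((S x - z) / h) ^ 2 / 2) ∂μ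
        = ‖((∫ x, Real.exp (-((S x - z) / h) ^ 2 / 2) ∂μ : ℝ) : ℂ)‖ := by
          rw [Complex.norm_real, Real.norm_eq_abs, abs_of_nonneg h0]
      _ = ‖∫ x, ∫ y, Complex.exp ((((S x - z) / h : ℝ) : ℂ) * y * Complex.I)
            ∂(gaussianReal 0 1) ∂μ‖ := by
          rw [← integral_complex_ofReal]; simp_rw [kernel]
      _ = ‖∫ y, ∫ x, Complex.exp ((((S x - z) / h : ℝ) : ℂ) * y * Complex.I) ∂μ
            ∂(gaussianReal 0 1)‖ := by
          rw [integral_integral_swap]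
          refine Integrable.of_bound (Measurable.aestronglyMeasurable ?_) 1
            (ae_of_all _ fun p => ?_)
          · have : Measurable fun p : (ι → ℝ) × ℝ => S p.1 := hSm.comp measurable_fst
            simp only [Function.uncurry_def]; fun_prop
          · simp only [Function.uncurry_def]
            rw [← Complex.ofReal_mul, Complex.norm_exp_ofReal_mul_I]
      _ ≤ ∫ y, (h / τ) ^ (1 / 2 : ℝ) * |y| ^ (-(1 / 2) : ℝ) ∂(gaussianReal 0 1) := by
          refine norm_integral_le_of_norm_le
            (integrable_abs_rpow_neg_half_gaussianReal.const_mul _) ?_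
          -- The point 0 must be excluded: `rpow` gives 0 to a negative power the value 0, which
          -- would not dominate the integrand there.
          have hne : ∀ᵐ y ∂(gaussianReal 0 1), y ≠ 0 := by
            have := nullSingletonClass_gaussianReal (μ := 0) (v := 1) one_ne_zero
            exact (gaussianReal 0 1).ae_ne 0
          filter_upwards [hne] with y hy
          have e : ∀ x : ι → ℝ, Complex.exp ((((S x - z) / h : ℝ) : ℂ) * y * Complex.I)
              = Complex.exp (((-(z * y / h) : ℝ) : ℂ) * Complex.I)
                * Complex.exp (((y / h * S x : ℝ) : ℂ) * Complex.I) := by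
            intro x
            rw [← Complex.exp_add]; congr 1; push_cast; ring
          simp_rw [e]
          rw [integral_const_mul, norm_mul, Complex.norm_exp_ofReal_mul_I, one_mul]
          refine (norm_integral_cexp_sum_mul_sq_le l (y / h)).trans ?_
          rw [hl]
          have hy' : 0 < |y| := abs_pos.2 hy
          -- Discarding the 1 and the factor 4 leaves a pure power of |y|τ/h.
          have h1 : (1 + 4 * (y / h) ^ 2 * τ ^ 2) ^ (-(1 / 4) : ℝ)
              ≤ ((|y| * (τ / h)) ^ 2) ^ (-(1 / 4) : ℝ) := by
            refine Real.rpow_le_rpow_of_nonpos (by positivity) ?_ (by norm_num)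
            rw [mul_pow, sq_abs, div_pow, div_pow]
            have : 0 ≤ y ^ 2 * (τ ^ 2 / h ^ 2) := by positivity
            calc y ^ 2 * (τ ^ 2 / h ^ 2) ≤ 1 + 4 * (y ^ 2 * (τ ^ 2 / h ^ 2)) := by linarith
              _ = _ := by ring
          refine h1.trans (le_of_eq ?_)
          rw [← Real.rpow_natCast, ← Real.rpow_mul (by positivity),
            Real.mul_rpow (by positivity) (by positivity), mul_comm]
          norm_num
          rw [Real.rpow_neg (by positivity), ← Real.inv_rpow (by positivity), inv_div]
          exact Or.inl rfl
  rw [integral_const_mul, ← hJ] at step2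
  have hk : 0 ≤ (h / τ) ^ (1 / 2 : ℝ) := by positivity
  calc _ ≤ _ := step1
    _ ≤ Real.exp (1 / 2) * ((h / τ) ^ (1 / 2 : ℝ) * J) := by gcongr
    _ ≤ Real.exp (1 / 2) * (J + 1) * (h / τ) ^ (1 / 2 : ℝ) := by
      have : 0 ≤ Real.exp (1 / 2) * (h / τ) ^ (1 / 2 : ℝ) := by positivity
      nlinarith

end SumSquares

/-! ### Diagonalization and moments of Gaussian quadratic forms -/

section Diagonalization

variable {ι : Type*} [Fintype ι] [DecidableEq ι] {A : Matrix ι ι ℝ}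

/-- Both sides are the trace of A². -/
theorem Matrix.IsHermitian.sum_eigenvalues_sq (hA : A.IsHermitian) :
    ∑ i, hA.eigenvalues i ^ 2 = ∑ i, ∑ j, A i j ^ 2 := by
  have h1 : (A * A).trace = ∑ i, ∑ j, A i j ^ 2 := by
    simp only [Matrix.trace, Matrix.diag, Matrix.mul_apply]
    refine Finset.sum_congr rfl fun i _ => Finset.sum_congr rfl fun j _ => ?_
    have := hA.apply i j
    simp only [star_trivial] at this
    rw [this, sq]
  rw [← h1]
  conv_rhs => rw [hA.spectral_theorem, ← map_mul, Unitary.conjStarAlgAut_apply,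
    Matrix.trace_mul_cycle, Unitary.coe_star_mul_self, one_mul, Matrix.diagonal_mul_diagonal,
    Matrix.trace_diagonal]
  exact Finset.sum_congr rfl fun i _ => by simp [sq]

/-- The standard Gaussian law has independent standard coordinates in every orthonormal basis, in
particular in an eigenbasis of A. -/
theorem map_dotProduct_mulVec_pi_gaussianReal (hA : A.IsHermitian) :
    (Measure.pi fun _ : ι => gaussianReal 0 1).map (fun x => x ⬝ᵥ A *ᵥ x)
      = (Measure.pi fun _ : ι => gaussianReal 0 1).map
        (fun x => ∑ i, hA.eigenvalues i * x i ^ 2) := by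
  set F : EuclideanSpace ℝ ι → ℝ := fun v => v.ofLp ⬝ᵥ A *ᵥ v.ofLp with hF
  have hFm : Measurable F := by
    have : F = fun v => inner ℝ v (Matrix.toEuclideanCLM (𝕜 := ℝ) A v) := by
      ext v; rw [Matrix.inner_toEuclideanCLM]
    rw [this]; fun_prop
  have h1 := congrArg (Measure.map F) (map_pi_eq_stdGaussian (ι := ι))
  rw [stdGaussian_eq_map_pi_orthonormalBasis hA.eigenvectorBasis,
    Measure.map_map hFm (by fun_prop), Measure.map_map hFm (by fun_prop)] at h1
  refine (Eq.trans ?_ h1).trans ?_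
  · rfl
  · congr 1
    ext x
    simp only [Function.comp, hF]
    rw [← Matrix.inner_toEuclideanCLM, map_sum]
    have : ∀ i, Matrix.toEuclideanCLM (𝕜 := ℝ) A (x i • hA.eigenvectorBasis i)
        = (hA.eigenvalues i * x i) • hA.eigenvectorBasis i := by
      intro i
      rw [map_smul, mul_comm, mul_smul]
      congr 1
      have := hA.mulVec_eigenvectorBasis i
      ext k
      exact congrFun this k
    simp_rw [this]
    rw [hA.eigenvectorBasis.orthonormal.inner_sum]
    refine Finset.sum_congr rfl fun i _ => ?_
    simp; ring

end Diagonalization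

theorem measurable_sum_mul_sq {ι : Type*} [Fintype ι] (l : ι → ℝ) :
    Measurable fun x : ι → ℝ => ∑ i, l i * x i ^ 2 := by
  fun_prop

theorem measurable_dotProduct_mulVec {d : ℕ} (S : Matrix (Fin d) (Fin d) ℝ) :
    Measurable fun x : EuclideanSpace ℝ (Fin d) => x.ofLp ⬝ᵥ S *ᵥ x.ofLp := by
  simp_rw [← Matrix.inner_toEuclideanCLM]
  fun_prop

theorem dotProduct_mulVec_nonneg {d : ℕ} {S : Matrix (Fin d) (Fin d) ℝ} (hS : S.PosSemidef)
    (x : Fin d → ℝ) : 0 ≤ x ⬝ᵥ S *ᵥ x := by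
  simpa using hS.dotProduct_mulVec_nonneg x

/-- The fourth moment of the standard Gaussian, plus one. -/
noncomputable def gaussianFourthMoment : ℝ := 1 + ∫ x, x ^ 4 ∂(gaussianReal 0 1)

/-- The purpose of the added one: powers of the constant can be compared through their exponents,
and the constant can be inserted as a factor in upper bounds. -/
theorem one_le_gaussianFourthMoment : 1 ≤ gaussianFourthMoment := by
  have : 0 ≤ ∫ x, x ^ 4 ∂(gaussianReal 0 1) := integral_nonneg fun x => by positivity
  unfold gaussianFourthMoment; linarith

theorem integrable_pow_four_gaussianReal :
    Integrable (fun x : ℝ => x ^ 4) (gaussianReal 0 1) := by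
  have := (memLp_id_gaussianReal' (μ := 0) (v := 1) (4 : ℕ) (by simp)).integrable_norm_pow
    (by norm_num)
  refine this.congr (ae_of_all _ fun x => ?_)
  simp only [id, Real.norm_eq_abs]
  rw [show (4 : ℕ) = 2 * 2 by norm_num, pow_mul, pow_mul, sq_abs]

theorem memLp_sq_gaussianReal : MemLp (fun x : ℝ => x ^ 2) 2 (gaussianReal 0 1) := by
  rw [memLp_two_iff_integrable_sq (by fun_prop)]
  refine integrable_pow_four_gaussianReal.congr (ae_of_all _ fun x => ?_)
  ring

theorem variance_sum_mul_sq_gaussian_le {ι : Type*} [Fintype ι] (l : ι → ℝ) :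
    Var[fun x => ∑ i, l i * x i ^ 2; Measure.pi fun _ : ι => gaussianReal 0 1]
      ≤ gaussianFourthMoment * ∑ i, l i ^ 2 := by
  have e : (fun x : ι → ℝ => ∑ i, l i * x i ^ 2)
      = ∑ i, fun x : ι → ℝ => (fun y => l i * y ^ 2) (x i) := by ext x; simp
  rw [e, variance_sum_pi (X := fun i y => l i * y ^ 2)
    fun i => memLp_sq_gaussianReal.const_mul (l i), Finset.mul_sum]
  refine Finset.sum_le_sum fun i _ => ?_
  rw [variance_const_mul, mul_comm]
  refine mul_le_mul_of_nonneg_right ?_ (sq_nonneg _)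
  refine (variance_le_expectation_sq (by fun_prop)).trans ?_
  have : ∫ x : ℝ, ((fun x => x ^ 2) ^ 2 : ℝ → ℝ) x ∂(gaussianReal 0 1)
      = ∫ x, x ^ 4 ∂(gaussianReal 0 1) := by
    congr 1; ext x; simp; ring
  rw [this]; unfold gaussianFourthMoment; linarith

/-- Cauchy–Schwarz with the weights l_i gives (∑ l_i x_i²)² ≤ (∑ l_i)(∑ l_i x_i⁴). -/
theorem integral_sq_sum_mul_sq_gaussian_le {ι : Type*} [Fintype ι] (l : ι → ℝ)
    (hl : ∀ i, 0 ≤ l i) :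
    Integrable (fun x => (∑ i, l i * x i ^ 2) ^ 2) (Measure.pi fun _ : ι => gaussianReal 0 1) ∧
    ∫ x, (∑ i, l i * x i ^ 2) ^ 2 ∂(Measure.pi fun _ : ι => gaussianReal 0 1)
      ≤ gaussianFourthMoment * (∑ i, l i) ^ 2 := by
  have hi : ∀ i : ι, Integrable (fun x : ι → ℝ => x i ^ 4)
      (Measure.pi fun _ : ι => gaussianReal 0 1) := fun i =>
    (measurePreserving_eval (fun _ : ι => gaussianReal 0 1) i).integrable_comp_of_integrable
      integrable_pow_four_gaussianReal
  have hv : ∀ i : ι, ∫ x : ι → ℝ, x i ^ 4 ∂(Measure.pi fun _ : ι => gaussianReal 0 1)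
      = ∫ x, x ^ 4 ∂(gaussianReal 0 1) := fun i => by
    have := (measurePreserving_eval (fun _ : ι => gaussianReal 0 1) i).map_eq
    conv_rhs => rw [← this]
    rw [integral_map (measurable_pi_apply i).aemeasurable (by fun_prop)]
  have hg : Integrable (fun x : ι → ℝ => (∑ i, l i) * ∑ i, l i * x i ^ 4)
      (Measure.pi fun _ : ι => gaussianReal 0 1) :=
    (integrable_finsetSum _ fun i _ => (hi i).const_mul _).const_mul _
  have hle : ∀ x : ι → ℝ, (∑ i, l i * x i ^ 2) ^ 2 ≤ (∑ i, l i) * ∑ i, l i * x i ^ 4 := by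
    intro x
    refine Finset.sum_sq_le_sum_mul_sum_of_sq_le_mul _ (fun i _ => hl i)
      (fun i _ => mul_nonneg (hl i) (by positivity)) fun i _ => le_of_eq (by ring)
  refine ⟨hg.mono' ((measurable_sum_mul_sq l).pow_const 2).aestronglyMeasurable
    (ae_of_all _ fun x => ?_), ?_⟩
  · rw [Real.norm_eq_abs, abs_of_nonneg (sq_nonneg _)]; exact hle x
  · refine (integral_mono_of_nonneg (ae_of_all _ fun x => sq_nonneg _) hg
      (ae_of_all _ hle)).trans ?_
    rw [integral_const_mul, integral_finsetSum _ fun i _ => (hi i).const_mul _]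
    simp_rw [integral_const_mul, hv, ← Finset.sum_mul]
    have : 0 ≤ (∑ i, l i) ^ 2 := sq_nonneg _
    unfold gaussianFourthMoment
    nlinarith

/-! ### Multivariate Gaussian vectors -/

section Multivariate

open scoped MatrixOrder

variable {d : ℕ} {S : Matrix (Fin d) (Fin d) ℝ}

/-- The map sending a standard Gaussian vector to one with covariance matrix `S`. -/
noncomputable def gaussianSqrtMap (S : Matrix (Fin d) (Fin d) ℝ) (w : Fin d → ℝ) :
    EuclideanSpace ℝ (Fin d) :=
  Matrix.toEuclideanCLM (𝕜 := ℝ) (CFC.sqrt S) (WithLp.toLp 2 w)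

theorem measurable_gaussianSqrtMap : Measurable (gaussianSqrtMap S) := by
  unfold gaussianSqrtMap; fun_prop

theorem map_gaussianSqrtMap :
    (Measure.pi fun _ : Fin d => gaussianReal 0 1).map (gaussianSqrtMap S)
      = multivariateGaussian 0 S := by
  rw [multivariateGaussian, ← map_pi_eq_stdGaussian, Measure.map_map (by fun_prop) (by fun_prop)]
  congr 1
  ext w : 1
  simp [gaussianSqrtMap]

theorem sqrt_isHermitian : (CFC.sqrt S).IsHermitian :=
  (CFC.sqrt_nonneg S).isSelfAdjoint

theorem gaussianSqrtMap_dotProduct (K : Matrix (Fin d) (Fin d) ℝ)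
    (v w : Fin d → ℝ) :
    (gaussianSqrtMap S v).ofLp ⬝ᵥ K *ᵥ (gaussianSqrtMap S w).ofLp
      = v ⬝ᵥ (CFC.sqrt S * K * CFC.sqrt S) *ᵥ w := by
  have e : ∀ u, (gaussianSqrtMap S u).ofLp = CFC.sqrt S *ᵥ u := fun u => rfl
  have ht : (CFC.sqrt S)ᵀ = CFC.sqrt S := sqrt_isHermitian (S := S)
  rw [e, e, ← Matrix.mulVec_mulVec, ← Matrix.mulVec_mulVec, Matrix.dotProduct_mulVec v,
    ← Matrix.mulVec_transpose, ht]

theorem inner_gaussianSqrtMap (hS : S.PosSemidef) (v w : Fin d → ℝ) :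
    inner ℝ (gaussianSqrtMap S v) (gaussianSqrtMap S w) = v ⬝ᵥ S *ᵥ w := by
  have := gaussianSqrtMap_dotProduct (S := S) 1 v w
  rw [mul_one, CFC.sqrt_mul_sqrt_self _ hS.nonneg, Matrix.one_mulVec] at this
  rw [← this, EuclideanSpace.inner_eq_star_dotProduct, dotProduct_comm]
  rfl

/-- The squared norm is the quadratic form of S in a standard Gaussian vector, and the squared
eigenvalues of S add up to |S|_F². -/
theorem variance_inner_self_multivariateGaussian_le (hS : S.PosSemidef) :
    Var[fun x => inner ℝ x x; multivariateGaussian 0 S]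
      ≤ gaussianFourthMoment * ∑ i, ∑ j, S i j ^ 2 := by
  rw [← map_gaussianSqrtMap, variance_map (by fun_prop) measurable_gaussianSqrtMap.aemeasurable]
  have : (fun x : EuclideanSpace ℝ (Fin d) => inner ℝ x x) ∘ gaussianSqrtMap S
      = fun w => w ⬝ᵥ S *ᵥ w := by ext w; exact inner_gaussianSqrtMap hS w w
  have hm : Measurable fun w : Fin d → ℝ => w ⬝ᵥ S *ᵥ w := by
    rw [← this]; exact Measurable.comp (by fun_prop) measurable_gaussianSqrtMap
  rw [this, ← hS.1.sum_eigenvalues_sq]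
  refine le_trans (le_of_eq ?_) (variance_sum_mul_sq_gaussian_le hS.1.eigenvalues)
  have e1 := variance_map (X := id) (μ := Measure.pi fun _ : Fin d => gaussianReal 0 1)
    aemeasurable_id hm.aemeasurable
  have e2 := variance_map (X := id) (μ := Measure.pi fun _ : Fin d => gaussianReal 0 1)
    (Y := fun x => ∑ i, hS.1.eigenvalues i * x i ^ 2) aemeasurable_id
    (measurable_sum_mul_sq _).aemeasurable
  rw [map_dotProduct_mulVec_pi_gaussianReal hS.1, e2] at e1
  exact e1.symm

/-- In standard coordinates the form has matrix √S · S · √S = S², which is positive semidefinite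
with trace |S|_F². -/
theorem integral_sq_dotProduct_mulVec_multivariateGaussian_le (hS : S.PosSemidef) :
    Integrable (fun x => (x.ofLp ⬝ᵥ S *ᵥ x.ofLp) ^ 2) (multivariateGaussian 0 S) ∧
    ∫ x, (x.ofLp ⬝ᵥ S *ᵥ x.ofLp) ^ 2 ∂(multivariateGaussian 0 S)
      ≤ gaussianFourthMoment * (∑ i, ∑ j, S i j ^ 2) ^ 2 := by
  have hT : (S * S).PosSemidef := by
    have := Matrix.posSemidef_conjTranspose_mul_self S
    rwa [hS.1] at this
  have hss : CFC.sqrt S * S * CFC.sqrt S = S * S := by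
    have h := CFC.sqrt_mul_sqrt_self S hS.nonneg
    calc CFC.sqrt S * S * CFC.sqrt S
        = CFC.sqrt S * (CFC.sqrt S * CFC.sqrt S) * CFC.sqrt S := by rw [h]
      _ = (CFC.sqrt S * CFC.sqrt S) * (CFC.sqrt S * CFC.sqrt S) := by noncomm_ring
      _ = S * S := by rw [h]
  have hm : Measurable fun w : Fin d → ℝ => w ⬝ᵥ (S * S) *ᵥ w :=
    (measurable_dotProduct_mulVec (S * S)).comp
      (by fun_prop : Measurable (WithLp.toLp 2 : (Fin d → ℝ) → EuclideanSpace ℝ (Fin d)))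
  have hsum : ∑ i, hT.1.eigenvalues i = ∑ i, ∑ j, S i j ^ 2 := by
    have := hT.1.trace_eq_sum_eigenvalues
    simp only [RCLike.ofReal_real_eq_id, id] at this
    rw [← this]
    simp only [Matrix.trace, Matrix.diag, Matrix.mul_apply]
    refine Finset.sum_congr rfl fun i _ => Finset.sum_congr rfl fun j _ => ?_
    have := hS.1.apply i j
    simp only [star_trivial] at this
    rw [this, sq]
  have hmap : (multivariateGaussian 0 S).map (fun x => x.ofLp ⬝ᵥ S *ᵥ x.ofLp)
      = (Measure.pi fun _ : Fin d => gaussianReal 0 1).map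
        (fun x => ∑ i, hT.1.eigenvalues i * x i ^ 2) := by
    rw [← map_gaussianSqrtMap, Measure.map_map (measurable_dotProduct_mulVec S)
      measurable_gaussianSqrtMap, ← map_dotProduct_mulVec_pi_gaussianReal hT.1]
    congr 1
    ext w
    simp only [Function.comp]
    rw [gaussianSqrtMap_dotProduct, hss]
  obtain ⟨h1, h2⟩ := integral_sq_sum_mul_sq_gaussian_le hT.1.eigenvalues hT.eigenvalues_nonneg
  rw [hsum] at h2
  constructor
  · have : Integrable (fun y : ℝ => y ^ 2)
        ((multivariateGaussian 0 S).map (fun x => x.ofLp ⬝ᵥ S *ᵥ x.ofLp)) := by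
      rw [hmap, integrable_map_measure (by fun_prop) (measurable_sum_mul_sq _).aemeasurable]
      exact h1
    exact (integrable_map_measure (by fun_prop)
      (measurable_dotProduct_mulVec S).aemeasurable).1 this
  · have e1 := integral_map (μ := multivariateGaussian 0 S) (f := fun y : ℝ => y ^ 2)
      (measurable_dotProduct_mulVec S).aemeasurable (by fun_prop)
    rw [hmap, integral_map (measurable_sum_mul_sq _).aemeasurable (by fun_prop)] at e1
    rw [← e1]
    exact h2

/-- The Gaussian counterpart of the moment in `Lq`: after normalization it is bounded by an absolute
constant, by Jensen's inequality from the second moment. -/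
theorem lintegral_dotProduct_mulVec_rpow_multivariateGaussian_le (hS : S.PosSemidef) {r : ℝ}
    (hr : 0 ≤ r) (hr2 : r ≤ 2) :
    ∫⁻ x, ENNReal.ofReal ((x.ofLp ⬝ᵥ S *ᵥ x.ofLp) ^ r) ∂(multivariateGaussian 0 S)
      ≤ ENNReal.ofReal (gaussianFourthMoment * (∑ i, ∑ j, S i j ^ 2) ^ r) := by
  obtain ⟨h1, h2⟩ := integral_sq_dotProduct_mulVec_multivariateGaussian_le hS
  have hL : MemLp (fun x : EuclideanSpace ℝ (Fin d) => x.ofLp ⬝ᵥ S *ᵥ x.ofLp) 2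
      (multivariateGaussian 0 S) :=
    (memLp_two_iff_integrable_sq (measurable_dotProduct_mulVec S).aestronglyMeasurable).2 h1
  have hL' : MemLp (fun x : EuclideanSpace ℝ (Fin d) => x.ofLp ⬝ᵥ S *ᵥ x.ofLp)
      (ENNReal.ofReal 2) (multivariateGaussian 0 S) := by simpa using hL
  have h3 := integral_abs_rpow_le_of_le_two hL hr hr2
  have habs : ∀ x : EuclideanSpace ℝ (Fin d),
      |x.ofLp ⬝ᵥ S *ᵥ x.ofLp| = x.ofLp ⬝ᵥ S *ᵥ x.ofLp := fun x =>
    abs_of_nonneg (dotProduct_mulVec_nonneg hS _)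
  have hi := hL'.integrable_abs_rpow hr hr2
  simp_rw [habs] at h3 hi
  rw [← ofReal_integral_eq_lintegral_ofReal hi
    (ae_of_all _ fun x => Real.rpow_nonneg (dotProduct_mulVec_nonneg hS _) _)]
  refine ENNReal.ofReal_le_ofReal (h3.trans ?_)
  have hB : 0 ≤ ∑ i, ∑ j, S i j ^ 2 :=
    Finset.sum_nonneg fun i _ => Finset.sum_nonneg fun j _ => sq_nonneg _
  calc _ ≤ (gaussianFourthMoment * (∑ i, ∑ j, S i j ^ 2) ^ 2) ^ (r / 2) :=
        Real.rpow_le_rpow (integral_nonneg fun x => sq_nonneg _) h2 (by linarith)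
    _ = gaussianFourthMoment ^ (r / 2) * (∑ i, ∑ j, S i j ^ 2) ^ r := by
        rw [Real.mul_rpow (by linarith [one_le_gaussianFourthMoment]) (by positivity),
          ← Real.rpow_natCast (∑ i, ∑ j, S i j ^ 2) 2, ← Real.rpow_mul hB]
        congr 2; push_cast; ring
    _ ≤ _ := by
        refine mul_le_mul_of_nonneg_right ?_ (by positivity)
        calc gaussianFourthMoment ^ (r / 2) ≤ gaussianFourthMoment ^ (1 : ℝ) :=
              Real.rpow_le_rpow_of_exponent_le one_le_gaussianFourthMoment (by linarith)
          _ = _ := Real.rpow_one _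

theorem variance_inner_multivariateGaussian (hS : S.PosSemidef) (x : EuclideanSpace ℝ (Fin d)) :
    Var[fun z => inner ℝ x z; multivariateGaussian 0 S] = x.ofLp ⬝ᵥ S *ᵥ x.ofLp := by
  rw [← covarianceBilin_self IsGaussian.memLp_two_id, covarianceBilin_multivariateGaussian hS]

/-- ⟨x, z⟩ is centred normal with variance xᵀSx, and |y|^q ≤ 1 + y⁴ gives a constant independent of
q. -/
theorem lintegral_abs_inner_rpow_multivariateGaussian_le (hS : S.PosSemidef) {q : ℝ}
    (hq : 0 ≤ q) (hq4 : q ≤ 4) (x : EuclideanSpace ℝ (Fin d)) :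
    ∫⁻ z, ENNReal.ofReal (|inner ℝ x z| ^ q) ∂(multivariateGaussian 0 S)
      ≤ ENNReal.ofReal (gaussianFourthMoment * (x.ofLp ⬝ᵥ S *ᵥ x.ofLp) ^ (q / 2)) := by
  have hnn := dotProduct_mulVec_nonneg hS x.ofLp
  set a := √(x.ofLp ⬝ᵥ S *ᵥ x.ofLp) with ha
  have hlaw : (multivariateGaussian 0 S).map (fun z => inner ℝ x z)
      = (gaussianReal 0 1).map (fun y => a * y) := by
    have h := IsGaussian.map_eq_gaussianReal (μ := multivariateGaussian 0 S) (innerSL ℝ x)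
    have h0 : ∫ z, innerSL ℝ x z ∂(multivariateGaussian 0 S) = 0 := by
      rw [ContinuousLinearMap.integral_comp_comm _ IsGaussian.integrable_fun_id]
      simp
    have hv : Var[⇑(innerSL ℝ x); multivariateGaussian 0 S] = x.ofLp ⬝ᵥ S *ᵥ x.ofLp :=
      variance_inner_multivariateGaussian hS x
    rw [h0, hv] at h
    rw [gaussianReal_map_const_mul, mul_zero, mul_one]
    refine Eq.trans h ?_
    congr 1
    ext
    simp [ha, Real.sq_sqrt hnn, hnn]
  have hm : Measurable fun y : ℝ => ENNReal.ofReal (|y| ^ q) := by fun_prop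
  rw [← lintegral_map (f := fun y : ℝ => ENNReal.ofReal (|y| ^ q)) hm (by fun_prop), hlaw,
    lintegral_map hm (by fun_prop)]
  have hpt : ∀ y : ℝ, ENNReal.ofReal (|a * y| ^ q) ≤ ENNReal.ofReal (a ^ q * (1 + y ^ 4)) := by
    intro y
    refine ENNReal.ofReal_le_ofReal ?_
    rw [abs_mul, abs_of_nonneg (Real.sqrt_nonneg _), Real.mul_rpow (Real.sqrt_nonneg _)
      (abs_nonneg _)]
    refine mul_le_mul_of_nonneg_left ?_ (by positivity)
    have h4 : y ^ 4 = |y| ^ (4 : ℝ) := by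
      rw [show (4 : ℝ) = ((4 : ℕ) : ℝ) by norm_num, Real.rpow_natCast,
        show (4 : ℕ) = 2 * 2 by norm_num, pow_mul, pow_mul, sq_abs]
    rcases le_total |y| 1 with h | h
    · have := Real.rpow_le_one (abs_nonneg y) h hq
      have : 0 ≤ y ^ 4 := by positivity
      linarith
    · have := Real.rpow_le_rpow_of_exponent_le h hq4
      linarith
  refine (lintegral_mono hpt).trans ?_
  have hi : Integrable (fun y : ℝ => 1 + y ^ 4) (gaussianReal 0 1) :=
    (integrable_const 1).add integrable_pow_four_gaussianReal
  rw [← ofReal_integral_eq_lintegral_ofReal (hi.const_mul _)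
    (ae_of_all _ fun y => by positivity), integral_const_mul]
  refine ENNReal.ofReal_le_ofReal (le_of_eq ?_)
  rw [integral_add (integrable_const 1) integrable_pow_four_gaussianReal, mul_comm]
  unfold gaussianFourthMoment
  congr 1
  · simp
  · rw [ha, Real.sqrt_eq_rpow, ← Real.rpow_mul hnn]; congr 1; ring

/-- **Anti-concentration** for quadratic forms in independent Gaussian vectors. -/
theorem exists_gaussian_quadraticForm_anticoncentration : ∃ K : ℝ, 0 < K ∧
    ∀ {n d : ℕ} {P : Matrix (Fin n) (Fin n) ℝ} {S : Matrix (Fin d) (Fin d) ℝ}, P.IsHermitian →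
      S.PosSemidef → ∀ τ : ℝ, 0 < τ → (∑ i, ∑ j, P i j ^ 2) * (∑ k, ∑ l, S k l ^ 2) = τ ^ 2 →
      ∀ z h : ℝ, 0 < h →
        (Measure.pi fun _ : Fin n => multivariateGaussian 0 S).real
          {x : Fin n → EuclideanSpace ℝ (Fin d) |
            |∑ i, ∑ j, P i j * inner ℝ (x i) (x j) - z| ≤ h} ≤ K * (h / τ) ^ (1 / 2 : ℝ) := by
  obtain ⟨K, hK, H⟩ := exists_gaussian_sq_anticoncentration
  refine ⟨K, hK, fun {n d P S} hP hS τ hτ hPS z h hh => ?_⟩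
  -- Over the n·d standard Gaussian coordinates the form has matrix P ⊗ S, whose squared entries sum
  -- to the product of the two sums of squares. So τ is exactly the ℓ² norm of its eigenvalues.
  set A : Matrix (Fin n × Fin d) (Fin n × Fin d) ℝ := Matrix.kroneckerMap (· * ·) P S with hA
  have hAh : A.IsHermitian := by
    ext p q
    have h1 := hP.apply p.1 q.1
    have h2 := hS.1.apply p.2 q.2
    simp only [star_trivial] at h1 h2
    simp [hA, Matrix.kroneckerMap_apply, Matrix.conjTranspose_apply, h1, h2]
  have hsum : ∑ p, hAh.eigenvalues p ^ 2 = τ ^ 2 := by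
    rw [hAh.sum_eigenvalues_sq, ← hPS]
    simp only [hA, Fintype.sum_prod_type, Matrix.kroneckerMap_apply, mul_pow]
    rw [Finset.sum_mul]
    refine Finset.sum_congr rfl fun i _ => ?_
    rw [Finset.sum_comm, Finset.sum_mul]
    refine Finset.sum_congr rfl fun j _ => ?_
    simp_rw [Finset.mul_sum]
  set Φ : (Fin n × Fin d → ℝ) → (Fin n → EuclideanSpace ℝ (Fin d)) :=
    fun w i => gaussianSqrtMap S fun k => w (i, k) with hΦ
  have hΦm : Measurable Φ :=
    measurable_pi_lambda _ fun i => measurable_gaussianSqrtMap.comp (by fun_prop)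
  have hmap : (Measure.pi fun _ : Fin n × Fin d => gaussianReal 0 1).map Φ
      = Measure.pi fun _ : Fin n => multivariateGaussian 0 S := by
    have h1 := Measure.infinitePi_map_curry (X := ℝ)
      (fun (_ : Fin n) (_ : Fin d) => gaussianReal 0 1)
    simp_rw [Measure.infinitePi_eq_pi] at h1
    have h2 := Measure.pi_map_pi
      (μ := fun _ : Fin n => Measure.pi fun _ : Fin d => gaussianReal 0 1)
      (f := fun _ => gaussianSqrtMap S)
      (hμ := fun _ => by rw [map_gaussianSqrtMap]; infer_instance)
      (fun _ => measurable_gaussianSqrtMap.aemeasurable)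
    simp_rw [map_gaussianSqrtMap] at h2
    rw [← h2, ← h1, Measure.map_map _ (MeasurableEquiv.measurable _)]
    · rfl
    · exact measurable_pi_lambda _ fun i => measurable_gaussianSqrtMap.comp (by fun_prop)
  have hquad : ∀ w, ∑ i, ∑ j, P i j * inner ℝ (Φ w i) (Φ w j) = w ⬝ᵥ A *ᵥ w := by
    intro w
    simp only [hΦ, inner_gaussianSqrtMap hS, dotProduct, Matrix.mulVec, hA,
      Matrix.kroneckerMap_apply, Fintype.sum_prod_type, Finset.mul_sum]
    refine Finset.sum_congr rfl fun i _ => ?_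
    rw [Finset.sum_comm]
    refine Finset.sum_congr rfl fun k _ => Finset.sum_congr rfl fun j _ =>
      Finset.sum_congr rfl fun l _ => by ring
  have hset : MeasurableSet {y : ℝ | |y - z| ≤ h} :=
    measurableSet_le (by fun_prop) measurable_const
  have hQm : Measurable fun x : Fin n → EuclideanSpace ℝ (Fin d) =>
      ∑ i, ∑ j, P i j * inner ℝ (x i) (x j) := by fun_prop
  have hAm : Measurable fun w : Fin n × Fin d → ℝ => w ⬝ᵥ A *ᵥ w := by
    have : (fun w : Fin n × Fin d → ℝ => w ⬝ᵥ A *ᵥ w)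
      = (fun x => ∑ i, ∑ j, P i j * inner ℝ (x i) (x j)) ∘ Φ := by
      ext w; exact (hquad w).symm
    rw [this]; exact hQm.comp hΦm
  have e1 : (Measure.pi fun _ : Fin n => multivariateGaussian 0 S).real
          {x | |∑ i, ∑ j, P i j * inner ℝ (x i) (x j) - z| ≤ h}
      = (Measure.pi fun _ : Fin n × Fin d => gaussianReal 0 1).real
        {w | |∑ p, hAh.eigenvalues p * w p ^ 2 - z| ≤ h} := by
    rw [← hmap]
    refine (map_measureReal_apply hΦm (hQm hset)).trans ?_
    have h3 := congrArg (fun m => m.real {y : ℝ | |y - z| ≤ h})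
      (map_dotProduct_mulVec_pi_gaussianReal hAh)
    simp only at h3
    rw [map_measureReal_apply hAm hset, map_measureReal_apply (by fun_prop) hset] at h3
    refine Eq.trans ?_ h3
    congr 1
    ext w
    simp only [Set.mem_preimage, Set.mem_ofPred_eq, hquad]
  rw [e1]
  exact H _ τ hτ hsum z h hh

end Multivariate

/-! ### Laws with prescribed mean and covariance -/

/-- The measure `κ` is centred with covariance matrix `S` and finite second moments. -/
structure HasCenteredCov {d : ℕ} (κ : Measure (EuclideanSpace ℝ (Fin d)))
    (S : Matrix (Fin d) (Fin d) ℝ) : Prop where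
  memLp : MemLp id 2 κ
  mean : ∫ x, x ∂κ = 0
  cov : ∀ k l, cov[fun x => x k, fun x => x l; κ] = S k l

theorem dotProduct_mulVec_eq_sum {d : ℕ} (S : Matrix (Fin d) (Fin d) ℝ)
    (x : EuclideanSpace ℝ (Fin d)) :
    x.ofLp ⬝ᵥ S *ᵥ x.ofLp = ∑ k, ∑ l, S k l * (x k * x l) := by
  simp only [dotProduct, Matrix.mulVec, Finset.mul_sum]
  exact Finset.sum_congr rfl fun k _ => Finset.sum_congr rfl fun l _ => by ring

namespace HasCenteredCov

variable {d : ℕ} {κ : Measure (EuclideanSpace ℝ (Fin d))}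
  {S : Matrix (Fin d) (Fin d) ℝ}

theorem memLp_inner (h : HasCenteredCov κ S) (x : EuclideanSpace ℝ (Fin d)) :
    MemLp (fun z => inner ℝ x z) 2 κ :=
  h.memLp.const_inner x

theorem memLp_apply (h : HasCenteredCov κ S) (k : Fin d) : MemLp (fun z => z k) 2 κ := by
  have := h.memLp_inner (EuclideanSpace.single k 1)
  simpa [EuclideanSpace.inner_single_left] using this

theorem integrable_apply_mul_apply (h : HasCenteredCov κ S) (k l : Fin d) :
    Integrable (fun z => z k * z l) κ :=
  (h.memLp_apply k).integrable_mul (h.memLp_apply l)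

theorem integrable_inner_sq (h : HasCenteredCov κ S) (x : EuclideanSpace ℝ (Fin d)) :
    Integrable (fun z => inner ℝ x z ^ 2) κ := (h.memLp_inner x).integrable_sq

theorem integrable_dotProduct_mulVec (h : HasCenteredCov κ S) :
    Integrable (fun x => x.ofLp ⬝ᵥ S *ᵥ x.ofLp) κ := by
  simp_rw [dotProduct_mulVec_eq_sum]
  exact integrable_finsetSum _ fun k _ => integrable_finsetSum _ fun l _ =>
    (h.integrable_apply_mul_apply k l).const_mul _

theorem integrable_inner_self (h : HasCenteredCov κ S) : Integrable (fun x => inner ℝ x x) κ := by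
  simp_rw [PiLp.inner_apply]
  exact integrable_finsetSum _ fun k _ => by simpa [sq] using h.integrable_apply_mul_apply k k

variable [IsProbabilityMeasure κ]

theorem integral_inner (h : HasCenteredCov κ S) (x : EuclideanSpace ℝ (Fin d)) :
    ∫ z, inner ℝ x z ∂κ = 0 := by
  have hi : Integrable (fun z : EuclideanSpace ℝ (Fin d) => z) κ :=
    h.memLp.integrable (by norm_num)
  rw [_root_.integral_inner hi, h.mean, inner_zero_right]

theorem integral_apply (h : HasCenteredCov κ S) (k : Fin d) : ∫ z, z k ∂κ = 0 := by
  have := h.integral_inner (EuclideanSpace.single k 1)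
  simpa [EuclideanSpace.inner_single_left] using this

theorem integral_apply_mul_apply (h : HasCenteredCov κ S) (k l : Fin d) :
    ∫ z, z k * z l ∂κ = S k l := by
  rw [← h.cov k l, covariance_eq_sub (h.memLp_apply k) (h.memLp_apply l), h.integral_apply,
    zero_mul, sub_zero]
  rfl

theorem integral_inner_sq (h : HasCenteredCov κ S) (x : EuclideanSpace ℝ (Fin d)) :
    ∫ z, inner ℝ x z ^ 2 ∂κ = x.ofLp ⬝ᵥ S *ᵥ x.ofLp := by
  have e : ∀ z : EuclideanSpace ℝ (Fin d), inner ℝ x z ^ 2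
      = ∑ k, ∑ l, x k * x l * (z k * z l) := by
    intro z
    rw [PiLp.inner_apply, sq, Finset.sum_mul_sum]
    refine Finset.sum_congr rfl fun k _ => Finset.sum_congr rfl fun l _ => ?_
    simp; ring
  simp_rw [e]
  rw [integral_finsetSum _ fun k _ => integrable_finsetSum _ fun l _ =>
    (h.integrable_apply_mul_apply k l).const_mul _]
  simp only [dotProduct, Matrix.mulVec, Finset.mul_sum]
  refine Finset.sum_congr rfl fun k _ => ?_
  rw [integral_finsetSum _ fun l _ => (h.integrable_apply_mul_apply k l).const_mul _]
  refine Finset.sum_congr rfl fun l _ => ?_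
  rw [integral_const_mul, h.integral_apply_mul_apply]
  ring

theorem posSemidef (h : HasCenteredCov κ S) : S.PosSemidef := by
  refine Matrix.PosSemidef.of_dotProduct_mulVec_nonneg ?_ fun x => ?_
  · ext k l
    simp only [Matrix.conjTranspose_apply, star_trivial]
    rw [← h.integral_apply_mul_apply, ← h.integral_apply_mul_apply]
    simp_rw [mul_comm]
  · have := h.integral_inner_sq (WithLp.toLp 2 x)
    simp only [star_trivial]
    rw [← this]
    exact integral_nonneg fun z => sq_nonneg _

theorem integral_dotProduct_mulVec (h : HasCenteredCov κ S) :
    ∫ x, x.ofLp ⬝ᵥ S *ᵥ x.ofLp ∂κ = ∑ k, ∑ l, S k l ^ 2 := by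
  simp_rw [dotProduct_mulVec_eq_sum]
  refine (integral_finsetSum _ fun k _ => integrable_finsetSum _ fun l _ =>
    (h.integrable_apply_mul_apply k l).const_mul _).trans ?_
  refine Finset.sum_congr rfl fun k _ => ?_
  rw [integral_finsetSum _ fun l _ => (h.integrable_apply_mul_apply k l).const_mul _]
  refine Finset.sum_congr rfl fun l _ => ?_
  rw [integral_const_mul, h.integral_apply_mul_apply, sq]

theorem integral_inner_self (h : HasCenteredCov κ S) : ∫ x, inner ℝ x x ∂κ = S.trace := by
  simp_rw [PiLp.inner_apply]
  rw [integral_finsetSum _ fun k _ => by simpa [sq] using h.integrable_apply_mul_apply k k]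
  refine Finset.sum_congr rfl fun k _ => ?_
  rw [Matrix.diag_apply, ← h.integral_apply_mul_apply]
  simp [sq]

end HasCenteredCov

theorem hasCenteredCov_multivariateGaussian {d : ℕ} {S : Matrix (Fin d) (Fin d) ℝ}
    (hS : S.PosSemidef) : HasCenteredCov (multivariateGaussian 0 S) S where
  memLp := IsGaussian.memLp_two_id
  mean := integral_id_multivariateGaussian
  cov := covariance_eval_multivariateGaussian hS

/-! ### Resampling and off-diagonal quadratic forms -/

/-- Resampling one coordinate of a product measure. -/
theorem MeasureTheory.Measure.map_update_prod_pi {ι X : Type*} [Fintype ι] [DecidableEq ι]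
    [MeasurableSpace X] (μ : ι → Measure X) [∀ i, IsProbabilityMeasure (μ i)] (κ : Measure X)
    [IsProbabilityMeasure κ] (i : ι) :
    ((Measure.pi μ).prod κ).map (fun p => Function.update p.1 i p.2)
      = Measure.pi (Function.update μ i κ) := by
  have : ∀ j, IsProbabilityMeasure (Function.update μ i κ j) := by
    intro j
    rcases eq_or_ne j i with rfl | hj
    · simpa using ‹IsProbabilityMeasure κ›
    · simpa [hj] using (inferInstance : IsProbabilityMeasure (μ j))
  symm
  refine Measure.pi_eq fun s hs => ?_
  have hm : Measurable fun p : (ι → X) × X => Function.update p.1 i p.2 := by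
    refine measurable_pi_lambda _ fun j => ?_
    rcases eq_or_ne j i with rfl | hj
    · simpa using measurable_snd
    · simpa [hj, Function.comp_def] using (measurable_pi_apply j).comp measurable_fst
  rw [Measure.map_apply hm (MeasurableSet.univ_pi hs)]
  have e : (fun p : (ι → X) × X => Function.update p.1 i p.2) ⁻¹' Set.univ.pi s
      = (Set.univ.pi (Function.update s i Set.univ)) ×ˢ (s i) := by
    ext p
    simp only [Set.mem_preimage, Set.mem_univ_pi, Set.mem_prod]
    constructor
    · intro h
      refine ⟨fun j => ?_, by simpa using h i⟩
      rcases eq_or_ne j i with rfl | hj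
      · simp
      · simpa [hj] using h j
    · rintro ⟨h1, h2⟩ j
      rcases eq_or_ne j i with rfl | hj
      · simpa using h2
      · simpa [hj] using h1 j
  rw [e, Measure.prod_prod, Measure.pi_pi, ← Finset.mul_prod_erase _ _ (Finset.mem_univ i),
    ← Finset.mul_prod_erase Finset.univ (fun j => (Function.update μ i κ j) (s j))
      (Finset.mem_univ i)]
  simp only [Function.update_self, measure_univ, one_mul]
  rw [mul_comm]
  congr 1
  refine Finset.prod_congr rfl fun j hj => ?_
  simp [Finset.ne_of_mem_erase hj]

section QuadraticForm

variable {n d : ℕ}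

/-- The quadratic form `∑ A_ij ⟨x_i, x_j⟩`. -/
noncomputable def quadForm (A : Matrix (Fin n) (Fin n) ℝ)
    (x : Fin n → EuclideanSpace ℝ (Fin d)) : ℝ :=
  ∑ i, ∑ j, A i j * inner ℝ (x i) (x j)

/-- The linear map `x ↦ ∑ A_ij x_j`. -/
noncomputable def rowComb (A : Matrix (Fin n) (Fin n) ℝ) (i : Fin n)
    (x : Fin n → EuclideanSpace ℝ (Fin d)) : EuclideanSpace ℝ (Fin d) :=
  ∑ j, A i j • x j

@[fun_prop]
theorem measurable_quadForm (A : Matrix (Fin n) (Fin n) ℝ) :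
    Measurable (quadForm A : (Fin n → EuclideanSpace ℝ (Fin d)) → ℝ) := by
  unfold quadForm; fun_prop

@[fun_prop]
theorem measurable_rowComb (A : Matrix (Fin n) (Fin n) ℝ) (i : Fin n) :
    Measurable (rowComb A i : (Fin n → EuclideanSpace ℝ (Fin d)) → _) := by
  unfold rowComb; fun_prop

/-- With zero diagonal the form is affine in each coordinate; its slope is twice `rowComb A i x`,
which does not involve x_i because A_ii = 0. -/
theorem quadForm_update {A : Matrix (Fin n) (Fin n) ℝ} (hA : A.IsHermitian)
    (hdiag : ∀ i, A i i = 0) (i : Fin n) (x : Fin n → EuclideanSpace ℝ (Fin d))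
    (y : EuclideanSpace ℝ (Fin d)) :
    quadForm A (Function.update x i y)
      = quadForm A (Function.update x i 0) + 2 * inner ℝ y (rowComb A i x) := by
  have hs : ∀ a b, A a b = A b a := fun a b => by simpa using hA.apply b a
  have split : ∀ z, quadForm A (Function.update x i z)
      = ∑ a ∈ Finset.univ.erase i, ∑ b ∈ Finset.univ.erase i, A a b * inner ℝ (x a) (x b)
        + 2 * inner ℝ z (rowComb A i x) := by
    intro z
    have hrow : inner ℝ z (rowComb A i x)
        = ∑ b ∈ Finset.univ.erase i, A i b * inner ℝ z (x b) := by
      rw [rowComb, inner_sum, ← Finset.add_sum_erase _ _ (Finset.mem_univ i), hdiag]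
      simp [inner_smul_right]
    unfold quadForm
    rw [hrow, ← Finset.add_sum_erase _ _ (Finset.mem_univ i),
      ← Finset.add_sum_erase Finset.univ
        (fun b => A i b * inner ℝ (Function.update x i z i) (Function.update x i z b))
        (Finset.mem_univ i)]
    simp only [hdiag, zero_mul, zero_add, Function.update_self]
    have e1 : ∑ b ∈ Finset.univ.erase i, A i b * inner ℝ z (Function.update x i z b)
        = ∑ b ∈ Finset.univ.erase i, A i b * inner ℝ z (x b) :=
      Finset.sum_congr rfl fun b hb => by simp [Finset.ne_of_mem_erase hb]
    have e2 : ∑ a ∈ Finset.univ.erase i, ∑ b, A a b *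
          inner ℝ (Function.update x i z a) (Function.update x i z b)
        = ∑ a ∈ Finset.univ.erase i, (A i a * inner ℝ z (x a)
          + ∑ b ∈ Finset.univ.erase i, A a b * inner ℝ (x a) (x b)) := by
      refine Finset.sum_congr rfl fun a ha => ?_
      rw [← Finset.add_sum_erase _ _ (Finset.mem_univ i)]
      simp only [Finset.ne_of_mem_erase ha, Function.update_self, ne_eq, not_false_eq_true,
        Function.update_of_ne]
      rw [hs a i, real_inner_comm]
      congr 1
      exact Finset.sum_congr rfl fun b hb => by simp [Finset.ne_of_mem_erase hb]
    rw [e1, e2, Finset.sum_add_distrib]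
    ring
  rw [split y, split 0]
  simp

end QuadraticForm

/-! ### Lindeberg replacement for quadratic forms -/

section Lindeberg

variable {n d : ℕ} {S : Matrix (Fin d) (Fin d) ℝ}

/-- For fixed x this is Rosenthal's inequality for the independent centred variables A_ij ⟨x, ω_j⟩.
The coordinates may have different laws, as the hybrids below require; only their covariance is
common. -/
theorem lintegral_abs_inner_rowComb_rpow_le {q : ℝ} (hq : 2 < q) (hq' : q ≤ 3)
    (A : Matrix (Fin n) (Fin n) ℝ) (i : Fin n)
    (μ : Fin n → Measure (EuclideanSpace ℝ (Fin d))) [∀ j, IsProbabilityMeasure (μ j)]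
    (hμ : ∀ j, HasCenteredCov (μ j) S) (x : EuclideanSpace ℝ (Fin d)) :
    ∫⁻ ω, ENNReal.ofReal (|inner ℝ x (rowComb A i ω)| ^ q) ∂(Measure.pi μ)
      ≤ 11 * (∑ j, ENNReal.ofReal (|A i j| ^ q) *
          ∫⁻ y, ENNReal.ofReal (|inner ℝ x y| ^ q) ∂(μ j)
        + ENNReal.ofReal ((∑ j, A i j ^ 2) ^ (q / 2)) *
          ENNReal.ofReal ((x.ofLp ⬝ᵥ S *ᵥ x.ofLp) ^ (q / 2))) := by
  have hS : S.PosSemidef := (hμ i).posSemidef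
  have hnn := dotProduct_mulVec_nonneg hS x.ofLp
  have hterm : ∀ j, ENNReal.ofReal (|A i j| ^ q) *
      ∫⁻ y, ENNReal.ofReal (|inner ℝ x y| ^ q) ∂(μ j)
      = ∫⁻ y, ENNReal.ofReal (|A i j * inner ℝ x y| ^ q) ∂(μ j) := by
    intro j
    rw [← lintegral_const_mul _ (by fun_prop)]
    refine lintegral_congr fun y => ?_
    rw [← ENNReal.ofReal_mul (by positivity), abs_mul, Real.mul_rpow (abs_nonneg _) (abs_nonneg _)]
  simp_rw [hterm]
  -- Extended-valued integrals avoid assuming a moment of order q: if one is infinite, so is the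
  -- right-hand side.
  by_cases htop : ∑ j, ∫⁻ y, ENNReal.ofReal (|A i j * inner ℝ x y| ^ q) ∂(μ j) = ⊤
  · rw [htop, top_add, ENNReal.mul_top (by norm_num)]; exact le_top
  have hfin : ∀ j, ∫⁻ y, ENNReal.ofReal (|A i j * inner ℝ x y| ^ q) ∂(μ j) ≠ ⊤ := fun j =>
    (ENNReal.sum_ne_top.1 htop) j (Finset.mem_univ j)
  have hL : ∀ j, MemLp (fun y => A i j * inner ℝ x y) (ENNReal.ofReal q) (μ j) := by
    intro j
    refine ⟨by fun_prop, ?_⟩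
    rw [eLpNorm_lt_top_iff_lintegral_rpow_enorm_lt_top (by simp; linarith) (by simp),
      ENNReal.toReal_ofReal (by linarith)]
    refine lt_of_le_of_lt (le_of_eq ?_) (lt_top_iff_ne_top.2 (hfin j))
    refine lintegral_congr fun y => ?_
    rw [← ofReal_norm, ENNReal.ofReal_rpow_of_nonneg (norm_nonneg _) (by linarith),
      Real.norm_eq_abs]
  set X : Fin n → (Fin n → EuclideanSpace ℝ (Fin d)) → ℝ :=
    fun j ω => A i j * inner ℝ x (ω j) with hX
  have hXL : ∀ j, MemLp (X j) (ENNReal.ofReal q) (Measure.pi μ) := fun j =>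
    (hL j).comp_measurePreserving (measurePreserving_eval μ j)
  have hint : ∀ (j : Fin n) (f : EuclideanSpace ℝ (Fin d) → ℝ), Measurable f →
      ∫ ω, f (ω j) ∂(Measure.pi μ) = ∫ y, f y ∂(μ j) := by
    intro j f hf
    conv_rhs => rw [← (measurePreserving_eval μ j).map_eq]
    rw [integral_map (measurable_pi_apply j).aemeasurable hf.aestronglyMeasurable]
  have hX0 : ∀ j, ∫ ω, X j ω ∂(Measure.pi μ) = 0 := by
    intro j
    rw [hint j (fun y => A i j * inner ℝ x y) (by fun_prop), integral_const_mul,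
      (hμ j).integral_inner, mul_zero]
  have hX2 : ∀ j, ∫ ω, X j ω ^ 2 ∂(Measure.pi μ) = A i j ^ 2 * (x.ofLp ⬝ᵥ S *ᵥ x.ofLp) := by
    intro j
    rw [hint j (fun y => (A i j * inner ℝ x y) ^ 2) (by fun_prop)]
    simp_rw [mul_pow]
    rw [integral_const_mul, (hμ j).integral_inner_sq]
  have hind : iIndepFun X (Measure.pi μ) :=
    iIndepFun_pi (X := fun j y => A i j * inner ℝ x y) fun j => by fun_prop
  have hros := integral_abs_sum_rpow_le hq hq' (fun j => by fun_prop) hind hXL hX0 Finset.univ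
  have hrow : ∀ ω, inner ℝ x (rowComb A i ω) = ∑ j, X j ω := by
    intro ω
    rw [rowComb, inner_sum]
    exact Finset.sum_congr rfl fun j _ => by rw [inner_smul_right]
  simp_rw [hrow]
  have hsumL : MemLp (fun ω => ∑ j, X j ω) (ENNReal.ofReal q) (Measure.pi μ) :=
    memLp_finsetSum _ fun j _ => hXL j
  rw [← ofReal_integral_eq_lintegral_ofReal (hsumL.integrable_abs_rpow (by linarith) le_rfl)
    (ae_of_all _ fun ω => by positivity)]
  refine (ENNReal.ofReal_le_ofReal hros).trans ?_
  have hIq : ∀ j, ENNReal.ofReal (∫ ω, |X j ω| ^ q ∂(Measure.pi μ))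
      = ∫⁻ y, ENNReal.ofReal (|A i j * inner ℝ x y| ^ q) ∂(μ j) := by
    intro j
    rw [hint j (fun y => |A i j * inner ℝ x y| ^ q) (by fun_prop),
      ofReal_integral_eq_lintegral_ofReal ((hL j).integrable_abs_rpow (by linarith) le_rfl)
        (ae_of_all _ fun ω => by positivity)]
  have hnnj : ∀ j ∈ Finset.univ, 0 ≤ ∫ ω, |X j ω| ^ q ∂(Measure.pi μ) := fun j _ =>
    integral_nonneg fun ω => by positivity
  have hA0 : 0 ≤ ∑ j, A i j ^ 2 := Finset.sum_nonneg fun j _ => sq_nonneg _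
  rw [ENNReal.ofReal_mul (by norm_num), ENNReal.ofReal_add (Finset.sum_nonneg hnnj)
    (Real.rpow_nonneg (Finset.sum_nonneg fun j _ => integral_nonneg fun ω => sq_nonneg _) _),
    ENNReal.ofReal_sum_of_nonneg hnnj]
  simp_rw [hIq, hX2]
  rw [← Finset.sum_mul, Real.mul_rpow hA0 hnn, ENNReal.ofReal_mul (by positivity)]
  simp

/-- Centring kills the first-order term, and the second-order one, (2⟨x, s⟩)²/2 in mean, depends on
κ only through S. The comparison value is therefore the same for all laws with covariance S. -/
theorem ofReal_abs_integral_sub_taylor_le {κ : Measure (EuclideanSpace ℝ (Fin d))}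
    [IsProbabilityMeasure κ] (h : HasCenteredCov κ S) {f f₁ f₂ : ℝ → ℝ} (hf : Continuous f)
    (hf0 : ∀ x, 0 ≤ f x) (hf1 : ∀ x, f x ≤ 1) {q K : ℝ} (hK : 0 ≤ K)
    (htaylor : ∀ a y, |f (a + y) - f a - f₁ a * y - f₂ a * y ^ 2 / 2| ≤ K * |y| ^ q)
    (a : ℝ) (s : EuclideanSpace ℝ (Fin d)) :
    ENNReal.ofReal |∫ x, f (a + 2 * inner ℝ x s) ∂κ - (f a + f₂ a * 2 * (s.ofLp ⬝ᵥ S *ᵥ s.ofLp))|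
      ≤ ENNReal.ofReal (K * 2 ^ q) * ∫⁻ x, ENNReal.ofReal (|inner ℝ x s| ^ q) ∂κ := by
  have i0 : Integrable (fun x : EuclideanSpace ℝ (Fin d) => f (a + 2 * inner ℝ x s)) κ := by
    refine Integrable.of_bound (Continuous.aestronglyMeasurable (by fun_prop)) 1
      (ae_of_all _ fun x => ?_)
    rw [Real.norm_eq_abs, abs_of_nonneg (hf0 _)]; exact hf1 _
  have i1 : Integrable (fun x => inner ℝ x s) κ := by
    simp_rw [real_inner_comm s]
    exact (h.memLp_inner s).integrable (by norm_num)
  have i2 : Integrable (fun x => inner ℝ x s ^ 2) κ := by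
    simp_rw [real_inner_comm s]
    exact h.integrable_inner_sq s
  have v1 : ∫ x, inner ℝ x s ∂κ = 0 := by
    simp_rw [real_inner_comm s]; exact h.integral_inner s
  have v2 : ∫ x, inner ℝ x s ^ 2 ∂κ = s.ofLp ⬝ᵥ S *ᵥ s.ofLp := by
    simp_rw [real_inner_comm s]; exact h.integral_inner_sq s
  have j1 : Integrable (fun x => f a + f₁ a * 2 * inner ℝ x s) κ :=
    (integrable_const _).add (i1.const_mul _)
  have j2 : Integrable (fun x => f a + f₁ a * 2 * inner ℝ x s + f₂ a * 2 * inner ℝ x s ^ 2) κ :=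
    j1.add (i2.const_mul _)
  have e : ∫ x, f (a + 2 * inner ℝ x s) ∂κ - (f a + f₂ a * 2 * (s.ofLp ⬝ᵥ S *ᵥ s.ofLp))
      = ∫ x, (f (a + 2 * inner ℝ x s) -
        (f a + f₁ a * 2 * inner ℝ x s + f₂ a * 2 * inner ℝ x s ^ 2)) ∂κ := by
    rw [integral_sub i0 j2, integral_add j1 (i2.const_mul _),
      integral_add (integrable_const _) (i1.const_mul _), integral_const_mul, integral_const_mul,
      v1, v2]
    simp
  rw [e, ← Real.norm_eq_abs, ofReal_norm, ← lintegral_const_mul _ (by fun_prop)]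
  refine (enorm_integral_le_lintegral_enorm _).trans (lintegral_mono fun x => ?_)
  rw [← ofReal_norm, Real.norm_eq_abs, ← ENNReal.ofReal_mul (by positivity)]
  refine ENNReal.ofReal_le_ofReal ?_
  have := htaylor a (2 * inner ℝ x s)
  rw [abs_mul, abs_of_pos (by norm_num : (0 : ℝ) < 2),
    Real.mul_rpow (by norm_num) (abs_nonneg _)] at this
  rw [mul_assoc K]
  refine le_trans (le_of_eq ?_) this
  congr 1; ring

end Lindeberg

section Replacement

variable {n d : ℕ} {S : Matrix (Fin d) (Fin d) ℝ}

theorem measurable_update_prod {X : Type*} [MeasurableSpace X] (i : Fin n) :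
    Measurable fun p : (Fin n → X) × X => Function.update p.1 i p.2 := by
  refine measurable_pi_lambda _ fun j => ?_
  rcases eq_or_ne j i with rfl | hj
  · simpa using measurable_snd
  · simpa [hj, Function.comp_def] using (measurable_pi_apply j).comp measurable_fst

/-- Cost of replacing the law of one coordinate in the expectation of a smooth function of an
off-diagonal quadratic form. -/
theorem ofReal_abs_integral_update_sub_le {q : ℝ} (hq : 2 < q) (hq' : q ≤ 3)
    {A : Matrix (Fin n) (Fin n) ℝ} (hA : A.IsHermitian) (hdiag : ∀ i, A i i = 0)
    {f f₁ f₂ : ℝ → ℝ} (hf : Continuous f) (hf0 : ∀ x, 0 ≤ f x) (hf1 : ∀ x, f x ≤ 1) {K : ℝ}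
    (hK : 0 ≤ K) (htaylor : ∀ a y, |f (a + y) - f a - f₁ a * y - f₂ a * y ^ 2 / 2| ≤ K * |y| ^ q)
    (μ : Fin n → Measure (EuclideanSpace ℝ (Fin d))) [∀ j, IsProbabilityMeasure (μ j)]
    (hμ : ∀ j, HasCenteredCov (μ j) S) (κ κ' : Measure (EuclideanSpace ℝ (Fin d)))
    [IsProbabilityMeasure κ] [IsProbabilityMeasure κ'] (hκ : HasCenteredCov κ S)
    (hκ' : HasCenteredCov κ' S) {a b : ℝ≥0∞}
    (ha : ∀ j, ∫⁻ x, ∫⁻ y, ENNReal.ofReal (|inner ℝ x y| ^ q) ∂(μ j) ∂κ ≤ a)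
    (ha' : ∀ j, ∫⁻ x, ∫⁻ y, ENNReal.ofReal (|inner ℝ x y| ^ q) ∂(μ j) ∂κ' ≤ a)
    (hb : ∫⁻ x, ENNReal.ofReal ((x.ofLp ⬝ᵥ S *ᵥ x.ofLp) ^ (q / 2)) ∂κ ≤ b)
    (hb' : ∫⁻ x, ENNReal.ofReal ((x.ofLp ⬝ᵥ S *ᵥ x.ofLp) ^ (q / 2)) ∂κ' ≤ b) (i : Fin n) :
    ENNReal.ofReal |∫ ω, f (quadForm A ω) ∂(Measure.pi (Function.update μ i κ))
        - ∫ ω, f (quadForm A ω) ∂(Measure.pi (Function.update μ i κ'))|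
      ≤ ENNReal.ofReal (22 * K * 2 ^ q) * (∑ j, ENNReal.ofReal (|A i j| ^ q) * a
        + ENNReal.ofReal ((∑ j, A i j ^ 2) ^ (q / 2)) * b) := by
  set r : (Fin n → EuclideanSpace ℝ (Fin d)) → ℝ := fun ω => quadForm A (Function.update ω i 0)
  set s := rowComb (d := d) A i
  have hupd : ∀ (ω : Fin n → EuclideanSpace ℝ (Fin d)) x,
      quadForm A (Function.update ω i x) = r ω + 2 * inner ℝ x (s ω) :=
    fun ω x => quadForm_update hA hdiag i ω x
  have hsm : Measurable s := measurable_rowComb A i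
  have hrm : Measurable r := by
    have h0 : Measurable fun ω : Fin n → EuclideanSpace ℝ (Fin d) =>
        (ω, (0 : EuclideanSpace ℝ (Fin d))) := by fun_prop
    exact (measurable_quadForm A).comp ((measurable_update_prod i).comp h0)
  have hbound : ∀ x, ‖f x‖ ≤ 1 := fun x => by
    rw [Real.norm_eq_abs, abs_of_nonneg (hf0 x)]; exact hf1 x
  have hjoint : Measurable fun p : (Fin n → EuclideanSpace ℝ (Fin d)) × EuclideanSpace ℝ (Fin d) =>
      f (r p.1 + 2 * inner ℝ p.2 (s p.1)) := by
    refine hf.measurable.comp ((hrm.comp measurable_fst).add (Measurable.const_mul ?_ _))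
    exact measurable_snd.inner (hsm.comp measurable_fst)
  -- The resampled coordinate is integrated first, with the intercept `r ω` and slope vector `s ω`
  -- held fixed.
  have hfub : ∀ (m : Measure (EuclideanSpace ℝ (Fin d))) [IsProbabilityMeasure m],
      ∫ ω, f (quadForm A ω) ∂(Measure.pi (Function.update μ i m))
        = ∫ ω, ∫ x, f (r ω + 2 * inner ℝ x (s ω)) ∂m ∂(Measure.pi μ) := by
    intro m _
    have hfm : Measurable fun ω : Fin n → EuclideanSpace ℝ (Fin d) => f (quadForm A ω) :=
      hf.measurable.comp (measurable_quadForm A)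
    rw [← Measure.map_update_prod_pi, integral_map (measurable_update_prod i).aemeasurable
      hfm.aestronglyMeasurable]
    simp_rw [hupd]
    rw [integral_prod]
    exact Integrable.of_bound hjoint.aestronglyMeasurable 1 (ae_of_all _ fun p => hbound _)
  have hinner : ∀ (m : Measure (EuclideanSpace ℝ (Fin d))) [IsProbabilityMeasure m],
      Integrable (fun ω => ∫ x, f (r ω + 2 * inner ℝ x (s ω)) ∂m) (Measure.pi μ) := by
    intro m _
    refine Integrable.of_bound hjoint.stronglyMeasurable.integral_prod_right.aestronglyMeasurable 1
      (ae_of_all _ fun ω => ?_)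
    simpa using norm_integral_le_of_norm_le_const (μ := m)
      (ae_of_all _ fun x => hbound (r ω + 2 * inner ℝ x (s ω)))
  -- Tonelli puts x outside, so that Rosenthal's inequality applies to the slope for fixed x.
  have hmom : ∀ (m : Measure (EuclideanSpace ℝ (Fin d))) [IsProbabilityMeasure m],
      (∀ j, ∫⁻ x, ∫⁻ y, ENNReal.ofReal (|inner ℝ x y| ^ q) ∂(μ j) ∂m ≤ a) →
      ∫⁻ x, ENNReal.ofReal ((x.ofLp ⬝ᵥ S *ᵥ x.ofLp) ^ (q / 2)) ∂m ≤ b →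
      ∫⁻ ω, ∫⁻ x, ENNReal.ofReal (|inner ℝ x (s ω)| ^ q) ∂m ∂(Measure.pi μ)
        ≤ 11 * (∑ j, ENNReal.ofReal (|A i j| ^ q) * a
          + ENNReal.ofReal ((∑ j, A i j ^ 2) ^ (q / 2)) * b) := by
    intro m _ h1 h2
    have hm1 : Measurable fun p : (Fin n → EuclideanSpace ℝ (Fin d)) × EuclideanSpace ℝ (Fin d) =>
        ENNReal.ofReal (|inner ℝ p.2 (s p.1)| ^ q) := by
      have : Measurable fun p : (Fin n → EuclideanSpace ℝ (Fin d)) × EuclideanSpace ℝ (Fin d) =>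
        inner ℝ p.2 (s p.1) := measurable_snd.inner (hsm.comp measurable_fst)
      fun_prop
    rw [lintegral_lintegral_swap hm1.aemeasurable]
    refine (lintegral_mono fun x => lintegral_abs_inner_rowComb_rpow_le hq hq' A i μ hμ x).trans ?_
    have hm2 : ∀ j, Measurable fun x => ∫⁻ y, ENNReal.ofReal (|inner ℝ x y| ^ q) ∂(μ j) := by
      intro j
      refine Measurable.lintegral_prod_right' (f := fun p : EuclideanSpace ℝ (Fin d) ×
        EuclideanSpace ℝ (Fin d) => ENNReal.ofReal (|inner ℝ p.1 p.2| ^ q)) ?_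
      fun_prop
    have hm3 : Measurable fun x : EuclideanSpace ℝ (Fin d) =>
        ENNReal.ofReal ((x.ofLp ⬝ᵥ S *ᵥ x.ofLp) ^ (q / 2)) :=
      ((measurable_dotProduct_mulVec S).pow_const _).ennreal_ofReal
    rw [lintegral_const_mul _ (by fun_prop), lintegral_add_left (by fun_prop),
      lintegral_finsetSum _ (by fun_prop), lintegral_const_mul _ hm3]
    gcongr with j
    rw [lintegral_const_mul _ (hm2 j)]
    gcongr
    exact h1 j
  rw [hfub κ, hfub κ', ← integral_sub (hinner κ) (hinner κ'), ← Real.norm_eq_abs, ofReal_norm]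
  refine (enorm_integral_le_lintegral_enorm _).trans ?_
  have hpt : ∀ ω, ‖∫ x, f (r ω + 2 * inner ℝ x (s ω)) ∂κ
        - ∫ x, f (r ω + 2 * inner ℝ x (s ω)) ∂κ'‖ₑ
      ≤ ENNReal.ofReal (K * 2 ^ q) * (∫⁻ x, ENNReal.ofReal (|inner ℝ x (s ω)| ^ q) ∂κ
        + ∫⁻ x, ENNReal.ofReal (|inner ℝ x (s ω)| ^ q) ∂κ') := by
    intro ω
    have e1 := ofReal_abs_integral_sub_taylor_le hκ hf hf0 hf1 hK htaylor (r ω) (s ω)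
    have e2 := ofReal_abs_integral_sub_taylor_le hκ' hf hf0 hf1 hK htaylor (r ω) (s ω)
    rw [mul_add]
    refine le_trans ?_ (add_le_add e1 e2)
    rw [← ofReal_norm, Real.norm_eq_abs, ← ENNReal.ofReal_add (abs_nonneg _) (abs_nonneg _)]
    refine ENNReal.ofReal_le_ofReal ?_
    -- This common Taylor value cancels between the two laws, leaving only the two remainders.
    set c := f (r ω) + f₂ (r ω) * 2 * ((s ω).ofLp ⬝ᵥ S *ᵥ (s ω).ofLp)
    calc _ = |(∫ x, f (r ω + 2 * inner ℝ x (s ω)) ∂κ - c)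
          - (∫ x, f (r ω + 2 * inner ℝ x (s ω)) ∂κ' - c)| := by congr 1; ring
      _ ≤ _ := abs_sub _ _
  refine (lintegral_mono hpt).trans ?_
  have hm4 : ∀ (m : Measure (EuclideanSpace ℝ (Fin d))) [IsProbabilityMeasure m],
      Measurable fun ω => ∫⁻ x, ENNReal.ofReal (|inner ℝ x (s ω)| ^ q) ∂m := by
    intro m _
    refine Measurable.lintegral_prod_right' (f := fun p : (Fin n → EuclideanSpace ℝ (Fin d)) ×
      EuclideanSpace ℝ (Fin d) => ENNReal.ofReal (|inner ℝ p.2 (s p.1)| ^ q)) ?_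
    have : Measurable fun p : (Fin n → EuclideanSpace ℝ (Fin d)) × EuclideanSpace ℝ (Fin d) =>
      inner ℝ p.2 (s p.1) := measurable_snd.inner (hsm.comp measurable_fst)
    fun_prop
  have hm5 : Measurable fun ω => ∫⁻ x, ENNReal.ofReal (|inner ℝ x (s ω)| ^ q) ∂κ
      + ∫⁻ x, ENNReal.ofReal (|inner ℝ x (s ω)| ^ q) ∂κ' := (hm4 κ).add (hm4 κ')
  rw [lintegral_const_mul _ hm5, lintegral_add_left (hm4 κ)]
  refine (mul_le_mul_right (add_le_add (hmom κ ha hb) (hmom κ' ha' hb')) _).trans (le_of_eq ?_)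
  -- The factor 22 is one Rosenthal constant 11 for each of the two laws.
  have e22 : ENNReal.ofReal (22 * K * 2 ^ q) = ENNReal.ofReal (K * 2 ^ q) * (11 + 11) := by
    rw [show 22 * K * 2 ^ q = (K * 2 ^ q) * 22 by ring,
      ENNReal.ofReal_mul (p := K * 2 ^ q) (by positivity), ENNReal.ofReal_ofNat]
    norm_num
  rw [e22, ← add_mul, ← mul_assoc]

/-- **Lindeberg's swapping argument** for off-diagonal quadratic forms in independent vectors. -/
theorem ofReal_abs_integral_quadForm_sub_le {q : ℝ} (hq : 2 < q) (hq' : q ≤ 3)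
    {A : Matrix (Fin n) (Fin n) ℝ} (hA : A.IsHermitian) (hdiag : ∀ i, A i i = 0)
    {f f₁ f₂ : ℝ → ℝ} (hf : Continuous f) (hf0 : ∀ x, 0 ≤ f x) (hf1 : ∀ x, f x ≤ 1) {K : ℝ}
    (hK : 0 ≤ K) (htaylor : ∀ a y, |f (a + y) - f a - f₁ a * y - f₂ a * y ^ 2 / 2| ≤ K * |y| ^ q)
    (ν γ : Measure (EuclideanSpace ℝ (Fin d))) [IsProbabilityMeasure ν] [IsProbabilityMeasure γ]
    (hν : HasCenteredCov ν S) (hγ : HasCenteredCov γ S) {a b : ℝ≥0∞}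
    (ha : ∀ κ ∈ ({ν, γ} : Set (Measure (EuclideanSpace ℝ (Fin d)))), ∀ κ' ∈ ({ν, γ} : Set _),
      ∫⁻ x, ∫⁻ y, ENNReal.ofReal (|inner ℝ x y| ^ q) ∂κ' ∂κ ≤ a)
    (hb : ∀ κ ∈ ({ν, γ} : Set (Measure (EuclideanSpace ℝ (Fin d)))),
      ∫⁻ x, ENNReal.ofReal ((x.ofLp ⬝ᵥ S *ᵥ x.ofLp) ^ (q / 2)) ∂κ ≤ b) :
    ENNReal.ofReal |∫ ω, f (quadForm A ω) ∂(Measure.pi fun _ : Fin n => ν)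
        - ∫ ω, f (quadForm A ω) ∂(Measure.pi fun _ : Fin n => γ)|
      ≤ ENNReal.ofReal (22 * K * 2 ^ q) * ∑ i, (∑ j, ENNReal.ofReal (|A i j| ^ q) * a
        + ENNReal.ofReal ((∑ j, A i j ^ 2) ^ (q / 2)) * b) := by
  -- Hybrid k has law γ in the coordinates below k and ν in the others. Consecutive hybrids differ
  -- in one coordinate, and the others mix both laws, whence the moment bounds for all four pairs.
  set hyb : ℕ → Fin n → Measure (EuclideanSpace ℝ (Fin d)) :=
    fun k i => if i.val < k then γ else ν with hhyb
  have hmem : ∀ k i, hyb k i ∈ ({ν, γ} : Set (Measure (EuclideanSpace ℝ (Fin d)))) := by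
    intro k i; simp only [hhyb]; split_ifs <;> simp
  have hprob : ∀ k i, IsProbabilityMeasure (hyb k i) := by
    intro k i; simp only [hhyb]; split_ifs <;> infer_instance
  have hcov : ∀ k i, HasCenteredCov (hyb k i) S := by
    intro k i; simp only [hhyb]; split_ifs <;> assumption
  set I : ℕ → ℝ := fun k => ∫ ω, f (quadForm A ω) ∂(Measure.pi (hyb k)) with hI
  have h0 : hyb 0 = fun _ => ν := by ext1 i; simp [hhyb]
  have hn : hyb n = fun _ => γ := by ext1 i; simp [hhyb]
  have hstep : ∀ k : Fin n, ENNReal.ofReal |I k - I (k + 1)|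
      ≤ ENNReal.ofReal (22 * K * 2 ^ q) * (∑ j, ENNReal.ofReal (|A k j| ^ q) * a
        + ENNReal.ofReal ((∑ j, A k j ^ 2) ^ (q / 2)) * b) := by
    intro k
    have e1 : hyb k = Function.update (hyb k) k ν := by
      ext1 i
      rcases eq_or_ne i k with rfl | hi
      · simp [hhyb]
      · simp [hi]
    have e2 : hyb (k + 1) = Function.update (hyb k) k γ := by
      ext1 i
      rcases eq_or_ne i k with rfl | hi
      · simp [hhyb]
      · have hi' : i.val ≠ k.val := fun h => hi (Fin.ext h)
        simp only [hhyb, Function.update_of_ne hi]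
        congr 1
        simp only [eq_iff_iff]
        omega
    simp only [hI]
    rw [e2]
    nth_rewrite 1 [e1]
    exact ofReal_abs_integral_update_sub_le hq hq' hA hdiag hf hf0 hf1 hK htaylor (hyb k) (hcov k)
      ν γ hν hγ (fun j => ha ν (by simp) _ (hmem k j)) (fun j => ha γ (by simp) _ (hmem k j))
      (hb ν (by simp)) (hb γ (by simp)) k
  have htel : I 0 - I n = ∑ k : Fin n, (I k - I (k + 1)) := by
    rw [Fin.sum_univ_eq_sum_range (fun k => I k - I (k + 1)), Finset.sum_range_sub']
  have e0 : ∫ ω, f (quadForm A ω) ∂(Measure.pi fun _ : Fin n => ν) = I 0 := by simp only [hI, h0]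
  have en : ∫ ω, f (quadForm A ω) ∂(Measure.pi fun _ : Fin n => γ) = I n := by simp only [hI, hn]
  rw [e0, en, htel, Finset.mul_sum]
  refine (ENNReal.ofReal_le_ofReal (Finset.abs_sum_le_sum_abs _ _)).trans ?_
  rw [ENNReal.ofReal_sum_of_nonneg fun k _ => abs_nonneg _]
  exact Finset.sum_le_sum fun k _ => hstep k

/-- Second moment of an off-diagonal quadratic form. -/
theorem lintegral_quadForm_sq_le {A : Matrix (Fin n) (Fin n) ℝ} (hA : A.IsHermitian)
    (hdiag : ∀ i, A i i = 0) (ν : Measure (EuclideanSpace ℝ (Fin d))) [IsProbabilityMeasure ν]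
    (hν : HasCenteredCov ν S) :
    ∫⁻ ω, ENNReal.ofReal (quadForm A ω ^ 2) ∂(Measure.pi fun _ : Fin n => ν)
      ≤ ENNReal.ofReal (4 * (∑ i, ∑ j, A i j ^ 2) * ∑ k, ∑ l, S k l ^ 2) := by
  -- E⟨s, x⟩² over an independent copy x is computed in both orders: sᵀSs when s is fixed, a sum of
  -- variances when x is fixed.
  have hrowsq : ∀ (B : Matrix (Fin n) (Fin n) ℝ) (i : Fin n),
      ∫⁻ ω, ENNReal.ofReal ((rowComb B i ω).ofLp ⬝ᵥ S *ᵥ (rowComb B i ω).ofLp)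
        ∂(Measure.pi fun _ : Fin n => ν)
      = ENNReal.ofReal ((∑ j, B i j ^ 2) * ∑ k, ∑ l, S k l ^ 2) := by
    intro B i
    have hsm : Measurable (rowComb (d := d) B i) := measurable_rowComb B i
    have h1 : ∀ ω : Fin n → EuclideanSpace ℝ (Fin d),
        ENNReal.ofReal ((rowComb B i ω).ofLp ⬝ᵥ S *ᵥ (rowComb B i ω).ofLp)
        = ∫⁻ x, ENNReal.ofReal (inner ℝ (rowComb B i ω) x ^ 2) ∂ν := by
      intro ω
      rw [← hν.integral_inner_sq, ofReal_integral_eq_lintegral_ofReal (hν.integrable_inner_sq _)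
        (ae_of_all _ fun x => sq_nonneg _)]
    have h2 : ∀ x : EuclideanSpace ℝ (Fin d),
        ∫⁻ ω, ENNReal.ofReal (inner ℝ (rowComb B i ω) x ^ 2) ∂(Measure.pi fun _ : Fin n => ν)
        = ENNReal.ofReal ((∑ j, B i j ^ 2) * (x.ofLp ⬝ᵥ S *ᵥ x.ofLp)) := by
      intro x
      have hL : ∀ j, MemLp (fun y => B i j * inner ℝ x y) 2 ν := fun j =>
        (hν.memLp_inner x).const_mul _
      have e : (fun ω => inner ℝ (rowComb B i ω) x)
          = ∑ j, fun ω : Fin n → EuclideanSpace ℝ (Fin d) =>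
            (fun y => B i j * inner ℝ x y) (ω j) := by
        ext ω
        rw [rowComb, sum_inner, Finset.sum_apply]
        refine Finset.sum_congr rfl fun j _ => ?_
        rw [inner_smul_left, real_inner_comm]; simp
      have hL' : ∀ j, MemLp (fun ω : Fin n → EuclideanSpace ℝ (Fin d) => B i j * inner ℝ x (ω j)) 2
          (Measure.pi fun _ : Fin n => ν) := fun j =>
        (hL j).comp_measurePreserving (measurePreserving_eval (fun _ : Fin n => ν) j)
      have hsum : MemLp (fun ω => inner ℝ (rowComb B i ω) x) 2 (Measure.pi fun _ : Fin n => ν) := by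
        rw [e]; exact memLp_finsetSum' _ fun j _ => hL' j
      have hint0 : ∀ j, ∫ ω, B i j * inner ℝ x (ω j) ∂(Measure.pi fun _ : Fin n => ν) = 0 := by
        intro j
        have := (measurePreserving_eval (fun _ : Fin n => ν) j).map_eq
        have h3 := integral_map (μ := Measure.pi fun _ : Fin n => ν)
          (measurable_pi_apply j).aemeasurable
          (f := fun y : EuclideanSpace ℝ (Fin d) => B i j * inner ℝ x y) (by fun_prop)
        refine h3.symm.trans ?_
        rw [show (fun ω : Fin n → EuclideanSpace ℝ (Fin d) => ω j) = Function.eval j from rfl, this,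
          integral_const_mul, hν.integral_inner, mul_zero]
      have hmean : ∫ ω, inner ℝ (rowComb B i ω) x ∂(Measure.pi fun _ : Fin n => ν) = 0 := by
        have e' : ∀ ω, inner ℝ (rowComb B i ω) x = ∑ j, B i j * inner ℝ x (ω j) := fun ω => by
          simpa using congrFun e ω
        simp_rw [e']
        refine (integral_finsetSum _ fun j _ => (hL' j).integrable (by norm_num)).trans ?_
        exact Finset.sum_eq_zero fun j _ => hint0 j
      rw [← ofReal_integral_eq_lintegral_ofReal hsum.integrable_sq
        (ae_of_all _ fun ω => sq_nonneg _),
        ← variance_of_integral_eq_zero hsum.aestronglyMeasurable.aemeasurable hmean, e,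
        variance_sum_pi hL, Finset.sum_mul]
      congr 1
      refine Finset.sum_congr rfl fun j _ => ?_
      rw [variance_const_mul, variance_of_integral_eq_zero (by fun_prop) (hν.integral_inner x),
        hν.integral_inner_sq]
    simp_rw [h1]
    rw [lintegral_lintegral_swap (by
      have : Measurable fun p : (Fin n → EuclideanSpace ℝ (Fin d)) × EuclideanSpace ℝ (Fin d) =>
        inner ℝ (rowComb B i p.1) p.2 := (hsm.comp measurable_fst).inner measurable_snd
      exact (this.pow_const 2).ennreal_ofReal.aemeasurable)]
    simp_rw [h2]
    rw [← ofReal_integral_eq_lintegral_ofReal (hν.integrable_dotProduct_mulVec.const_mul _)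
      (ae_of_all _ fun x => mul_nonneg (Finset.sum_nonneg fun j _ => sq_nonneg _)
        (dotProduct_mulVec_nonneg hν.posSemidef _)), integral_const_mul,
      hν.integral_dotProduct_mulVec]
  have hS0 : 0 ≤ ∑ k, ∑ l, S k l ^ 2 :=
    Finset.sum_nonneg fun i _ => Finset.sum_nonneg fun j _ => sq_nonneg _
  -- The form is restricted to indices in t, and t grows by one index. Each new index adds 4 times
  -- the mean of sᵀSs, by orthogonality of the affine increment. Enlarging its row to the full row
  -- of A counts each pair twice, whence 4 instead of the exact 2.
  have key : ∀ t : Finset (Fin n),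
      ∫⁻ ω, ENNReal.ofReal
          (quadForm (Matrix.of fun i j => if i ∈ t ∧ j ∈ t then A i j else 0) ω ^ 2)
        ∂(Measure.pi fun _ : Fin n => ν)
      ≤ ENNReal.ofReal (4 * (∑ i ∈ t, ∑ j, A i j ^ 2) * ∑ k, ∑ l, S k l ^ 2) := by
    intro t
    induction t using Finset.induction_on with
    | empty => simp [quadForm]
    | insert c t hc ih =>
      set B := Matrix.of fun i j => if i ∈ t ∧ j ∈ t then A i j else 0 with hB
      set B' := Matrix.of fun i j => if i ∈ insert c t ∧ j ∈ insert c t then A i j else 0 with hB'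
      have hB'h : B'.IsHermitian := by
        ext i j
        have := hA.apply i j
        simp only [star_trivial] at this
        simp only [hB', Matrix.conjTranspose_apply, Matrix.of_apply, star_trivial, this]
        congr 1
        exact propext and_comm
      have hB'd : ∀ i, B' i i = 0 := fun i => by simp [hB', hdiag i]
      have hrest : ∀ ω : Fin n → EuclideanSpace ℝ (Fin d),
          quadForm B' (Function.update ω c 0) = quadForm B ω := by
        intro ω
        unfold quadForm
        refine Finset.sum_congr rfl fun i _ => Finset.sum_congr rfl fun j _ => ?_
        rcases eq_or_ne i c with rfl | hi
        · simp [hB, hc]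
        rcases eq_or_ne j c with rfl | hj
        · simp [hB, hc]
        simp [hB, hB', hi, hj]
      have hpi : Measure.pi (fun _ : Fin n => ν)
          = ((Measure.pi fun _ : Fin n => ν).prod ν).map
            (fun p => Function.update p.1 c p.2) := by
        rw [Measure.map_update_prod_pi]; congr 1; ext1 j; simp [Function.update_apply]
      have hm1 : Measurable fun ω : Fin n → EuclideanSpace ℝ (Fin d) =>
          ENNReal.ofReal (quadForm B' ω ^ 2) :=
        ((measurable_quadForm B').pow_const 2).ennreal_ofReal
      have hpt : ∀ ω : Fin n → EuclideanSpace ℝ (Fin d),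
          ∫⁻ x, ENNReal.ofReal (quadForm B' (Function.update ω c x) ^ 2) ∂ν
          = ENNReal.ofReal (quadForm B ω ^ 2)
            + 4 * ENNReal.ofReal ((rowComb B' c ω).ofLp ⬝ᵥ S *ᵥ (rowComb B' c ω).ofLp) := by
        intro ω
        have e : ∀ x, quadForm B' (Function.update ω c x) ^ 2
            = quadForm B ω ^ 2 + 4 * quadForm B ω * inner ℝ (rowComb B' c ω) x
              + 4 * inner ℝ (rowComb B' c ω) x ^ 2 := by
          intro x
          rw [quadForm_update hB'h hB'd, hrest, real_inner_comm]; ring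
        have i1 := ((hν.memLp_inner (rowComb B' c ω)).integrable (by norm_num)).const_mul
          (4 * quadForm B ω)
        have i2 := (hν.integrable_inner_sq (rowComb B' c ω)).const_mul 4
        have i3 : Integrable (fun x => quadForm B ω ^ 2
            + 4 * quadForm B ω * inner ℝ (rowComb B' c ω) x) ν := (integrable_const _).add i1
        rw [← ofReal_integral_eq_lintegral_ofReal (by simp_rw [e]; exact i3.add i2)
          (ae_of_all _ fun x => sq_nonneg _)]
        simp_rw [e]
        rw [integral_add i3 i2, integral_add (integrable_const _) i1, integral_const_mul,
          integral_const_mul, hν.integral_inner, hν.integral_inner_sq, mul_zero, add_zero,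
          integral_const, probReal_univ, one_smul, ENNReal.ofReal_add (sq_nonneg _)
            (mul_nonneg (by norm_num) (dotProduct_mulVec_nonneg hν.posSemidef _)),
          ENNReal.ofReal_mul (by norm_num)]
        simp
      have hm2 : Measurable fun p : (Fin n → EuclideanSpace ℝ (Fin d)) × EuclideanSpace ℝ (Fin d) =>
          ENNReal.ofReal (quadForm B' (Function.update p.1 c p.2) ^ 2) :=
        hm1.comp (measurable_update_prod c)
      rw [hpi, lintegral_map hm1 (measurable_update_prod c), lintegral_prod _ hm2.aemeasurable]
      simp_rw [hpt]
      have hm3 : Measurable fun ω : Fin n → EuclideanSpace ℝ (Fin d) =>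
          ENNReal.ofReal ((rowComb B' c ω).ofLp ⬝ᵥ S *ᵥ (rowComb B' c ω).ofLp) :=
        ((measurable_dotProduct_mulVec S).comp (measurable_rowComb B' c)).ennreal_ofReal
      rw [lintegral_add_left ((measurable_quadForm B).pow_const 2).ennreal_ofReal,
        lintegral_const_mul _ hm3, hrowsq]
      have hle : ∑ j, B' c j ^ 2 ≤ ∑ j, A c j ^ 2 := by
        refine Finset.sum_le_sum fun j _ => ?_
        simp only [hB', Matrix.of_apply]
        split_ifs
        · exact le_rfl
        · simpa using sq_nonneg (A c j)
      rw [Finset.sum_insert hc, mul_add, add_mul, add_comm, ENNReal.ofReal_add (by positivity)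
        (by positivity)]
      refine add_le_add ?_ ih
      rw [show (4 : ℝ≥0∞) = ENNReal.ofReal 4 by simp, ← ENNReal.ofReal_mul (by norm_num), mul_assoc]
      gcongr
  have := key Finset.univ
  simp only [Finset.mem_univ, and_self, if_true] at this
  exact this

end Replacement

/-! ### Quantitative Lindeberg central limit theorem -/

/-- Cosine and sine each contribute 2·1 + 1 = 3 from the real Taylor estimate. Below, q = 3 serves
small values and q = 2 large ones. -/
theorem norm_cexp_sub_taylor_two_le {q : ℝ} (hq : 2 ≤ q) (hq' : q ≤ 3) (u : ℝ) :
    ‖Complex.exp (u * Complex.I) - (1 + u * Complex.I - u ^ 2 / 2)‖ ≤ 6 * |u| ^ q := by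
  have hc := abs_taylor_two_le (g := Real.cos) (g₁ := fun x => -Real.sin x)
    (g₂ := fun x => -Real.cos x) (g₃ := fun x => Real.sin x) (K₂ := 1) (K₃ := 1)
    (fun x => Real.hasDerivAt_cos x) (fun x => (Real.hasDerivAt_sin x).neg)
    (fun x => ((Real.hasDerivAt_cos x).neg).congr_deriv (neg_neg _))
    (fun x => by simpa using Real.abs_cos_le_one x) (fun x => Real.abs_sin_le_one x) hq hq' 0 u
  have hs := abs_taylor_two_le (g := Real.sin) (g₁ := fun x => Real.cos x)
    (g₂ := fun x => -Real.sin x) (g₃ := fun x => -Real.cos x) (K₂ := 1) (K₃ := 1)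
    (fun x => Real.hasDerivAt_sin x) (fun x => Real.hasDerivAt_cos x)
    (fun x => (Real.hasDerivAt_sin x).neg)
    (fun x => by simpa using Real.abs_sin_le_one x)
    (fun x => by simpa using Real.abs_cos_le_one x) hq hq' 0 u
  simp only [zero_add, Real.cos_zero, Real.sin_zero, neg_zero, zero_mul, sub_zero, one_mul,
    zero_div] at hc hs
  have e : Complex.exp (u * Complex.I) - (1 + u * Complex.I - u ^ 2 / 2)
      = ((Real.cos u - 1 - -1 * u ^ 2 / 2 : ℝ) : ℂ) + ((Real.sin u - u : ℝ) : ℂ) * Complex.I := by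
    rw [Complex.exp_mul_I]; push_cast; ring
  rw [e]
  refine (norm_add_le _ _).trans ?_
  rw [norm_mul, Complex.norm_I, mul_one, Complex.norm_real, Complex.norm_real, Real.norm_eq_abs,
    Real.norm_eq_abs]
  linarith

theorem norm_prod_sub_prod_le_sum {ι : Type*} (s : Finset ι) (a b : ι → ℂ)
    (ha : ∀ i, ‖a i‖ ≤ 1) (hb : ∀ i, ‖b i‖ ≤ 1) :
    ‖∏ i ∈ s, a i - ∏ i ∈ s, b i‖ ≤ ∑ i ∈ s, ‖a i - b i‖ := by
  classical
  induction s using Finset.induction_on with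
  | empty => simp
  | insert c s hc ih =>
    rw [Finset.prod_insert hc, Finset.prod_insert hc, Finset.sum_insert hc]
    have e : a c * ∏ i ∈ s, a i - b c * ∏ i ∈ s, b i
        = (a c - b c) * ∏ i ∈ s, a i + b c * (∏ i ∈ s, a i - ∏ i ∈ s, b i) := by ring
    rw [e]
    refine (norm_add_le _ _).trans ?_
    rw [norm_mul, norm_mul]
    have h1 : ‖∏ i ∈ s, a i‖ ≤ 1 := by
      rw [norm_prod]; exact Finset.prod_le_one (fun _ _ => norm_nonneg _) fun i _ => ha i
    refine add_le_add (mul_le_of_le_one_right (norm_nonneg _) h1) ?_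
    exact (mul_le_of_le_one_left (norm_nonneg _) (hb c)).trans ih

section CentralLimit

variable {Ω : Type*} {mΩ : MeasurableSpace Ω} {μ : Measure Ω} [IsProbabilityMeasure μ]

/-- Truncation at ε: the cubic remainder where |X| ≤ ε, the quadratic one where |X| > ε. Then 1 − x
is compared with exp(−x), x = t²v/2, at cost x². Each error is either v times a small factor or a
tail, so it stays small after summation. -/
theorem norm_charFun_sub_gaussian_le {X : Ω → ℝ} (hX : MemLp X 2 μ) (h0 : ∫ ω, X ω ∂μ = 0)
    (t : ℝ) {ε : ℝ} (hε : 0 < ε) :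
    ‖charFun (μ.map X) t - Complex.exp ((-(t ^ 2 * (∫ ω, X ω ^ 2 ∂μ) / 2) : ℝ) : ℂ)‖
      ≤ 6 * |t| ^ 3 * ε * (∫ ω, X ω ^ 2 ∂μ) + 6 * t ^ 2 * (∫ ω in {ω | ε < |X ω|}, X ω ^ 2 ∂μ)
        + t ^ 4 * (ε ^ 2 + ∫ ω in {ω | ε < |X ω|}, X ω ^ 2 ∂μ) * (∫ ω, X ω ^ 2 ∂μ) := by
  set v := ∫ ω, X ω ^ 2 ∂μ with hv
  set L := ∫ ω in {ω | ε < |X ω|}, X ω ^ 2 ∂μ with hL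
  have hXm : AEMeasurable X μ := hX.aestronglyMeasurable.aemeasurable
  have hv0 : 0 ≤ v := integral_nonneg fun ω => sq_nonneg _
  have hXi : Integrable X μ := hX.integrable (by norm_num)
  have hX2 : Integrable (fun ω => X ω ^ 2) μ := hX.integrable_sq
  have hset : NullMeasurableSet {ω | ε < |X ω|} μ :=
    nullMeasurableSet_lt aemeasurable_const (by fun_prop)
  have hind : Integrable ({ω | ε < |X ω|}.indicator fun ω => X ω ^ 2) μ :=
    hX2.indicator₀ hset
  have hLi : ∫ ω, {ω | ε < |X ω|}.indicator (fun ω => X ω ^ 2) ω ∂μ = L :=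
    integral_indicator₀ hset
  -- This bounds v² by (ε² + L)v, which can be summed when the variances add up to one.
  have hvL : v ≤ ε ^ 2 + L := by
    rw [← hLi, hv]
    have : ∫ ω, X ω ^ 2 ∂μ ≤ ∫ ω, (ε ^ 2 + {ω | ε < |X ω|}.indicator (fun ω => X ω ^ 2) ω) ∂μ := by
      refine integral_mono hX2 ((integrable_const _).add hind) fun ω => ?_
      by_cases h : ω ∈ {ω | ε < |X ω|}
      · simp only [Set.indicator_of_mem h]; nlinarith
      · simp only [Set.indicator_of_notMem h]
        have h' : |X ω| ≤ ε := not_lt.1 h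
        rw [add_zero, ← sq_abs]
        exact pow_le_pow_left₀ (abs_nonneg _) h' 2
    rwa [integral_add (integrable_const _) hind, integral_const, probReal_univ, one_smul] at this
  have step1 : ‖charFun (μ.map X) t - ((1 - t ^ 2 * v / 2 : ℝ) : ℂ)‖
      ≤ 6 * |t| ^ 3 * ε * v + 6 * t ^ 2 * L := by
    have c1 : charFun (μ.map X) t = ∫ ω, Complex.exp (((t * X ω : ℝ) : ℂ) * Complex.I) ∂μ := by
      rw [charFun_apply_real, integral_map hXm (Continuous.aestronglyMeasurable (by fun_prop))]
      simp
    have i1 : Integrable (fun ω => Complex.exp (((t * X ω : ℝ) : ℂ) * Complex.I)) μ := by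
      refine Integrable.of_bound ?_ 1
        (ae_of_all _ fun ω => by rw [Complex.norm_exp_ofReal_mul_I])
      exact (Continuous.comp_aestronglyMeasurable
        (g := fun x : ℝ => Complex.exp (((t * x : ℝ) : ℂ) * Complex.I)) (by fun_prop)
        hX.aestronglyMeasurable)
    have i2 : Integrable (fun ω => ((t * X ω : ℝ) : ℂ) * Complex.I) μ :=
      ((hXi.const_mul t).ofReal).mul_const _
    have i3 : Integrable (fun ω => (((t * X ω) ^ 2 / 2 : ℝ) : ℂ)) μ := by
      have : Integrable (fun ω => (t * X ω) ^ 2 / 2) μ := by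
        simp_rw [mul_pow]; exact (hX2.const_mul _).div_const 2
      exact this.ofReal
    have i4 : Integrable (fun ω => (1 : ℂ) + ((t * X ω : ℝ) : ℂ) * Complex.I) μ :=
      (integrable_const _).add i2
    have i5 : Integrable (fun ω => (1 : ℂ) + ((t * X ω : ℝ) : ℂ) * Complex.I
        - (((t * X ω) ^ 2 / 2 : ℝ) : ℂ)) μ := i4.sub i3
    have c2 : ((1 - t ^ 2 * v / 2 : ℝ) : ℂ)
        = ∫ ω, ((1 : ℂ) + ((t * X ω : ℝ) : ℂ) * Complex.I - (((t * X ω) ^ 2 / 2 : ℝ) : ℂ)) ∂μ := by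
      rw [integral_sub i4 i3, integral_add (integrable_const _) i2, integral_mul_const,
        integral_complex_ofReal, integral_complex_ofReal, integral_const_mul, h0,
        integral_div]
      simp_rw [mul_pow]
      rw [integral_const_mul, ← hv]
      simp
    rw [c1, c2, ← integral_sub i1 i5]
    have hbound : ∀ ω, ‖Complex.exp (((t * X ω : ℝ) : ℂ) * Complex.I)
          - ((1 : ℂ) + ((t * X ω : ℝ) : ℂ) * Complex.I - (((t * X ω) ^ 2 / 2 : ℝ) : ℂ))‖
        ≤ 6 * |t| ^ 3 * ε * X ω ^ 2
          + 6 * t ^ 2 * {ω | ε < |X ω|}.indicator (fun ω => X ω ^ 2) ω := by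
      intro ω
      have e : (((t * X ω) ^ 2 / 2 : ℝ) : ℂ) = ((t * X ω : ℝ) : ℂ) ^ 2 / 2 := by push_cast; ring
      rw [e]
      by_cases h : ω ∈ {ω | ε < |X ω|}
      · have := norm_cexp_sub_taylor_two_le (q := 2) le_rfl (by norm_num) (t * X ω)
        simp only [Set.indicator_of_mem h]
        refine this.trans ?_
        rw [Real.rpow_two, sq_abs, mul_pow]
        have : 0 ≤ 6 * |t| ^ 3 * ε * X ω ^ 2 := by positivity
        linarith
      · have := norm_cexp_sub_taylor_two_le (q := 3) (by norm_num) le_rfl (t * X ω)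
        have h' : |X ω| ≤ ε := not_lt.1 h
        simp only [Set.indicator_of_notMem h, mul_zero, add_zero]
        refine this.trans ?_
        rw [show (3 : ℝ) = ((3 : ℕ) : ℝ) by norm_num, Real.rpow_natCast, abs_mul, mul_pow]
        calc 6 * (|t| ^ 3 * |X ω| ^ 3) = 6 * |t| ^ 3 * |X ω| * |X ω| ^ 2 := by ring
          _ ≤ 6 * |t| ^ 3 * ε * |X ω| ^ 2 := by gcongr
          _ = _ := by rw [sq_abs]
    have i6 : Integrable (fun ω => 6 * |t| ^ 3 * ε * X ω ^ 2
        + 6 * t ^ 2 * {ω | ε < |X ω|}.indicator (fun ω => X ω ^ 2) ω) μ :=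
      (hX2.const_mul _).add (hind.const_mul _)
    refine (norm_integral_le_of_norm_le i6 (ae_of_all _ hbound)).trans (le_of_eq ?_)
    rw [integral_add (hX2.const_mul _) (hind.const_mul _), integral_const_mul, integral_const_mul,
      hLi]
  have step2 : ‖((1 - t ^ 2 * v / 2 : ℝ) : ℂ) - Complex.exp ((-(t ^ 2 * v / 2) : ℝ) : ℂ)‖
      ≤ t ^ 4 * (ε ^ 2 + L) * v := by
    rw [← Complex.ofReal_exp, ← Complex.ofReal_sub, Complex.norm_real, Real.norm_eq_abs]
    set x := t ^ 2 * v / 2 with hx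
    have hx0 : 0 ≤ x := by positivity
    have hle : |1 - x - Real.exp (-x)| ≤ x ^ 2 := by
      have h1 : 1 - x ≤ Real.exp (-x) := by have := Real.add_one_le_exp (-x); linarith
      rw [abs_of_nonpos (by linarith)]
      rcases le_total x 1 with h | h
      · have := Real.abs_exp_sub_one_sub_id_le (x := -x) (by rwa [abs_neg, abs_of_nonneg hx0])
        have := (abs_le.1 this).2
        nlinarith
      · have : Real.exp (-x) ≤ 1 := Real.exp_le_one_iff.2 (by linarith)
        nlinarith
    refine hle.trans ?_
    rw [hx]
    have : t ^ 4 * v * v ≤ t ^ 4 * (ε ^ 2 + L) * v := by gcongr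
    have h4 : 0 ≤ t ^ 4 * v * v := by positivity
    nlinarith
  calc _ ≤ _ := norm_sub_le_norm_sub_add_norm_sub _ ((1 - t ^ 2 * v / 2 : ℝ) : ℂ) _
    _ ≤ _ := add_le_add step1 step2

/-- As the variances sum to one, exp(−t²/2) factors as ∏ exp(−t²v_i/2). The difference of two
products of numbers in the unit disc is at most the sum of the differences. -/
theorem norm_charFun_sum_sub_gaussian_le {n : ℕ} {X : Fin n → Ω → ℝ} (hind : iIndepFun X μ)
    (hX : ∀ i, MemLp (X i) 2 μ) (h0 : ∀ i, ∫ ω, X i ω ∂μ = 0)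
    (h1 : ∑ i, ∫ ω, X i ω ^ 2 ∂μ = 1) (t : ℝ) {ε : ℝ} (hε : 0 < ε) :
    ‖charFun (μ.map fun ω => ∑ i, X i ω) t - Complex.exp ((-(t ^ 2 / 2) : ℝ) : ℂ)‖
      ≤ 6 * |t| ^ 3 * ε + 6 * t ^ 2 * (∑ i, ∫ ω in {ω | ε < |X i ω|}, X i ω ^ 2 ∂μ)
        + t ^ 4 * (ε ^ 2 + ∑ i, ∫ ω in {ω | ε < |X i ω|}, X i ω ^ 2 ∂μ) := by
  set v : Fin n → ℝ := fun i => ∫ ω, X i ω ^ 2 ∂μ with hv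
  set L : Fin n → ℝ := fun i => ∫ ω in {ω | ε < |X i ω|}, X i ω ^ 2 ∂μ with hL
  have hv0 : ∀ i, 0 ≤ v i := fun i => integral_nonneg fun ω => sq_nonneg _
  have hL0 : ∀ i, 0 ≤ L i := fun i => integral_nonneg fun ω => sq_nonneg _
  have hXm : ∀ i, AEMeasurable (X i) μ := fun i => (hX i).aestronglyMeasurable.aemeasurable
  have hprob : ∀ i, IsProbabilityMeasure (μ.map (X i)) := fun i =>
    Measure.isProbabilityMeasure_map (hXm i)
  rw [hind.charFun_map_fun_sum_eq_prod hXm, Finset.prod_apply]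
  have e : Complex.exp ((-(t ^ 2 / 2) : ℝ) : ℂ)
      = ∏ i, Complex.exp ((-(t ^ 2 * v i / 2) : ℝ) : ℂ) := by
    rw [← Complex.exp_sum, ← Complex.ofReal_sum, Finset.sum_neg_distrib, ← Finset.sum_div,
      ← Finset.mul_sum, h1, mul_one]
  rw [e]
  refine (norm_prod_sub_prod_le_sum Finset.univ _ _ (fun i => norm_charFun_le_one t)
    (fun i => ?_)).trans ?_
  · rw [← Complex.ofReal_exp, Complex.norm_real, Real.norm_eq_abs, abs_of_pos (Real.exp_pos _)]
    exact Real.exp_le_one_iff.2 (by have := hv0 i; rw [neg_nonpos]; positivity)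
  · calc _ ≤ ∑ i, (6 * |t| ^ 3 * ε * v i + 6 * t ^ 2 * L i + t ^ 4 * (ε ^ 2 + ∑ j, L j) * v i) := by
          refine Finset.sum_le_sum fun i _ => ?_
          refine (norm_charFun_sub_gaussian_le (hX i) (h0 i) t hε).trans ?_
          have : L i ≤ ∑ j, L j :=
            Finset.single_le_sum (f := L) (fun j _ => hL0 j) (Finset.mem_univ i)
          have hvi := hv0 i
          gcongr
      _ = _ := by
          rw [Finset.sum_add_distrib, Finset.sum_add_distrib, ← Finset.mul_sum, ← Finset.mul_sum,
            ← Finset.mul_sum, h1]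
          ring

/-- From |e^{ia} − e^{ib}| ≤ |a − b|; an L¹-small perturbation is thus negligible in the limit law.
-/
theorem norm_charFun_map_sub_charFun_map_le {X Y : Ω → ℝ} (hX : AEMeasurable X μ)
    (hY : AEMeasurable Y μ) (hXY : Integrable (fun ω => X ω - Y ω) μ) (t : ℝ) :
    ‖charFun (μ.map X) t - charFun (μ.map Y) t‖ ≤ |t| * ∫ ω, |X ω - Y ω| ∂μ := by
  have c : ∀ Z : Ω → ℝ, AEMeasurable Z μ →
      charFun (μ.map Z) t = ∫ ω, Complex.exp (((t * Z ω : ℝ) : ℂ) * Complex.I) ∂μ ∧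
      Integrable (fun ω => Complex.exp (((t * Z ω : ℝ) : ℂ) * Complex.I)) μ := by
    intro Z hZ
    constructor
    · rw [charFun_apply_real, integral_map hZ (Continuous.aestronglyMeasurable (by fun_prop))]
      simp
    · refine Integrable.of_bound ?_ 1
        (ae_of_all _ fun ω => by rw [Complex.norm_exp_ofReal_mul_I])
      exact (Continuous.comp_aestronglyMeasurable
        (g := fun x : ℝ => Complex.exp (((t * x : ℝ) : ℂ) * Complex.I)) (by fun_prop)
        hZ.aestronglyMeasurable)
  rw [(c X hX).1, (c Y hY).1, ← integral_sub (c X hX).2 (c Y hY).2, ← integral_const_mul]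
  refine norm_integral_le_of_norm_le (hXY.abs.const_mul _) (ae_of_all _ fun ω => ?_)
  have e : Complex.exp (((t * X ω : ℝ) : ℂ) * Complex.I)
        - Complex.exp (((t * Y ω : ℝ) : ℂ) * Complex.I)
      = Complex.exp (((t * Y ω : ℝ) : ℂ) * Complex.I)
        * (Complex.exp (Complex.I * ((t * (X ω - Y ω) : ℝ) : ℂ)) - 1) := by
    rw [mul_sub, mul_one, ← Complex.exp_add]
    congr 2
    push_cast; ring
  rw [e, norm_mul, Complex.norm_exp_ofReal_mul_I, one_mul, ← abs_mul]
  exact Real.norm_exp_I_mul_ofReal_sub_one_le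

end CentralLimit

/-! ### The projection matrix and the decomposition of the statistic -/

open scoped Matrix.Norms.Frobenius in
theorem frobNorm_sq {a b : ℕ} (A : Matrix (Fin a) (Fin b) ℝ) :
    frobNorm A ^ 2 = ∑ i, ∑ j, A i j ^ 2 := by
  have h : 0 ≤ ∑ i, ∑ j, ‖A i j‖ ^ (2 : ℝ) :=
    Finset.sum_nonneg fun i _ => Finset.sum_nonneg fun j _ => by positivity
  rw [frobNorm, Matrix.frobenius_norm_def, ← Real.sqrt_eq_rpow, Real.sq_sqrt h]
  simp

open scoped Matrix.Norms.Frobenius in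
theorem frobNorm_nonneg {a b : ℕ} (A : Matrix (Fin a) (Fin b) ℝ) : 0 ≤ frobNorm A := norm_nonneg A

theorem Matrix.mulVec_injective_of_rank_eq {a b : ℕ} {A : Matrix (Fin a) (Fin b) ℝ}
    (h : A.rank = b) : Function.Injective A.mulVec := by
  have h1 := A.mulVecLin.finrank_range_add_finrank_ker
  rw [← Matrix.rank, h, Module.finrank_fin_fun] at h1
  have h2 : LinearMap.ker A.mulVecLin = ⊥ := Submodule.finrank_eq_zero.1 (by omega)
  exact LinearMap.ker_eq_bot.1 h2

theorem rowMatrix_mul_transpose {n d : ℕ} (v : Fin n → EuclideanSpace ℝ (Fin d)) (i j : Fin n) :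
    (rowMatrix v * (rowMatrix v)ᵀ) i j = inner ℝ (v i) (v j) := by
  rw [PiLp.inner_apply, Matrix.mul_apply]
  refine Finset.sum_congr rfl fun k _ => ?_
  simp [rowMatrix, mul_comm]

/-- |A V|_F² = tr(Vᵀ AᵀA V) = tr(A V Vᵀ), and V Vᵀ is the Gram matrix of the rows. -/
theorem frobNorm_mul_rowMatrix_sq {n d : ℕ} {A : Matrix (Fin n) (Fin n) ℝ} (hA : A.IsHermitian)
    (hAA : A * A = A) (v : Fin n → EuclideanSpace ℝ (Fin d)) :
    frobNorm (A * rowMatrix v) ^ 2 = quadForm A v := by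
  have hAt : Aᵀ = A := hA
  have h1 : frobNorm (A * rowMatrix v) ^ 2 = ((A * rowMatrix v)ᵀ * (A * rowMatrix v)).trace := by
    rw [frobNorm_sq, Matrix.trace, Finset.sum_comm]
    generalize A * rowMatrix v = B
    simp only [Matrix.diag_apply, Matrix.mul_apply, Matrix.transpose_apply, sq]
  rw [h1, Matrix.transpose_mul, hAt, Matrix.mul_assoc, ← Matrix.mul_assoc A A, hAA,
    Matrix.trace_mul_comm, Matrix.mul_assoc, Matrix.trace]
  refine Finset.sum_congr rfl fun i _ => ?_
  rw [Matrix.diag_apply, Matrix.mul_apply]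
  refine Finset.sum_congr rfl fun j _ => ?_
  rw [rowMatrix_mul_transpose, real_inner_comm]

namespace ManovaModel

variable (M : ManovaModel)

/-- Full column rank makes the matrix inverse in `P` a true inverse rather than its default value.
-/
theorem posDef_gram : (M.Xᵀ * M.X).PosDef := by
  have := Matrix.PosDef.conjTranspose_mul_self M.X (Matrix.mulVec_injective_of_rank_eq M.rank_X)
  simpa using this

theorem posDef_contrast : (M.C * (M.Xᵀ * M.X)⁻¹ * M.Cᵀ).PosDef := by
  have h := M.posDef_gram.inv.conjTranspose_mul_mul_same (B := M.Cᵀ)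
    (Matrix.mulVec_injective_of_rank_eq (by rw [Matrix.rank_transpose, M.rank_C]))
  simpa using h

theorem P_isHermitian : M.P.IsHermitian := by
  have h1 : ((M.Xᵀ * M.X)⁻¹)ᵀ = (M.Xᵀ * M.X)⁻¹ := M.posDef_gram.inv.1
  have h2 : ((M.C * (M.Xᵀ * M.X)⁻¹ * M.Cᵀ)⁻¹)ᵀ = (M.C * (M.Xᵀ * M.X)⁻¹ * M.Cᵀ)⁻¹ :=
    M.posDef_contrast.inv.1
  rw [Matrix.IsHermitian, Matrix.conjTranspose_eq_transpose_of_trivial, P]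
  generalize (M.C * (M.Xᵀ * M.X)⁻¹ * M.Cᵀ)⁻¹ = D at *
  generalize (M.Xᵀ * M.X)⁻¹ = A at *
  simp only [Matrix.transpose_mul, Matrix.transpose_transpose, h1, h2, Matrix.mul_assoc]

theorem gram_mul_inv : M.Xᵀ * M.X * (M.Xᵀ * M.X)⁻¹ = 1 :=
  Matrix.mul_nonsing_inv _ M.posDef_gram.det_pos.ne'.isUnit

theorem contrast_mul_inv : M.C * (M.Xᵀ * M.X)⁻¹ * M.Cᵀ * (M.C * (M.Xᵀ * M.X)⁻¹ * M.Cᵀ)⁻¹ = 1 :=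
  Matrix.mul_nonsing_inv _ M.posDef_contrast.det_pos.ne'.isUnit

/-- Two cancellations suffice, of the Gram matrix and of the contrast matrix with their inverses;
both inverses are generalized so that only these identities remain. -/
theorem P_mul_P : M.P * M.P = M.P := by
  have h1 := M.gram_mul_inv
  have h2 := M.contrast_mul_inv
  rw [P]
  generalize (M.C * (M.Xᵀ * M.X)⁻¹ * M.Cᵀ)⁻¹ = D at *
  generalize (M.Xᵀ * M.X)⁻¹ = A at *
  calc _ = M.X * A * M.Cᵀ * D * M.C * A * (M.Xᵀ * M.X * A) * M.Cᵀ * D * M.C * A * M.Xᵀ := by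
        simp only [Matrix.mul_assoc]
    _ = M.X * A * M.Cᵀ * D * (M.C * A * M.Cᵀ * D) * M.C * A * M.Xᵀ := by
        rw [h1, Matrix.mul_one]; simp only [Matrix.mul_assoc]
    _ = _ := by rw [h2, Matrix.mul_one]

theorem trace_P : M.P.trace = M.m := by
  have h1 := M.gram_mul_inv
  have h2 := M.contrast_mul_inv
  rw [P]
  generalize (M.C * (M.Xᵀ * M.X)⁻¹ * M.Cᵀ)⁻¹ = D at *
  generalize (M.Xᵀ * M.X)⁻¹ = A at *
  have e : M.X * A * M.Cᵀ * D * M.C * A * M.Xᵀ = M.X * A * M.Cᵀ * D * (M.C * A * M.Xᵀ) := by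
    simp only [Matrix.mul_assoc]
  have e2 : M.C * A * M.Xᵀ * (M.X * A * M.Cᵀ * D) = M.C * A * (M.Xᵀ * M.X * A) * M.Cᵀ * D := by
    simp only [Matrix.mul_assoc]
  rw [e, Matrix.trace_mul_comm, e2, h1, Matrix.mul_one, h2, Matrix.trace_one, Fintype.card_fin]

theorem P_mul_mean (h : M.NullHypothesis) : M.P * (M.X * M.B) = 0 := by
  have h0 : M.C * M.B = 0 := h
  have h1 := mul_eq_one_comm.1 M.gram_mul_inv
  rw [P]
  generalize (M.C * (M.Xᵀ * M.X)⁻¹ * M.Cᵀ)⁻¹ = D at *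
  generalize (M.Xᵀ * M.X)⁻¹ = A at *
  calc _ = M.X * A * M.Cᵀ * D * M.C * (A * (M.Xᵀ * M.X)) * M.B := by
        simp only [Matrix.mul_assoc]
    _ = M.X * A * M.Cᵀ * D * (M.C * M.B) := by rw [h1, Matrix.mul_one]; simp only [Matrix.mul_assoc]
    _ = 0 := by rw [h0, Matrix.mul_zero]

theorem P_symm (i j : Fin M.n) : M.P i j = M.P j i := by
  simpa using M.P_isHermitian.apply j i

/-- The diagonal entry of P = P Pᵀ. It turns row sums of squares into leverages. -/
theorem sum_P_sq (i : Fin M.n) : ∑ j, M.P i j ^ 2 = M.P i i := by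
  conv_rhs => rw [← M.P_mul_P, Matrix.mul_apply]
  exact Finset.sum_congr rfl fun j _ => by rw [sq, M.P_symm j i]

theorem P_diag_nonneg (i : Fin M.n) : 0 ≤ M.P i i := by
  rw [← M.sum_P_sq i]; positivity

theorem sum_P_diag : ∑ i, M.P i i = M.m := M.trace_P

theorem sum_sum_P_sq : ∑ i, ∑ j, M.P i j ^ 2 = M.m := by
  simp_rw [M.sum_P_sq, M.sum_P_diag]

theorem m_pos : (0 : ℝ) < M.m := by exact_mod_cast M.one_le_m

theorem G_eq (z : Fin M.n → EuclideanSpace ℝ (Fin M.d)) : M.G z = quadForm M.P z :=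
  frobNorm_mul_rowMatrix_sq M.P_isHermitian M.P_mul_P z

theorem Q_eq (h : M.NullHypothesis) (ω : M.Ω) : M.Q ω = quadForm M.P (fun i => M.V i ω) := by
  rw [Q, Y, Matrix.mul_add, M.P_mul_mean h, zero_add]
  exact frobNorm_mul_rowMatrix_sq M.P_isHermitian M.P_mul_P _

theorem hasCenteredCov : HasCenteredCov M.ν M.Sigma := ⟨M.memLp_two, M.mean_zero, fun _ _ => rfl⟩

theorem vsig_sq : M.vsig ^ 2 = ∑ k, ∑ l, M.Sigma k l ^ 2 := frobNorm_sq _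

theorem vsig_pos : 0 < M.vsig := by
  obtain ⟨j, k, h⟩ := M.nondegenerate
  have h0 : 0 ≤ M.vsig := frobNorm_nonneg _
  refine h0.lt_of_ne fun hz => h ?_
  have hs := M.vsig_sq
  rw [← hz, zero_pow two_ne_zero] at hs
  have h1 := (Finset.sum_eq_zero_iff_of_nonneg fun i _ => by positivity).1 hs.symm j
    (Finset.mem_univ _)
  have h2 := (Finset.sum_eq_zero_iff_of_nonneg fun i _ => by positivity).1 h1 k (Finset.mem_univ _)
  exact pow_eq_zero_iff two_ne_zero |>.1 h2

theorem hasLaw_V_pi : HasLaw (fun ω i => M.V i ω) (Measure.pi fun _ => M.ν) M.μ where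
  aemeasurable := aemeasurable_pi_lambda _ fun i => (M.hasLaw_V i).aemeasurable
  map_eq := by
    rw [(iIndepFun_iff_map_fun_eq_pi_map fun i => (M.hasLaw_V i).aemeasurable).1 M.indep_V]
    simp_rw [fun i => (M.hasLaw_V i).map_eq]

/-- The off-diagonal part of `P`. -/
noncomputable def offDiag : Matrix (Fin M.n) (Fin M.n) ℝ :=
  Matrix.of fun i j => if i = j then 0 else M.P i j

theorem offDiag_apply (i j : Fin M.n) : M.offDiag i j = if i = j then 0 else M.P i j := rfl

theorem offDiag_diag (i : Fin M.n) : M.offDiag i i = 0 := by simp [offDiag_apply]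

theorem offDiag_isHermitian : M.offDiag.IsHermitian := by
  ext i j
  simp only [Matrix.conjTranspose_apply, star_trivial, offDiag_apply, M.P_symm j i, eq_comm]

theorem offDiag_sq_le (i j : Fin M.n) : M.offDiag i j ^ 2 ≤ M.P i j ^ 2 := by
  rw [offDiag_apply]; split_ifs <;> nlinarith [sq_nonneg (M.P i j)]

theorem sum_offDiag_sq_le (i : Fin M.n) : ∑ j, M.offDiag i j ^ 2 ≤ M.P i i :=
  (Finset.sum_le_sum fun j _ => M.offDiag_sq_le i j).trans_eq (M.sum_P_sq i)

theorem sum_sum_offDiag_sq_le : ∑ i, ∑ j, M.offDiag i j ^ 2 ≤ M.m :=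
  (Finset.sum_le_sum fun i _ => M.sum_offDiag_sq_le i).trans_eq M.sum_P_diag

/-- The centred diagonal part of the quadratic form of `P`. -/
noncomputable def diagForm (x : Fin M.n → EuclideanSpace ℝ (Fin M.d)) : ℝ :=
  ∑ i, M.P i i * (inner ℝ (x i) (x i) - M.Sigma.trace)

@[fun_prop]
theorem measurable_diagForm : Measurable M.diagForm := by
  unfold diagForm; fun_prop

/-- Centring each diagonal term at tr Σ costs tr P · tr Σ = m tr Σ in total. -/
theorem quadForm_P (x : Fin M.n → EuclideanSpace ℝ (Fin M.d)) :
    quadForm M.P x = quadForm M.offDiag x + M.diagForm x + M.m * M.Sigma.trace := by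
  have h1 : quadForm M.P x = quadForm M.offDiag x + ∑ i, M.P i i * inner ℝ (x i) (x i) := by
    rw [quadForm, quadForm, ← Finset.sum_add_distrib]
    refine Finset.sum_congr rfl fun i _ => ?_
    rw [Finset.sum_eq_add_sum_sdiff_singleton_of_mem (Finset.mem_univ i),
      Finset.sum_eq_add_sum_sdiff_singleton_of_mem (Finset.mem_univ i) fun j =>
        M.offDiag i j * _, M.offDiag_diag, zero_mul, zero_add, add_comm]
    congr 1
    refine Finset.sum_congr rfl fun j hj => ?_
    rw [offDiag_apply, if_neg]
    rintro rfl; simp at hj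
  rw [h1, diagForm]
  simp_rw [mul_sub]
  rw [Finset.sum_sub_distrib, ← Finset.sum_mul, M.sum_P_diag]
  ring

end ManovaModel

/-! ### Smoothing inequality and tail of the diagonal part -/

/-- The smoothing inequality: the distribution functions of `T + D` under two laws are compared
through smooth functions of `T`, tail bounds for `D`, and anti-concentration of `T + D` under the
second law. -/
theorem abs_measureReal_sub_le_of_smooth {X : Type*} [MeasurableSpace X] {π₁ π₂ : Measure X}
    [IsProbabilityMeasure π₁] [IsProbabilityMeasure π₂] {T D : X → ℝ} (hT : Measurable T)
    {g : ℝ → ℝ} (hg : Continuous g) (hg0 : ∀ x, 0 ≤ g x) (hg1 : ∀ x, g x ≤ 1)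
    (hgl : ∀ x ≤ 0, g x = 1) (hgr : ∀ x, 1 ≤ x → g x = 0) {a b e L A : ℝ} (hb : 0 < b)
    (hL : ∀ z, |∫ x, g ((T x - z) / b) ∂π₁ - ∫ x, g ((T x - z) / b) ∂π₂| ≤ L)
    (hA : ∀ z, π₂.real {x | |T x + D x - z| ≤ a + b + e} ≤ A) (z : ℝ) :
    |π₁.real {x | T x + D x ≤ z} - π₂.real {x | T x + D x ≤ z}|
      ≤ π₁.real {x | a ≤ |D x|} + π₂.real {x | e ≤ |D x|} + L + A := by
  have hint : ∀ (π : Measure X) [IsProbabilityMeasure π] (z : ℝ),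
      Integrable (fun x => g ((T x - z) / b)) π := by
    intro π _ z
    refine Integrable.of_bound (hg.measurable.comp (by fun_prop)).aestronglyMeasurable 1
      (ae_of_all _ fun x => ?_)
    rw [Real.norm_eq_abs, abs_of_nonneg (hg0 _)]; exact hg1 _
  -- The smooth step of width b lies between the indicators of T ≤ z and T ≤ z + b.
  have hlow : ∀ (π : Measure X) [IsProbabilityMeasure π] (z : ℝ),
      π.real {x | T x ≤ z} ≤ ∫ x, g ((T x - z) / b) ∂π := by
    intro π _ z
    have hm : MeasurableSet {x | T x ≤ z} := measurableSet_le hT measurable_const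
    rw [← integral_indicator_one hm]
    refine integral_mono ((integrable_const _).indicator hm) (hint π z) fun x => ?_
    by_cases h : x ∈ {x | T x ≤ z}
    · rw [Set.indicator_of_mem h, hgl _ (div_nonpos_of_nonpos_of_nonneg (sub_nonpos.2 h) hb.le)]
      rfl
    · rw [Set.indicator_of_notMem h]; exact hg0 _
  have hup : ∀ (π : Measure X) [IsProbabilityMeasure π] (z : ℝ),
      ∫ x, g ((T x - z) / b) ∂π ≤ π.real {x | T x ≤ z + b} := by
    intro π _ z
    have hm : MeasurableSet {x | T x ≤ z + b} := measurableSet_le hT measurable_const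
    rw [← integral_indicator_one hm]
    refine integral_mono (hint π z) ((integrable_const _).indicator hm) fun x => ?_
    by_cases h : x ∈ {x | T x ≤ z + b}
    · rw [Set.indicator_of_mem h]; exact hg1 _
    · rw [Set.indicator_of_notMem h, hgr _ ((one_le_div hb).2 ?_)]
      have : z + b < T x := not_le.1 h
      linarith
  have hD : ∀ {r x : ℝ}, ¬ r ≤ |x| → -r < x ∧ x < r := fun h => abs_lt.1 (not_le.1 h)
  have union₂ : ∀ (π : Measure X) [IsProbabilityMeasure π] {s t u : Set X}, s ⊆ t ∪ u →
      π.real s ≤ π.real t + π.real u := fun π _ s t u h =>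
    (measureReal_mono h).trans (measureReal_union_le _ _)
  rw [abs_sub_le_iff]
  constructor
  -- Drop D under π₁ (shift a), pass to π₂ through the smooth step (shift b), restore D under π₂
  -- (shift e). Anti-concentration pays for the total shift; the other direction is symmetric.
  · have h1 : π₁.real {x | T x + D x ≤ z}
        ≤ π₁.real {x | a ≤ |D x|} + π₁.real {x | T x ≤ z + a} := by
      refine union₂ π₁ fun x hx => ?_
      by_cases h : a ≤ |D x|
      · exact Or.inl h
      · have hx' : T x + D x ≤ z := hx
        refine Or.inr (?_ : T x ≤ z + a)
        linarith [hD h]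
    have h2 := hlow π₁ (z + a)
    have h3 := (abs_le.1 (hL (z + a))).2
    have h4 := hup π₂ (z + a)
    have h5 : π₂.real {x | T x ≤ z + a + b}
        ≤ π₂.real {x | e ≤ |D x|} + π₂.real {x | T x + D x ≤ z + (a + b + e)} := by
      refine union₂ π₂ fun x hx => ?_
      by_cases h : e ≤ |D x|
      · exact Or.inl h
      · have hx' : T x ≤ z + a + b := hx
        refine Or.inr (?_ : T x + D x ≤ z + (a + b + e))
        linarith [hD h]
    have h6 : π₂.real {x | T x + D x ≤ z + (a + b + e)}
        ≤ π₂.real {x | T x + D x ≤ z} + π₂.real {x | |T x + D x - z| ≤ a + b + e} := by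
      refine union₂ π₂ fun x hx => ?_
      have hx' : T x + D x ≤ z + (a + b + e) := hx
      by_cases h : T x + D x ≤ z
      · exact Or.inl h
      · refine Or.inr (?_ : |T x + D x - z| ≤ a + b + e)
        rw [abs_of_pos (by linarith)]; linarith
    linarith [hA z]
  · have h6 : π₂.real {x | T x + D x ≤ z}
        ≤ π₂.real {x | T x + D x ≤ z - (a + b + e)}
          + π₂.real {x | |T x + D x - z| ≤ a + b + e} := by
      refine union₂ π₂ fun x hx => ?_
      have hx' : T x + D x ≤ z := hx
      by_cases h : T x + D x ≤ z - (a + b + e)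
      · exact Or.inl h
      · refine Or.inr (?_ : |T x + D x - z| ≤ a + b + e)
        rw [abs_of_nonpos (by linarith)]; linarith
    have h5 : π₂.real {x | T x + D x ≤ z - (a + b + e)}
        ≤ π₂.real {x | e ≤ |D x|} + π₂.real {x | T x ≤ z - a - b} := by
      refine union₂ π₂ fun x hx => ?_
      by_cases h : e ≤ |D x|
      · exact Or.inl h
      · have hx' : T x + D x ≤ z - (a + b + e) := hx
        refine Or.inr (?_ : T x ≤ z - a - b)
        linarith [hD h]
    have h4 := hlow π₂ (z - a - b)
    have h3 := (abs_le.1 (hL (z - a - b))).1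
    have h2 := hup π₁ (z - a - b)
    rw [sub_add_cancel] at h2
    have h1 : π₁.real {x | T x ≤ z - a}
        ≤ π₁.real {x | a ≤ |D x|} + π₁.real {x | T x + D x ≤ z} := by
      refine union₂ π₁ fun x hx => ?_
      by_cases h : a ≤ |D x|
      · exact Or.inl h
      · have hx' : T x ≤ z - a := hx
        refine Or.inr (?_ : T x + D x ≤ z)
        linarith [hD h]
    linarith [hA z]

/-- Sharpening the step to width b multiplies the order-q constant by b^(-q), the origin of the term
Δ_q/h^q. -/
theorem taylor_rescale {g g₁ g₂ : ℝ → ℝ} {K q b : ℝ} (hb : 0 < b)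
    (hg : ∀ a y, |g (a + y) - g a - g₁ a * y - g₂ a * y ^ 2 / 2| ≤ K * |y| ^ q) (z a y : ℝ) :
    |g ((a + y - z) / b) - g ((a - z) / b) - g₁ ((a - z) / b) / b * y
        - g₂ ((a - z) / b) / b ^ 2 * y ^ 2 / 2| ≤ K / b ^ q * |y| ^ q := by
  have h := hg ((a - z) / b) (y / b)
  rw [← add_div, show a - z + y = a + y - z by ring, abs_div, abs_of_pos hb,
    Real.div_rpow (abs_nonneg _) hb.le] at h
  refine le_trans (le_of_eq ?_) (h.trans_eq (by ring))
  congr 1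
  field_simp

namespace ManovaModel

variable (M : ManovaModel)

/-- Chebyshev's inequality: the summands are independent and centred since E⟨x, x⟩ = tr Σ. The law κ
is general because both the innovations and the Gaussian rows are needed. -/
theorem measureReal_le_abs_diagForm_le (κ : Measure (EuclideanSpace ℝ (Fin M.d)))
    [IsProbabilityMeasure κ] (hκ : HasCenteredCov κ M.Sigma)
    (h2 : MemLp (fun x => inner ℝ x x) 2 κ) {c : ℝ} (hc : 0 < c) :
    (Measure.pi fun _ : Fin M.n => κ).real {x | c ≤ |M.diagForm x|}
      ≤ (∑ i, M.P i i ^ 2) * Var[fun x => inner ℝ x x; κ] / c ^ 2 := by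
  have hY : ∀ i, MemLp (fun x : EuclideanSpace ℝ (Fin M.d) =>
      M.P i i * (inner ℝ x x - M.Sigma.trace)) 2 κ := fun i =>
    (h2.sub (memLp_const _)).const_mul _
  have e : M.diagForm = ∑ i : Fin M.n, fun x : Fin M.n → EuclideanSpace ℝ (Fin M.d) =>
      (fun y => M.P i i * (inner ℝ y y - M.Sigma.trace)) (x i) := by
    ext x; simp [diagForm]
  have hYi : ∀ i, MemLp (fun x : Fin M.n → EuclideanSpace ℝ (Fin M.d) =>
      M.P i i * (inner ℝ (x i) (x i) - M.Sigma.trace)) 2 (Measure.pi fun _ : Fin M.n => κ) :=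
    fun i => (hY i).comp_measurePreserving
      (measurePreserving_eval (fun _ : Fin M.n => κ) i)
  have hD : MemLp M.diagForm 2 (Measure.pi fun _ : Fin M.n => κ) := by
    unfold diagForm
    exact memLp_finsetSum _ fun i _ => hYi i
  have hmean : ∫ x, M.diagForm x ∂(Measure.pi fun _ : Fin M.n => κ) = 0 := by
    unfold diagForm
    rw [integral_finsetSum _ fun i _ => (hYi i).integrable (by norm_num)]
    refine Finset.sum_eq_zero fun i _ => ?_
    rw [integral_const_mul, integral_comp_eval (μ := fun _ : Fin M.n => κ)
      (f := fun y : EuclideanSpace ℝ (Fin M.d) => inner ℝ y y - M.Sigma.trace) (by fun_prop),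
      integral_sub hκ.integrable_inner_self (integrable_const _), hκ.integral_inner_self]
    simp
  have hvar : Var[M.diagForm; Measure.pi fun _ : Fin M.n => κ]
      = (∑ i, M.P i i ^ 2) * Var[fun x => inner ℝ x x; κ] := by
    rw [e, variance_sum_pi (X := fun i y => M.P i i * (inner ℝ y y - M.Sigma.trace)) hY,
      Finset.sum_mul]
    refine Finset.sum_congr rfl fun i _ => ?_
    rw [variance_const_mul, variance_sub_const h2.aestronglyMeasurable]
  have h := meas_ge_le_variance_div_sq hD hc
  rw [hmean, hvar] at h
  simp only [sub_zero] at h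
  rw [Measure.real]
  refine ENNReal.toReal_le_of_le_ofReal ?_ h
  have := variance_nonneg (fun x : EuclideanSpace ℝ (Fin M.d) => inner ℝ x x) κ
  positivity

end ManovaModel

/-! ### Bounding the replacement error by Δ_q -/

/-- Monotonicity of `ℓ^p` norms on a finite set, from exponent `2`. -/
theorem sum_abs_rpow_le_sum_sq_rpow {ι : Type*} (s : Finset ι) (a : ι → ℝ) {q : ℝ} (hq : 2 ≤ q) :
    ∑ i ∈ s, |a i| ^ q ≤ (∑ i ∈ s, a i ^ 2) ^ (q / 2) := by
  have e : ∀ i, |a i| ^ q = (a i ^ 2) * (a i ^ 2) ^ (q / 2 - 1) := by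
    intro i
    rcases eq_or_ne (a i) 0 with h | h
    · simp [h, Real.zero_rpow (by linarith : q ≠ 0)]
    · have hp : 0 < a i ^ 2 := by positivity
      rw [Real.rpow_sub_one hp.ne', mul_div_cancel₀ _ hp.ne', ← sq_abs, ← Real.rpow_two,
        ← Real.rpow_mul (abs_nonneg _)]
      congr 1; ring
  have hS : 0 ≤ ∑ i ∈ s, a i ^ 2 := Finset.sum_nonneg fun i _ => sq_nonneg _
  calc _ ≤ ∑ i ∈ s, a i ^ 2 * (∑ i ∈ s, a i ^ 2) ^ (q / 2 - 1) := by
        refine Finset.sum_le_sum fun i hi => ?_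
        rw [e i]
        refine mul_le_mul_of_nonneg_left ?_ (sq_nonneg _)
        exact Real.rpow_le_rpow (sq_nonneg _) (Finset.single_le_sum (f := fun i => a i ^ 2)
          (fun i _ => sq_nonneg _) hi) (by linarith)
    _ = _ := by
        rw [← Finset.sum_mul]
        rcases hS.eq_or_lt with h | h
        · rw [← h, Real.zero_rpow (by linarith : q / 2 ≠ 0), zero_mul]
        · rw [Real.rpow_sub_one h.ne', mul_div_cancel₀ _ h.ne']

namespace ManovaModel

variable (M : ManovaModel)

theorem sum_offDiag_rpow {q : ℝ} (hq : 0 < q) (i : Fin M.n) :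
    ∑ j, |M.offDiag i j| ^ q = ∑ j ∈ Finset.univ.erase i, |M.P i j| ^ q := by
  rw [← Finset.add_sum_erase _ _ (Finset.mem_univ i), M.offDiag_diag, abs_zero,
    Real.zero_rpow hq.ne', zero_add]
  refine Finset.sum_congr rfl fun j hj => ?_
  rw [offDiag_apply, if_neg (Finset.ne_of_mem_erase hj).symm]

/-- The ℓ^q norm is below the ℓ² norm, and the squares of row i sum to P_ii. Off-diagonal weights
can therefore be charged to the `Lq` term of `Delta`. -/
theorem sum_offDiag_rpow_le {q : ℝ} (hq : 2 ≤ q) (i : Fin M.n) :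
    ∑ j ∈ Finset.univ.erase i, |M.P i j| ^ q ≤ M.P i i ^ (q / 2) := by
  rw [← M.sum_offDiag_rpow (by linarith)]
  refine (sum_abs_rpow_le_sum_sq_rpow _ _ hq).trans ?_
  exact Real.rpow_le_rpow (Finset.sum_nonneg fun j _ => sq_nonneg _) (M.sum_offDiag_sq_le i)
    (by linarith)

theorem vsig_rpow_mul_Mq {q : ℝ} :
    ∫⁻ x, ∫⁻ y, ENNReal.ofReal (|inner ℝ x y| ^ q) ∂M.ν ∂M.ν
      = ENNReal.ofReal (M.vsig ^ q) * M.Mq q := by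
  have hm : Measurable fun z : EuclideanSpace ℝ (Fin M.d) × EuclideanSpace ℝ (Fin M.d) =>
      ENNReal.ofReal (|inner ℝ z.1 z.2| ^ q) := by fun_prop
  rw [← lintegral_prod (fun z => ENNReal.ofReal (|inner ℝ z.1 z.2| ^ q)) hm.aemeasurable, Mq,
    ← lintegral_const_mul' _ _ ENNReal.ofReal_ne_top]
  have hv := M.vsig_pos
  refine lintegral_congr fun z => ?_
  rw [← ENNReal.ofReal_mul (by positivity), abs_div, abs_of_pos hv,
    Real.div_rpow (abs_nonneg _) hv.le, mul_div_cancel₀ _ (by positivity)]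

theorem vsig_rpow_mul_Lq {q : ℝ} :
    ∫⁻ x, ENNReal.ofReal ((x.ofLp ⬝ᵥ M.Sigma *ᵥ x.ofLp) ^ (q / 2)) ∂M.ν
      = ENNReal.ofReal (M.vsig ^ q) * M.Lq q := by
  rw [Lq, ← lintegral_const_mul' _ _ ENNReal.ofReal_ne_top]
  have hv := M.vsig_pos
  refine lintegral_congr fun x => ?_
  have h0 := dotProduct_mulVec_nonneg M.hasCenteredCov.posSemidef x.ofLp
  have e : (M.vsig ^ 2) ^ (q / 2) = M.vsig ^ q := by
    rw [← Real.rpow_two, ← Real.rpow_mul hv.le]; congr 1; ring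
  rw [← ENNReal.ofReal_mul (by positivity), abs_div, abs_of_nonneg h0, abs_of_pos (by positivity),
    Real.div_rpow h0 (by positivity), e, mul_div_cancel₀ _ (by positivity)]

/-- The variable xᵀΣx/ς² has mean one, and its power q/2 ≥ 1 cannot have smaller mean. This lets
`Lq` absorb the absolute constants of the Gaussian moments. -/
theorem one_le_Lq {q : ℝ} (hq : 2 ≤ q) : 1 ≤ M.Lq q := by
  have hv := M.vsig_pos
  have h1 : ∫⁻ x, ENNReal.ofReal ((x.ofLp ⬝ᵥ M.Sigma *ᵥ x.ofLp) / M.vsig ^ 2) ∂M.ν = 1 := by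
    rw [← ofReal_integral_eq_lintegral_ofReal
      (M.hasCenteredCov.integrable_dotProduct_mulVec.div_const _)
      (ae_of_all _ fun x => div_nonneg
        (dotProduct_mulVec_nonneg M.hasCenteredCov.posSemidef x.ofLp) (by positivity)),
      integral_div, M.hasCenteredCov.integral_dotProduct_mulVec, ← M.vsig_sq,
      div_self (by positivity), ENNReal.ofReal_one]
  -- Bernoulli's inequality pu ≤ u^p + (p − 1) with p = q/2, integrated; this arrangement avoids
  -- truncated subtraction.
  have h2 : ENNReal.ofReal (q / 2) * 1 ≤ M.Lq q + ENNReal.ofReal (q / 2 - 1) := by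
    rw [← h1, ← lintegral_const_mul' _ _ ENNReal.ofReal_ne_top, Lq]
    have e : ENNReal.ofReal (q / 2 - 1) = ∫⁻ _, ENNReal.ofReal (q / 2 - 1) ∂M.ν := by simp
    rw [e, ← lintegral_add_right _ measurable_const]
    refine lintegral_mono fun x => ?_
    have h0 : 0 ≤ (x.ofLp ⬝ᵥ M.Sigma *ᵥ x.ofLp) / M.vsig ^ 2 := div_nonneg
        (dotProduct_mulVec_nonneg M.hasCenteredCov.posSemidef x.ofLp) (by positivity)
    rw [← ENNReal.ofReal_mul (by positivity), ← ENNReal.ofReal_add (by positivity) (by linarith),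
      abs_of_nonneg h0]
    refine ENNReal.ofReal_le_ofReal ?_
    have := one_add_mul_self_le_rpow_one_add
      (s := (x.ofLp ⬝ᵥ M.Sigma *ᵥ x.ofLp) / M.vsig ^ 2 - 1) (by linarith)
      (p := q / 2) (by linarith)
    rw [add_sub_cancel] at this
    linarith
  have e : ENNReal.ofReal (q / 2) * 1 = 1 + ENNReal.ofReal (q / 2 - 1) := by
    rw [mul_one, ← ENNReal.ofReal_one, ← ENNReal.ofReal_add zero_le_one (by linarith)]
    congr 1; ring
  rw [e] at h2
  exact (ENNReal.add_le_add_iff_right ENNReal.ofReal_ne_top).1 h2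

theorem lintegral_dotProduct_rpow_le {q : ℝ} (hq : 2 ≤ q) (hq4 : q ≤ 4)
    {κ : Measure (EuclideanSpace ℝ (Fin M.d))}
    (hκ : κ ∈ ({M.ν, multivariateGaussian 0 M.Sigma} :
      Set (Measure (EuclideanSpace ℝ (Fin M.d))))) :
    ∫⁻ x, ENNReal.ofReal ((x.ofLp ⬝ᵥ M.Sigma *ᵥ x.ofLp) ^ (q / 2)) ∂κ
      ≤ ENNReal.ofReal gaussianFourthMoment * (ENNReal.ofReal (M.vsig ^ q) * M.Lq q) := by
  have hκ1 : 1 ≤ ENNReal.ofReal gaussianFourthMoment := by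
    rw [← ENNReal.ofReal_one]; exact ENNReal.ofReal_le_ofReal one_le_gaussianFourthMoment
  have hv := M.vsig_pos
  rcases hκ with rfl | hκ
  · rw [M.vsig_rpow_mul_Lq]
    exact le_mul_of_one_le_left' hκ1
  · rw [Set.mem_singleton_iff.1 hκ]
    refine (lintegral_dotProduct_mulVec_rpow_multivariateGaussian_le M.hasCenteredCov.posSemidef
      (by linarith) (by linarith)).trans ?_
    have e : (M.vsig ^ 2) ^ (q / 2) = M.vsig ^ q := by
      rw [← Real.rpow_two, ← Real.rpow_mul hv.le]; congr 1; ring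
    rw [← M.vsig_sq, e, ENNReal.ofReal_mul (zero_le_one.trans one_le_gaussianFourthMoment)]
    gcongr
    exact le_mul_of_one_le_right' (M.one_le_Lq hq)

/-- `Mq` is needed only when both vectors are innovations. If one is Gaussian, conditioning on the
other vector x leaves a multiple of (xᵀΣx)^(q/2), which `Lq` controls. -/
theorem lintegral_inner_rpow_le {q : ℝ} (hq : 2 ≤ q) (hq4 : q ≤ 4)
    {κ κ' : Measure (EuclideanSpace ℝ (Fin M.d))}
    (hκ : κ ∈ ({M.ν, multivariateGaussian 0 M.Sigma} : Set (Measure (EuclideanSpace ℝ (Fin M.d)))))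
    (hκ' : κ' ∈ ({M.ν, multivariateGaussian 0 M.Sigma} :
      Set (Measure (EuclideanSpace ℝ (Fin M.d))))) :
    ∫⁻ x, ∫⁻ y, ENNReal.ofReal (|inner ℝ x y| ^ q) ∂κ' ∂κ
      ≤ ENNReal.ofReal (M.vsig ^ q) * M.Mq q + ENNReal.ofReal gaussianFourthMoment ^ 2 *
        (ENNReal.ofReal (M.vsig ^ q) * M.Lq q) := by
  have hg : ∀ κ ∈ ({M.ν, multivariateGaussian 0 M.Sigma} :
      Set (Measure (EuclideanSpace ℝ (Fin M.d)))),
      ∫⁻ x, ∫⁻ y, ENNReal.ofReal (|inner ℝ x y| ^ q) ∂(multivariateGaussian 0 M.Sigma) ∂κ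
        ≤ ENNReal.ofReal gaussianFourthMoment ^ 2 *
          (ENNReal.ofReal (M.vsig ^ q) * M.Lq q) := by
    intro κ hκ
    calc _ ≤ ∫⁻ x, ENNReal.ofReal gaussianFourthMoment *
          ENNReal.ofReal ((x.ofLp ⬝ᵥ M.Sigma *ᵥ x.ofLp) ^ (q / 2)) ∂κ := by
          refine lintegral_mono fun x => ?_
          rw [← ENNReal.ofReal_mul (zero_le_one.trans one_le_gaussianFourthMoment)]
          exact lintegral_abs_inner_rpow_multivariateGaussian_le M.hasCenteredCov.posSemidef
            (by linarith) hq4 x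
      _ ≤ _ := by
          rw [lintegral_const_mul' _ _ ENNReal.ofReal_ne_top, sq, mul_assoc]
          gcongr
          exact M.lintegral_dotProduct_rpow_le hq hq4 hκ
  rcases hκ' with rfl | hκ'
  · rcases hκ with rfl | hκ
    · rw [M.vsig_rpow_mul_Mq]; exact le_self_add
    · rw [Set.mem_singleton_iff.1 hκ, lintegral_lintegral_swap
        (f := fun x y => ENNReal.ofReal (|inner ℝ x y| ^ q)) (by fun_prop)]
      simp_rw [real_inner_comm]
      exact (hg _ (Set.mem_insert _ _)).trans le_add_self
  · rw [Set.mem_singleton_iff.1 hκ']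
    exact (hg _ hκ).trans le_add_self

theorem Delta_eq {q : ℝ} :
    ENNReal.ofReal ((M.m : ℝ) ^ (q / 2)) * M.Delta q
      = ENNReal.ofReal (∑ i, ∑ j ∈ Finset.univ.erase i, |M.P i j| ^ q) * M.Mq q
        + ENNReal.ofReal (∑ i, M.P i i ^ (q / 2)) * M.Lq q := by
  have hm : 0 < (M.m : ℝ) ^ (q / 2) := by have := M.m_pos; positivity
  rw [Delta, mul_add, ← mul_assoc, ← mul_assoc, ← ENNReal.ofReal_mul hm.le,
    ← ENNReal.ofReal_mul hm.le, mul_div_cancel₀ _ hm.ne', mul_div_cancel₀ _ hm.ne']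

/-- `Mq` keeps its own off-diagonal weights. The terms in `Lq` arise twice, from the mixed moments
and from the Gaussian part of Rosenthal's bound; both are charged to the diagonal weights, which
gives the factor 2. -/
theorem lindeberg_sum_le {q : ℝ} (hq : 2 ≤ q) :
    ∑ i, (∑ j, ENNReal.ofReal (|M.offDiag i j| ^ q) *
          (ENNReal.ofReal (M.vsig ^ q) * M.Mq q + ENNReal.ofReal gaussianFourthMoment ^ 2 *
            (ENNReal.ofReal (M.vsig ^ q) * M.Lq q))
        + ENNReal.ofReal ((∑ j, M.offDiag i j ^ 2) ^ (q / 2)) *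
          (ENNReal.ofReal gaussianFourthMoment * (ENNReal.ofReal (M.vsig ^ q) * M.Lq q)))
      ≤ ENNReal.ofReal (2 * gaussianFourthMoment ^ 2) *
        (ENNReal.ofReal ((M.vsig * √M.m) ^ q) * M.Delta q) := by
  have hκ1 := one_le_gaussianFourthMoment
  have hκ0 : 0 ≤ gaussianFourthMoment := zero_le_one.trans hκ1
  have hκ : 1 ≤ ENNReal.ofReal gaussianFourthMoment := by
    rw [← ENNReal.ofReal_one]; exact ENNReal.ofReal_le_ofReal hκ1
  set κ := ENNReal.ofReal gaussianFourthMoment with hκdef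
  set v := ENNReal.ofReal (M.vsig ^ q)
  set A₁ := ENNReal.ofReal (∑ i, ∑ j ∈ Finset.univ.erase i, |M.P i j| ^ q) with hA₁
  set A₂ := ENNReal.ofReal (∑ i, M.P i i ^ (q / 2)) with hA₂
  have hv := M.vsig_pos
  have hP := M.P_diag_nonneg
  have es : ENNReal.ofReal ((M.vsig * √M.m) ^ q) = v * ENNReal.ofReal ((M.m : ℝ) ^ (q / 2)) := by
    rw [Real.mul_rpow hv.le (Real.sqrt_nonneg _), ENNReal.ofReal_mul (by positivity),
      Real.sqrt_eq_rpow, ← Real.rpow_mul (Nat.cast_nonneg _)]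
    congr 3; ring
  have e2 : ENNReal.ofReal (2 * gaussianFourthMoment ^ 2) = 2 * κ ^ 2 := by
    rw [ENNReal.ofReal_mul zero_le_two, ENNReal.ofReal_pow hκ0]; simp [hκdef]
  rw [es, mul_assoc v, M.Delta_eq, e2]
  have hA12 : A₁ ≤ A₂ :=
    ENNReal.ofReal_le_ofReal (Finset.sum_le_sum fun i _ => M.sum_offDiag_rpow_le hq i)
  have s1 : ∑ i, ∑ j, ENNReal.ofReal (|M.offDiag i j| ^ q) = A₁ := by
    rw [hA₁, ENNReal.ofReal_sum_of_nonneg fun i _ => Finset.sum_nonneg fun j _ => by positivity]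
    refine Finset.sum_congr rfl fun i _ => ?_
    rw [← M.sum_offDiag_rpow (by linarith), ENNReal.ofReal_sum_of_nonneg fun j _ => by positivity]
  have s2 : ∑ i, ENNReal.ofReal ((∑ j, M.offDiag i j ^ 2) ^ (q / 2)) ≤ A₂ := by
    rw [hA₂, ENNReal.ofReal_sum_of_nonneg fun i _ => Real.rpow_nonneg (hP i) _]
    refine Finset.sum_le_sum fun i _ => ENNReal.ofReal_le_ofReal ?_
    exact Real.rpow_le_rpow (Finset.sum_nonneg fun j _ => sq_nonneg _) (M.sum_offDiag_sq_le i)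
      (by linarith)
  rw [Finset.sum_add_distrib]
  simp_rw [← Finset.sum_mul]
  rw [s1]
  calc _ ≤ A₁ * (v * M.Mq q + κ ^ 2 * (v * M.Lq q)) + A₂ * (κ * (v * M.Lq q)) := by gcongr
    _ ≤ A₁ * (v * M.Mq q) + A₂ * (κ ^ 2 * (v * M.Lq q)) + A₂ * (κ ^ 2 * (v * M.Lq q)) := by
        have hκ2 : κ ≤ κ ^ 2 := by rw [sq]; exact le_mul_of_one_le_left' hκ
        rw [mul_add]
        gcongr
    _ ≤ 2 * κ ^ 2 * (A₁ * (v * M.Mq q)) + A₂ * (κ ^ 2 * (v * M.Lq q))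
        + A₂ * (κ ^ 2 * (v * M.Lq q)) := by
        have h1 : 1 ≤ 2 * κ ^ 2 := by
          calc (1 : ℝ≥0∞) = 1 * 1 ^ 2 := by norm_num
            _ ≤ 2 * κ ^ 2 := by gcongr; norm_num
        have h2 : A₁ * (v * M.Mq q) ≤ 2 * κ ^ 2 * (A₁ * (v * M.Mq q)) :=
          le_mul_of_one_le_left' h1
        gcongr
    _ = _ := by ring

end ManovaModel

/-! ### Choice of scales and the Gaussian approximation bound -/

/-- Only a lower bound on h is required, so a scale may be enlarged to stay positive when x = 0. -/
theorem div_rpow_le_of_rpow_le {x h a r : ℝ} (hx : 0 ≤ x) (hr : 0 ≤ r)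
    (hxh : x ^ a ≤ h) : x / h ^ r ≤ x ^ (1 - a * r) := by
  rcases hx.eq_or_lt with rfl | hx
  · rw [zero_div]; exact Real.rpow_nonneg le_rfl _
  · rw [Real.rpow_sub hx, Real.rpow_one, Real.rpow_mul hx.le]
    gcongr

namespace ManovaModel

variable (M : ManovaModel)

theorem sum_P_diag_sq_pos : 0 < ∑ i, M.P i i ^ 2 := by
  refine (Finset.sum_nonneg fun i _ => sq_nonneg _).lt_of_ne fun h => ?_
  have h0 := (Finset.sum_eq_zero_iff_of_nonneg fun i _ => sq_nonneg (M.P i i)).1 h.symm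
  have : ∑ i, M.P i i = 0 := Finset.sum_eq_zero fun i hi => by simpa using h0 i hi
  rw [M.sum_P_diag] at this
  exact M.m_pos.ne' this

theorem leverage_pos : 0 < M.leverage := div_pos M.sum_P_diag_sq_pos M.m_pos

/-- The coefficient of the variance in `Lam` is strictly positive, so the convention 0 · ∞ = 0
cannot hide an infinite variance. -/
theorem memLp_inner_self (h : M.Lam ≠ ⊤) : MemLp (fun x => inner ℝ x x) 2 M.ν := by
  have hm : AEStronglyMeasurable (fun x : EuclideanSpace ℝ (Fin M.d) => inner ℝ x x) M.ν :=
    Measurable.aestronglyMeasurable (by fun_prop)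
  rw [← evariance_lt_top_iff_memLp hm, lt_top_iff_ne_top]
  contrapose h
  have hv := M.vsig_pos
  have hm := M.m_pos
  have hP := M.sum_P_diag_sq_pos
  rw [Lam, h, ENNReal.mul_top (ENNReal.ofReal_pos.2 (by positivity)).ne']
  exact ENNReal.top_rpow_of_pos (by norm_num)

theorem Lam_sq (h : M.Lam ≠ ⊤) :
    M.Lam.toReal ^ 2
      = (∑ i, M.P i i ^ 2) / (M.m * M.vsig ^ 2) * Var[fun x => inner ℝ x x; M.ν] := by
  have hv := M.vsig_pos
  have hm := M.m_pos
  have hP := M.sum_P_diag_sq_pos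
  have hV := variance_nonneg (fun x : EuclideanSpace ℝ (Fin M.d) => inner ℝ x x) M.ν
  have e : M.Lam ^ (2 : ℝ) = ENNReal.ofReal ((∑ i, M.P i i ^ 2) / (M.m * M.vsig ^ 2) *
      Var[fun x => inner ℝ x x; M.ν]) := by
    rw [ENNReal.ofReal_mul (by positivity), ofReal_variance (M.memLp_inner_self h), Lam,
      ← ENNReal.rpow_mul]
    norm_num
  rw [← ENNReal.toReal_ofReal (mul_nonneg (by positivity) hV), ← e, ← ENNReal.toReal_rpow,
    Real.rpow_two]

/-- Swapping with a step of width h s, s = ς√m: the factor s^q in the moment sum cancels the one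
from rescaling, and 44 = 22 · 2. -/
theorem abs_integral_smooth_sub_le {g g₁ g₂ : ℝ → ℝ} (hg : Continuous g)
    (hg0 : ∀ x, 0 ≤ g x) (hg1 : ∀ x, g x ≤ 1) {K q : ℝ} (hK : 0 ≤ K) (hq : 2 < q) (hq' : q ≤ 3)
    (htaylor : ∀ a y, |g (a + y) - g a - g₁ a * y - g₂ a * y ^ 2 / 2| ≤ K * |y| ^ q)
    {h : ℝ} (hh : 0 < h) (hD : M.Delta q ≠ ⊤) (z : ℝ) :
    |∫ x, g ((quadForm M.offDiag x - z) / (h * (M.vsig * √M.m))) ∂(Measure.pi fun _ => M.ν)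
        - ∫ x, g ((quadForm M.offDiag x - z) / (h * (M.vsig * √M.m))) ∂M.gaussLaw|
      ≤ 44 * K * 2 ^ q * gaussianFourthMoment ^ 2 * ((M.Delta q).toReal / h ^ q) := by
  have hκ0 : 0 ≤ gaussianFourthMoment := zero_le_one.trans one_le_gaussianFourthMoment
  set s := M.vsig * √M.m with hs
  have hs0 : 0 < s := mul_pos M.vsig_pos (Real.sqrt_pos.2 M.m_pos)
  have hb : 0 < h * s := mul_pos hh hs0
  have key := ofReal_abs_integral_quadForm_sub_le hq hq' M.offDiag_isHermitian M.offDiag_diag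
    (f := fun x => g ((x - z) / (h * s))) (f₁ := fun x => g₁ ((x - z) / (h * s)) / (h * s))
    (f₂ := fun x => g₂ ((x - z) / (h * s)) / (h * s) ^ 2) (by fun_prop) (fun x => hg0 _)
    (fun x => hg1 _) (K := K / (h * s) ^ q) (by positivity)
    (fun a y => taylor_rescale hb htaylor z a y) M.ν (multivariateGaussian 0 M.Sigma)
    M.hasCenteredCov (hasCenteredCov_multivariateGaussian M.hasCenteredCov.posSemidef)
    (fun κ hκ κ' hκ' => M.lintegral_inner_rpow_le hq.le (by linarith) hκ hκ')
    (fun κ hκ => M.lintegral_dotProduct_rpow_le hq.le (by linarith) hκ)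
  have key2 := key.trans (mul_le_mul_right (M.lindeberg_sum_le hq.le) _)
  rw [← ENNReal.ofReal_toReal hD, ← ENNReal.ofReal_mul (by positivity),
    ← ENNReal.ofReal_mul (by positivity), ← ENNReal.ofReal_mul (by positivity),
    ENNReal.ofReal_le_ofReal_iff (by positivity)] at key2
  refine key2.trans_eq ?_
  rw [← hs, Real.mul_rpow hh.le hs0.le]
  have h1 : 0 < s ^ q := by positivity
  have h2 : 0 < h ^ q := by positivity
  field_simp
  ring

/-- Thresholds are measured in the unit s = ς√m, for which s² = |P|_F² |Σ|_F². The scales h₁, h₂, h₃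
are for the diagonal part of the innovations, the smooth step, and the Gaussian diagonal part. -/
theorem kolmogorovDist_le_of_smoothing {g g₁ g₂ : ℝ → ℝ} (hg : Continuous g)
    (hg0 : ∀ x, 0 ≤ g x) (hg1 : ∀ x, g x ≤ 1) (hgl : ∀ x ≤ 0, g x = 1)
    (hgr : ∀ x, 1 ≤ x → g x = 0) {K q A : ℝ} (hK : 0 ≤ K) (hq : 2 < q) (hq' : q ≤ 3)
    (htaylor : ∀ a y, |g (a + y) - g a - g₁ a * y - g₂ a * y ^ 2 / 2| ≤ K * |y| ^ q)
    (hA : ∀ {n d : ℕ} {P : Matrix (Fin n) (Fin n) ℝ} {S : Matrix (Fin d) (Fin d) ℝ},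
      P.IsHermitian → S.PosSemidef → ∀ τ : ℝ, 0 < τ →
      (∑ i, ∑ j, P i j ^ 2) * (∑ k, ∑ l, S k l ^ 2) = τ ^ 2 → ∀ z h : ℝ, 0 < h →
        (Measure.pi fun _ : Fin n => multivariateGaussian 0 S).real
          {x : Fin n → EuclideanSpace ℝ (Fin d) |
            |∑ i, ∑ j, P i j * inner ℝ (x i) (x j) - z| ≤ h} ≤ A * (h / τ) ^ (1 / 2 : ℝ))
    (hnull : M.NullHypothesis) (hL : M.Lam ≠ ⊤) (hD : M.Delta q ≠ ⊤) {h₁ h₂ h₃ : ℝ}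
    (hh₁ : 0 < h₁) (hh₂ : 0 < h₂) (hh₃ : 0 < h₃) :
    kolmogorovDist M.Q M.μ M.G M.gaussLaw
      ≤ M.Lam.toReal ^ 2 / h₁ ^ 2 + gaussianFourthMoment * M.leverage / h₃ ^ 2
        + 44 * K * 2 ^ q * gaussianFourthMoment ^ 2 * ((M.Delta q).toReal / h₂ ^ q)
        + A * (h₁ + h₂ + h₃) ^ (1 / 2 : ℝ) := by
  have hv := M.vsig_pos
  have hm := M.m_pos
  set s := M.vsig * √M.m with hs
  have hs0 : 0 < s := mul_pos hv (Real.sqrt_pos.2 hm)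
  have hs2 : s ^ 2 = M.m * M.vsig ^ 2 := by rw [hs, mul_pow, Real.sq_sqrt hm.le]; ring
  have hS := M.hasCenteredCov.posSemidef
  have hcov := hasCenteredCov_multivariateGaussian hS
  have hprob : IsProbabilityMeasure M.gaussLaw := by unfold gaussLaw; infer_instance
  have anti : ∀ z, M.gaussLaw.real {x | |quadForm M.offDiag x + M.diagForm x - z|
      ≤ h₁ * s + h₂ * s + h₃ * s} ≤ A * (h₁ + h₂ + h₃) ^ (1 / 2 : ℝ) := by
    intro z
    have h := hA M.P_isHermitian hS s hs0
      (by rw [M.sum_sum_P_sq, ← M.vsig_sq, hs2]) (z + M.m * M.Sigma.trace)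
      (h₁ * s + h₂ * s + h₃ * s) (by positivity)
    rw [show (h₁ * s + h₂ * s + h₃ * s) / s = h₁ + h₂ + h₃ by field_simp] at h
    refine le_trans (le_of_eq ?_) h
    congr 1
    ext x
    have e : ∑ i, ∑ j, M.P i j * inner ℝ (x i) (x j) = quadForm M.P x := rfl
    simp only [Set.mem_ofPred_eq]
    rw [e, M.quadForm_P, add_sub_add_right_eq_sub]
  have cheb₁ : (Measure.pi fun _ : Fin M.n => M.ν).real {x | h₁ * s ≤ |M.diagForm x|}
      ≤ M.Lam.toReal ^ 2 / h₁ ^ 2 := by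
    refine (M.measureReal_le_abs_diagForm_le M.ν M.hasCenteredCov (M.memLp_inner_self hL)
      (mul_pos hh₁ hs0)).trans_eq ?_
    rw [M.Lam_sq hL, mul_pow, hs2]
    field_simp
  -- A Gaussian vector has a fourth moment, so its squared norm is square integrable.
  have hmem : MemLp (fun x => inner ℝ x x) 2 (multivariateGaussian 0 M.Sigma) := by
    have h := (IsGaussian.memLp_id (multivariateGaussian 0 M.Sigma) 4 (by simp)).norm_rpow_div 2
    have e : (4 : ℝ≥0∞) / 2 = 2 := by
      rw [show (4 : ℝ≥0∞) = 2 * 2 by norm_num]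
      exact ENNReal.mul_div_cancel_right two_ne_zero ENNReal.ofNat_ne_top
    rw [e] at h
    refine h.congr_norm (Measurable.aestronglyMeasurable (by fun_prop)) (ae_of_all _ fun x => ?_)
    simp
  have cheb₂ : M.gaussLaw.real {x | h₃ * s ≤ |M.diagForm x|}
      ≤ gaussianFourthMoment * M.leverage / h₃ ^ 2 := by
    refine (M.measureReal_le_abs_diagForm_le _ hcov hmem (mul_pos hh₃ hs0)).trans ?_
    have hvar := variance_inner_self_multivariateGaussian_le hS
    rw [← M.vsig_sq] at hvar
    have hP := M.sum_P_diag_sq_pos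
    calc _ ≤ (∑ i, M.P i i ^ 2) * (gaussianFourthMoment * M.vsig ^ 2) / (h₃ * s) ^ 2 := by gcongr
      _ = _ := by rw [leverage, mul_pow, hs2]; field_simp
  refine ciSup_le fun z => ?_
  have e₁ : M.μ.real {ω | M.Q ω ≤ z} = (Measure.pi fun _ : Fin M.n => M.ν).real
      {x | quadForm M.offDiag x + M.diagForm x ≤ z - M.m * M.Sigma.trace} := by
    have hms : MeasurableSet {x : Fin M.n → EuclideanSpace ℝ (Fin M.d) |
        quadForm M.offDiag x + M.diagForm x ≤ z - M.m * M.Sigma.trace} :=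
      measurableSet_le (by fun_prop) measurable_const
    rw [← M.hasLaw_V_pi.measureReal_eq hms]
    congr 1
    ext ω
    simp only [Set.mem_ofPred_eq]
    rw [M.Q_eq hnull, M.quadForm_P, le_sub_iff_add_le]
  have e₂ : M.gaussLaw.real {x | M.G x ≤ z} = M.gaussLaw.real
      {x | quadForm M.offDiag x + M.diagForm x ≤ z - M.m * M.Sigma.trace} := by
    congr 1
    ext x
    simp only [Set.mem_ofPred_eq]
    rw [M.G_eq, M.quadForm_P, le_sub_iff_add_le]
  rw [e₁, e₂]
  refine (abs_measureReal_sub_le_of_smooth (measurable_quadForm _) hg hg0 hg1 hgl hgr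
    (mul_pos hh₂ hs0) (fun z => M.abs_integral_smooth_sub_le hg hg0 hg1 hK hq hq' htaylor
      hh₂ hD z) anti _).trans ?_
  linarith

theorem approxBound_eq_ofReal (hL : M.Lam ≠ ⊤) {q : ℝ} (hq : 0 ≤ q) (hD : M.Delta q ≠ ⊤)
    (C₁ Cq C₂ : ℝ≥0) :
    M.approxBound C₁ Cq C₂ q = ENNReal.ofReal (C₁ * M.Lam.toReal ^ (2 / 5 : ℝ)
      + Cq * (M.Delta q).toReal ^ (1 / (2 * q + 1)) + C₂ * M.leverage ^ (1 / 5 : ℝ)) := by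
  have hl := M.leverage_pos
  rw [ENNReal.ofReal_add (by positivity) (by positivity),
    ENNReal.ofReal_add (by positivity) (by positivity), ENNReal.ofReal_mul (by positivity),
    ENNReal.ofReal_mul (by positivity), ENNReal.ofReal_mul (by positivity),
    ← ENNReal.ofReal_rpow_of_nonneg (by positivity) (by positivity),
    ← ENNReal.ofReal_rpow_of_nonneg (by positivity) (by positivity),
    ← ENNReal.ofReal_rpow_of_nonneg (by positivity) (by positivity), ENNReal.ofReal_toReal hL,
    ENNReal.ofReal_toReal hD, ENNReal.ofReal_coe_nnreal, ENNReal.ofReal_coe_nnreal,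
    ENNReal.ofReal_coe_nnreal, approxBound]

theorem exists_kolmogorovDist_le_approxBound : ∃ C₁ C₂ : ℝ≥0, 0 < C₁ ∧ 0 < C₂ ∧
    ∀ q : ℝ, 2 < q → q ≤ 3 → ∃ Cq : ℝ≥0, 0 < Cq ∧ ∀ M : ManovaModel, M.NullHypothesis →
      ENNReal.ofReal (kolmogorovDist M.Q M.μ M.G M.gaussLaw) ≤ M.approxBound C₁ Cq C₂ q := by
  obtain ⟨g, g₁, g₂, K, hK, hg, hg0, hg1, hgl, hgr, htaylor⟩ := exists_smooth_step
  obtain ⟨A, hA, hanti⟩ := exists_gaussian_quadraticForm_anticoncentration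
  have hκ := zero_lt_one.trans_le one_le_gaussianFourthMoment
  -- Each constant adds the coefficient of its direct error to its share of anti-concentration; the
  -- 3 counts the copies of leverage^(2/5) in the three scales.
  refine ⟨(1 + A).toNNReal, (gaussianFourthMoment + 3 * A).toNNReal,
    Real.toNNReal_pos.2 (by positivity),
    Real.toNNReal_pos.2 (by positivity), fun q hq hq' => ?_⟩
  refine ⟨(44 * K * 2 ^ q * gaussianFourthMoment ^ 2 + A).toNNReal,
    Real.toNNReal_pos.2 (by positivity), fun M hnull => ?_⟩
  -- With Λ or Δ infinite the bound is infinite, since its constants are nonzero.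
  by_cases hL : M.Lam = ⊤
  · refine le_top.trans_eq ?_
    rw [approxBound, hL, ENNReal.top_rpow_of_pos (by norm_num), ENNReal.mul_top, top_add, top_add]
    exact ENNReal.coe_ne_zero.2 (Real.toNNReal_pos.2 (by positivity)).ne'
  by_cases hD : M.Delta q = ⊤
  · refine le_top.trans_eq ?_
    rw [approxBound, hD, ENNReal.top_rpow_of_pos (by positivity), ENNReal.mul_top, add_top, top_add]
    exact ENNReal.coe_ne_zero.2 (Real.toNNReal_pos.2 (by positivity)).ne'
  rw [M.approxBound_eq_ofReal hL (by linarith) hD]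
  refine ENNReal.ofReal_le_ofReal ?_
  rw [Real.coe_toNNReal _ (by positivity), Real.coe_toNNReal _ (by positivity),
    Real.coe_toNNReal _ (by positivity)]
  have hl := M.leverage_pos
  set l := M.leverage
  set x := M.Lam.toReal with hx
  set δ := (M.Delta q).toReal with hδ
  have hx0 : 0 ≤ x := ENNReal.toReal_nonneg
  have hδ0 : 0 ≤ δ := ENNReal.toReal_nonneg
  have hl5 : 0 < l ^ (2 / 5 : ℝ) := by positivity
  -- The scales solve Λ²/h² = h^(1/2), Δ/h^q = h^(1/2) and leverage/h² = h^(1/2). Adding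
  -- leverage^(2/5) keeps the first two positive when Λ or Δ vanishes.
  refine (M.kolmogorovDist_le_of_smoothing hg hg0 hg1 hgl hgr hK.le hq hq' (htaylor q hq.le hq')
    hanti hnull hL hD (h₁ := x ^ (4 / 5 : ℝ) + l ^ (2 / 5 : ℝ))
    (h₂ := δ ^ (2 / (2 * q + 1)) + l ^ (2 / 5 : ℝ)) (h₃ := l ^ (2 / 5 : ℝ))
    (by positivity) (by positivity) hl5).trans ?_
  have b₁ : x ^ 2 / (x ^ (4 / 5 : ℝ) + l ^ (2 / 5 : ℝ)) ^ 2 ≤ x ^ (2 / 5 : ℝ) := by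
    have h := div_rpow_le_of_rpow_le (x := x ^ 2) (h := x ^ (4 / 5 : ℝ) + l ^ (2 / 5 : ℝ))
      (a := 2 / 5) (r := 2) (by positivity) (by norm_num) (by
        rw [← Real.rpow_two, ← Real.rpow_mul hx0]
        norm_num [hl5.le])
    rw [Real.rpow_two] at h
    refine h.trans_eq ?_
    rw [← Real.rpow_two, ← Real.rpow_mul hx0]
    norm_num
  have b₂ : l / (l ^ (2 / 5 : ℝ)) ^ 2 ≤ l ^ (1 / 5 : ℝ) := by
    have h := div_rpow_le_of_rpow_le (a := 2 / 5) (r := 2) hl.le (by norm_num) le_rfl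
    rw [Real.rpow_two] at h
    refine h.trans_eq ?_
    norm_num
  have b₃ : δ / (δ ^ (2 / (2 * q + 1)) + l ^ (2 / 5 : ℝ)) ^ q ≤ δ ^ (1 / (2 * q + 1)) := by
    refine (div_rpow_le_of_rpow_le (r := q) (a := 2 / (2 * q + 1)) hδ0
      (by linarith) (by linarith)).trans_eq ?_
    congr 1
    field_simp
    ring
  -- Subadditivity of the square root separates the scales.
  have b₄ : (x ^ (4 / 5 : ℝ) + l ^ (2 / 5 : ℝ) + (δ ^ (2 / (2 * q + 1)) + l ^ (2 / 5 : ℝ))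
        + l ^ (2 / 5 : ℝ)) ^ (1 / 2 : ℝ)
      ≤ x ^ (2 / 5 : ℝ) + δ ^ (1 / (2 * q + 1)) + 3 * l ^ (1 / 5 : ℝ) := by
    have sub : ∀ {a b : ℝ}, 0 ≤ a → 0 ≤ b →
        (a + b) ^ (1 / 2 : ℝ) ≤ a ^ (1 / 2 : ℝ) + b ^ (1 / 2 : ℝ) := fun ha hb =>
      Real.rpow_add_le_add_rpow ha hb (by norm_num) (by norm_num)
    have e₁ : (x ^ (4 / 5 : ℝ)) ^ (1 / 2 : ℝ) = x ^ (2 / 5 : ℝ) := by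
      rw [← Real.rpow_mul hx0]; norm_num
    have e₂ : (l ^ (2 / 5 : ℝ)) ^ (1 / 2 : ℝ) = l ^ (1 / 5 : ℝ) := by
      rw [← Real.rpow_mul hl.le]; norm_num
    have e₃ : (δ ^ (2 / (2 * q + 1))) ^ (1 / 2 : ℝ) = δ ^ (1 / (2 * q + 1)) := by
      rw [← Real.rpow_mul hδ0]; congr 1; field_simp
    have p₁ : 0 ≤ x ^ (4 / 5 : ℝ) := by positivity
    have p₃ : 0 ≤ δ ^ (2 / (2 * q + 1)) := by positivity
    have i₁ := sub (add_nonneg (add_nonneg p₁ hl5.le) (add_nonneg p₃ hl5.le)) hl5.le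
    have i₂ := sub (add_nonneg p₁ hl5.le) (add_nonneg p₃ hl5.le)
    have i₃ := sub p₁ hl5.le
    have i₄ := sub p₃ hl5.le
    rw [e₁, e₂] at i₃
    rw [e₃, e₂] at i₄
    rw [e₂] at i₁
    linarith
  have hc : 0 ≤ 44 * K * 2 ^ q * gaussianFourthMoment ^ 2 := by positivity
  rw [mul_div_assoc]
  have m₁ := mul_le_mul_of_nonneg_left b₂ hκ.le
  have m₂ := mul_le_mul_of_nonneg_left b₃ hc
  have m₃ := mul_le_mul_of_nonneg_left b₄ hA.le
  linarith

end ManovaModel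

/-! ### Normal limit when the diagonal part dominates -/

namespace ManovaModel

variable (M : ManovaModel)

/-- The off-diagonal part is of order at most ς√m with second moments alone, because P has squared
Frobenius norm m. -/
theorem memLp_quadForm_offDiag :
    MemLp (quadForm M.offDiag) 2 (Measure.pi fun _ : Fin M.n => M.ν) ∧
    ∫ x, quadForm M.offDiag x ^ 2 ∂(Measure.pi fun _ : Fin M.n => M.ν)
      ≤ (2 * (M.vsig * √M.m)) ^ 2 := by
  have h := lintegral_quadForm_sq_le M.offDiag_isHermitian M.offDiag_diag M.ν M.hasCenteredCov
  have hm : AEStronglyMeasurable (fun x : Fin M.n → EuclideanSpace ℝ (Fin M.d) =>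
      quadForm M.offDiag x ^ 2) (Measure.pi fun _ : Fin M.n => M.ν) :=
    ((measurable_quadForm _).pow_const 2).aestronglyMeasurable
  have h0 : 0 ≤ᵐ[Measure.pi fun _ : Fin M.n => M.ν]
      fun x : Fin M.n → EuclideanSpace ℝ (Fin M.d) => quadForm M.offDiag x ^ 2 :=
    ae_of_all _ fun x => sq_nonneg _
  refine ⟨(memLp_two_iff_integrable_sq (measurable_quadForm _).aestronglyMeasurable).2 ⟨hm, ?_⟩, ?_⟩
  · rw [hasFiniteIntegral_iff_ofReal h0]
    exact h.trans_lt ENNReal.ofReal_lt_top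
  · rw [integral_eq_lintegral_of_nonneg_ae h0 hm]
    refine ENNReal.toReal_le_of_le_ofReal (sq_nonneg _) (h.trans (ENNReal.ofReal_le_ofReal ?_))
    rw [← M.vsig_sq, mul_pow, mul_pow, Real.sq_sqrt M.m_pos.le]
    have := M.sum_sum_offDiag_sq_le
    calc _ ≤ 4 * (M.m : ℝ) * M.vsig ^ 2 := by gcongr
      _ = _ := by ring

theorem integral_inner_self_V (i : Fin M.n) :
    ∫ ω, inner ℝ (M.V i ω) (M.V i ω) ∂M.μ = M.Sigma.trace := by
  have h := (M.hasLaw_V i).integral_comp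
    (f := fun x : EuclideanSpace ℝ (Fin M.d) => inner ℝ x x)
    (Measurable.aestronglyMeasurable (by fun_prop))
  rw [M.hasCenteredCov.integral_inner_self] at h
  exact h

theorem W_eq (i : Fin M.n) (ω : M.Ω) :
    M.W i ω = M.P i i * (inner ℝ (M.V i ω) (M.V i ω) - M.Sigma.trace) / M.scale := by
  rw [W, integral_const_mul, M.integral_inner_self_V, mul_sub]

theorem iIndepFun_W : iIndepFun M.W M.μ := by
  have h := M.indep_V.comp (fun i (x : EuclideanSpace ℝ (Fin M.d)) =>
    M.P i i * (inner ℝ x x - M.Sigma.trace) / M.scale) (fun i => by fun_prop)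
  convert h using 2 with i
  ext ω
  exact M.W_eq i ω

theorem aemeasurable_normalized (hnull : M.NullHypothesis) :
    AEMeasurable (fun ω => (M.Q ω - M.m * M.Sigma.trace) / M.scale) M.μ := by
  simp_rw [M.Q_eq hnull]
  exact (((measurable_quadForm _).comp_aemeasurable M.hasLaw_V_pi.aemeasurable).sub_const
    _).div_const _

theorem normalized_eq (hnull : M.NullHypothesis) (ω : M.Ω) :
    (M.Q ω - M.m * M.Sigma.trace) / M.scale
      = ∑ i, M.W i ω + quadForm M.offDiag (fun i => M.V i ω) / M.scale := by
  simp_rw [M.W_eq]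
  rw [← Finset.sum_div, M.Q_eq hnull, M.quadForm_P, diagForm]
  ring

theorem memLp_W (hL : M.Lam ≠ ⊤) (i : Fin M.n) : MemLp (M.W i) 2 M.μ := by
  have h1 := M.memLp_inner_self hL
  rw [← (M.hasLaw_V i).map_eq] at h1
  have h2 := h1.comp_of_map (M.hasLaw_V i).aemeasurable
  have h3 := ((h2.sub (memLp_const M.Sigma.trace)).const_mul (M.P i i)).mul_const M.scale⁻¹
  convert h3 using 1
  ext ω
  rw [M.W_eq]; rfl

theorem integral_W (i : Fin M.n) : ∫ ω, M.W i ω ∂M.μ = 0 := by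
  have h := M.hasCenteredCov.integrable_inner_self
  rw [← (M.hasLaw_V i).map_eq] at h
  have h2 : Integrable (fun ω => inner ℝ (M.V i ω) (M.V i ω)) M.μ :=
    h.comp_aemeasurable (M.hasLaw_V i).aemeasurable
  simp_rw [M.W_eq]
  rw [integral_div, integral_const_mul, integral_sub h2 (integrable_const _),
    M.integral_inner_self_V]
  simp

theorem integral_W_sq (hL : M.Lam ≠ ⊤) (i : Fin M.n) :
    ∫ ω, M.W i ω ^ 2 ∂M.μ
      = M.P i i ^ 2 * Var[fun x => inner ℝ x x; M.ν] / M.scale ^ 2 := by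
  have h := (M.hasLaw_V i).integral_comp
    (f := fun x : EuclideanSpace ℝ (Fin M.d) => (inner ℝ x x - M.Sigma.trace) ^ 2)
    (Measurable.aestronglyMeasurable (by fun_prop))
  rw [variance_eq_integral (M.memLp_inner_self hL).aemeasurable,
    M.hasCenteredCov.integral_inner_self, ← h, ← integral_const_mul, ← integral_div]
  refine integral_congr_ae (ae_of_all _ fun ω => ?_)
  simp only [M.W_eq, div_pow, mul_pow, Function.comp]

/-- Λ ς√m is the standard deviation of the diagonal part; Λ must be finite and nonzero for the
normalization to have meaning. -/
theorem sum_integral_W_sq (hL : M.Lam ≠ ⊤) (hL0 : M.Lam ≠ 0) :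
    ∑ i, ∫ ω, M.W i ω ^ 2 ∂M.μ = 1 := by
  have hpos : 0 < M.Lam.toReal := ENNReal.toReal_pos hL0 hL
  have hv := M.vsig_pos
  have hm := M.m_pos
  simp_rw [M.integral_W_sq hL]
  have h := M.Lam_sq hL
  have e : M.scale ^ 2 = M.Lam.toReal ^ 2 * (M.m * M.vsig ^ 2) := by
    rw [scale, mul_pow, mul_pow, Real.sq_sqrt hm.le]; ring
  have e2 : (∑ i, M.P i i ^ 2) * Var[fun x => inner ℝ x x; M.ν]
      = M.Lam.toReal ^ 2 * (M.m * M.vsig ^ 2) := by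
    rw [h]; field_simp
  rw [← Finset.sum_div, ← Finset.sum_mul, e2, e, div_self (by positivity)]

/-- The first term is the cost of dropping the off-diagonal part, whose L¹ norm after normalization
is at most 2/Λ; the others come from the central limit theorem for the W_i. -/
theorem norm_charFun_normalized_sub_le (hnull : M.NullHypothesis) (hL : M.Lam ≠ ⊤)
    (hL0 : M.Lam ≠ 0) (t : ℝ) {ε : ℝ} (hε : 0 < ε) :
    ‖charFun (M.μ.map fun ω => (M.Q ω - M.m * M.Sigma.trace) / M.scale) t
        - Complex.exp ((-(t ^ 2 / 2) : ℝ) : ℂ)‖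
      ≤ |t| * (2 * M.Lam.toReal⁻¹) + (6 * |t| ^ 3 * ε
        + 6 * t ^ 2 * (∑ i, ∫ ω in {ω | ε < |M.W i ω|}, M.W i ω ^ 2 ∂M.μ)
        + t ^ 4 * (ε ^ 2 + ∑ i, ∫ ω in {ω | ε < |M.W i ω|}, M.W i ω ^ 2 ∂M.μ)) := by
  have hpos : 0 < M.Lam.toReal := ENNReal.toReal_pos hL0 hL
  have hs0 : 0 < M.vsig * √M.m := mul_pos M.vsig_pos (Real.sqrt_pos.2 M.m_pos)
  have hsc : M.scale = M.Lam.toReal * (M.vsig * √M.m) := by rw [scale, mul_assoc]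
  have hscale : 0 < M.scale := by rw [hsc]; positivity
  have hW : AEMeasurable (fun ω => ∑ i, M.W i ω) M.μ :=
    Finset.aemeasurable_fun_sum _ fun i _ => (M.memLp_W hL i).aestronglyMeasurable.aemeasurable
  obtain ⟨hT, hT2⟩ := M.memLp_quadForm_offDiag
  have ediff : ∀ ω, (M.Q ω - M.m * M.Sigma.trace) / M.scale - ∑ i, M.W i ω
      = quadForm M.offDiag (fun i => M.V i ω) / M.scale := fun ω => by
    rw [M.normalized_eq hnull]; ring
  have hTi : Integrable (fun ω => quadForm M.offDiag (fun i => M.V i ω)) M.μ := by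
    have h := hT.integrable (by norm_num)
    rw [← M.hasLaw_V_pi.map_eq] at h
    exact h.comp_aemeasurable M.hasLaw_V_pi.aemeasurable
  have hTabs : ∫ ω, |quadForm M.offDiag (fun i => M.V i ω)| ∂M.μ ≤ 2 * (M.vsig * √M.m) := by
    have h1 := M.hasLaw_V_pi.integral_comp
      (f := fun x : Fin M.n → EuclideanSpace ℝ (Fin M.d) => |quadForm M.offDiag x|)
      (Measurable.aestronglyMeasurable (by fun_prop))
    have h2 := integral_abs_rpow_le_of_le_two hT (r := 1) (by norm_num) (by norm_num)
    simp only [Real.rpow_one] at h2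
    refine (h1.trans_le h2).trans ?_
    rw [← Real.sqrt_eq_rpow]
    exact Real.sqrt_le_iff.2 ⟨by positivity, hT2⟩
  have hdiff : Integrable (fun ω => (M.Q ω - M.m * M.Sigma.trace) / M.scale - ∑ i, M.W i ω)
      M.μ := by
    simp_rw [ediff]; exact hTi.div_const _
  refine (norm_sub_le_norm_sub_add_norm_sub _ (charFun (M.μ.map fun ω => ∑ i, M.W i ω) t) _).trans
    (add_le_add ?_ ?_)
  · refine (norm_charFun_map_sub_charFun_map_le (M.aemeasurable_normalized hnull) hW hdiff
      t).trans (mul_le_mul_of_nonneg_left ?_ (abs_nonneg _))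
    simp_rw [ediff, abs_div, abs_of_pos hscale]
    rw [integral_div, div_le_iff₀ hscale, hsc]
    refine hTabs.trans_eq ?_
    field_simp
  · exact norm_charFun_sum_sub_gaussian_le M.iIndepFun_W (M.memLp_W hL) M.integral_W
      (M.sum_integral_W_sq hL hL0) t hε

theorem tendstoInDistribution_normalized (M : ℕ → ManovaModel) (hnull : ∀ k, (M k).NullHypothesis)
    (hfin : ∀ᶠ k in atTop, (M k).Lam ≠ ⊤) (hLam : Tendsto (fun k => (M k).Lam) atTop (𝓝 ⊤))
    (hlind : ∀ ε : ℝ, 0 < ε →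
      Tendsto (fun k => ∑ i, ∫ ω in {ω | ε < |(M k).W i ω|}, (M k).W i ω ^ 2 ∂(M k).μ)
        atTop (𝓝 0)) :
    TendstoInDistribution
      (fun k ω => ((M k).Q ω - (M k).m * (M k).Sigma.trace) / (M k).scale)
      atTop (id : ℝ → ℝ) (fun k => (M k).μ) (gaussianReal 0 1) where
  forall_aemeasurable k := (M k).aemeasurable_normalized (hnull k)
  tendsto := by
    refine ProbabilityMeasure.tendsto_iff_tendsto_charFun.2 fun t => ?_
    have hgauss : charFun (gaussianReal 0 1) t = Complex.exp ((-(t ^ 2 / 2) : ℝ) : ℂ) := by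
      rw [charFun_gaussianReal]; simp
    simp only [ProbabilityMeasure.coe_mk, Measure.map_id, hgauss]
    rw [Metric.tendsto_nhds]
    intro η hη
    -- The truncation level is fixed first, making the terms in ε alone small; the Lindeberg sum at
    -- that level and 1/Λ then vanish along the sequence.
    obtain ⟨ε, hε, hεη⟩ : ∃ ε : ℝ, 0 < ε ∧ 6 * |t| ^ 3 * ε + t ^ 4 * ε ^ 2 < η / 2 := by
      have hc : Tendsto (fun ε : ℝ => 6 * |t| ^ 3 * ε + t ^ 4 * ε ^ 2) (𝓝[>] 0) (𝓝 0) := by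
        have : Continuous fun ε : ℝ => 6 * |t| ^ 3 * ε + t ^ 4 * ε ^ 2 := by fun_prop
        have h := this.tendsto 0
        simp only [mul_zero, ne_eq, OfNat.ofNat_ne_zero, not_false_eq_true, zero_pow,
          add_zero] at h
        exact h.mono_left nhdsWithin_le_nhds
      obtain ⟨ε, h1, h2⟩ := ((hc.eventually_lt_const (half_pos hη)).and
        self_mem_nhdsWithin).exists
      exact ⟨ε, h2, h1⟩
    -- The inverse is taken in [0, ∞] first, because `ENNReal.toReal` is continuous at 0 but not at
    -- ∞.
    have hinv : Tendsto (fun k => (M k).Lam.toReal⁻¹) atTop (𝓝 0) := by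
      have h1 : Tendsto (fun k => (M k).Lam⁻¹) atTop (𝓝 0) := by
        simpa using tendsto_inv_iff.2 hLam
      have h2 := (ENNReal.tendsto_toReal ENNReal.zero_ne_top).comp h1
      simpa [Function.comp_def] using h2
    have hrem : Tendsto (fun k => |t| * (2 * (M k).Lam.toReal⁻¹) + (6 * t ^ 2 + t ^ 4) *
        ∑ i, ∫ ω in {ω | ε < |(M k).W i ω|}, (M k).W i ω ^ 2 ∂(M k).μ) atTop (𝓝 0) := by
      have h := ((hinv.const_mul 2).const_mul |t|).add ((hlind ε hε).const_mul (6 * t ^ 2 + t ^ 4))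
      simpa using h
    filter_upwards [hfin, hLam.eventually_ne ENNReal.top_ne_zero,
      hrem.eventually_lt_const (half_pos hη)] with k hk hk0 hkr
    rw [dist_eq_norm]
    refine ((M k).norm_charFun_normalized_sub_le (hnull k) hk hk0 t hε).trans_lt ?_
    linarith

theorem tendsto_approxBound (M : ℕ → ManovaModel) {q : ℝ} (hq : 0 < q) (C₁ Cq C₂ : ℝ≥0)
    (hlev : Tendsto (fun k => (M k).leverage) atTop (𝓝 0))
    (hDelta : Tendsto (fun k => (M k).Delta q) atTop (𝓝 0))
    (hLam : Tendsto (fun k => (M k).Lam) atTop (𝓝 0)) :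
    Tendsto (fun k => (M k).approxBound C₁ Cq C₂ q) atTop (𝓝 0) := by
  have key : ∀ {u : ℕ → ℝ≥0∞} (C : ℝ≥0) {r : ℝ}, 0 < r → Tendsto u atTop (𝓝 0) →
      Tendsto (fun k => (C : ℝ≥0∞) * u k ^ r) atTop (𝓝 0) := by
    intro u C r hr hu
    have h := ENNReal.Tendsto.const_mul (a := (C : ℝ≥0∞))
      ((ENNReal.continuous_rpow_const (y := r)).tendsto 0 |>.comp hu) (Or.inr ENNReal.coe_ne_top)
    simpa [ENNReal.zero_rpow_of_pos hr, Function.comp_def] using h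
  have hlev' : Tendsto (fun k => ENNReal.ofReal (M k).leverage) atTop (𝓝 0) := by
    simpa using ENNReal.tendsto_ofReal hlev
  have h := ((key C₁ (r := 2 / 5) (by norm_num) hLam).add
    (key Cq (r := 1 / (2 * q + 1)) (by positivity) hDelta)).add
    (key C₂ (r := 1 / 5) (by norm_num) hlev')
  simpa [approxBound] using h

end ManovaModel

theorem theorem1 :
    ∃ C₁ C₂ : ℝ≥0, 0 < C₁ ∧ 0 < C₂ ∧
      ∀ δ : ℝ, 0 < δ → δ ≤ 1 → ∃ Cq : ℝ≥0, 0 < Cq ∧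
        ∀ M : ℕ → ManovaModel,
          (∀ k, (M k).NullHypothesis) →
          Tendsto (fun k => (M k).leverage) atTop (𝓝 0) →
          Tendsto (fun k => (M k).Delta (2 + δ)) atTop (𝓝 0) →
          (Tendsto (fun k => (M k).Lam) atTop (𝓝 0) →
            (∀ k, ENNReal.ofReal (kolmogorovDist (M k).Q (M k).μ (M k).G (M k).gaussLaw)
              ≤ (M k).approxBound C₁ Cq C₂ (2 + δ)) ∧
            Tendsto (fun k => (M k).approxBound C₁ Cq C₂ (2 + δ)) atTop (𝓝 0)) ∧
          ((∀ᶠ k in atTop, (M k).Lam ≠ ⊤) →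
            Tendsto (fun k => (M k).Lam) atTop (𝓝 ⊤) →
            (∀ ε : ℝ, 0 < ε →
              Tendsto (fun k => ∑ i, ∫ ω in {ω | ε < |(M k).W i ω|}, (M k).W i ω ^ 2 ∂(M k).μ)
                atTop (𝓝 0)) →
            TendstoInDistribution
              (fun k ω => ((M k).Q ω - (M k).m * (M k).Sigma.trace) / (M k).scale)
              atTop (id : ℝ → ℝ) (fun k => (M k).μ) (gaussianReal 0 1)) := by
  obtain ⟨C₁, C₂, h₁, h₂, H⟩ := ManovaModel.exists_kolmogorovDist_le_approxBound
  refine ⟨C₁, C₂, h₁, h₂, fun δ hδ hδ' => ?_⟩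
  obtain ⟨Cq, hq, HM⟩ := H (2 + δ) (by linarith) (by linarith)
  refine ⟨Cq, hq, fun M hnull hlev hDelta => ⟨fun hLam => ⟨fun k => HM (M k) (hnull k), ?_⟩,
    fun hfin hLam hlind => ?_⟩⟩
  · exact ManovaModel.tendsto_approxBound M (by linarith) C₁ Cq C₂ hlev hDelta hLam
  · exact ManovaModel.tendstoInDistribution_normalized M hnull hfin hLam hlind
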